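/- Let $g\ge 0$, let $\Sigma=\Sigma_{g,1}$ be a compact connected oriented surface of genus $g$ with one boundary component, and let $\pi=\pi_1(\Sigma,*)$ with $*\in\partial\Sigma$. Thus $\pi$ is free on standard generators $\alpha_1,\beta_1,\dots,\alpha_g,\beta_g$ for which the boundary loop is $\zeta=\prod_{i=1}^g[\alpha_i,\beta_i]$. Let $I$ be the augmentation ideal of $\mathbb{Q}\pi$, let $\widehat{\mathbb{Q}\pi}=\varprojlim_m\mathbb{Q}\pi/I^m$ with the filtration $\widehat{I^m}=\ker(\widehat{\mathbb{Q}\pi}\to\mathbb{Q}\pi/I^m)$ and the corresponding topology, and let $\Delta$ be the complete coproduct induced by $\Delta(x)=x\otimes x$ for $x\in\pi$. The Malcev completion of $\pi$ is the group $\widehat\pi$ of (non-zero) elements $x\in\widehat{\mathbb{Q}\pi}$ with $\Delta(x)=x\,\widehat\otimes\,x$; it contains $\pi$ and is filtered by the subgroups $\widehat\pi_m=\widehat\pi\cap(1+\widehat{I^m})$. The generalized mapping class group of $\Sigma$ is the group $\widehat{\mathcal M}=\mathrm{Aut}_\partial(\widehat\pi)$ of automorphisms $u$ of the filtered group $\widehat\pi$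 (that is, $u(\widehat\pi_m)=\widehat\pi_m$ for all $m$) such that $u(\zeta)=\zeta$. For $k\ge 0$ let $\widehat{\mathcal M}[k]$ be the subgroup of those $u$ that act trivially modulo $\widehat{I^{k+1}}$, i.e. $u(x)-x\in\widehat{I^{k+1}}$ for all $x\in\widehat\pi$. Give $\widehat{\mathcal M}$ the topology for which the cosets $u\,\widehat{\mathcal M}[k]$ form a basis of open sets (the topology of the Johnson filtration). For a free loop $\alpha$ and a based loop $\beta$ in $\Sigma$ in general position, let $$\sigma(\alpha)(\beta)=\sum_{p\in\alpha\cap\beta}\varepsilon_p\,\beta_{*p}\,\alpha_p\,\beta_{p*}\in\mathbb{Q}\pi,$$ where $\varepsilon_p=\pm1$ is the local intersection number of $\alpha$ and $\beta$ at $p$, $\beta_{*p}$ and $\beta_{p*}$ are the parts of $\beta$ before and after $p$, and $\alpha_p$ is $\alpha$ based at $p$. This depends only on the homotopy classes; extend it bilinearly to linear combinations of free loops and of based loops. For a closed curve $\gamma$ in $\Sigma$, write $(\log\gamma)^2=\sum_{k\ge 2}c_k(\gamma-1)^k$, where $\log(1+X)^2=\sum_{k\ge2}c_kX^k$, let $\sigma((\log\gamma)^2)$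 be the continuous linear endomorphism of $\widehat{\mathbb{Q}\pi}$ given on $v\in\mathbb{Q}\pi$ by the convergent sum $\sum_k c_k\,\sigma((\gamma-1)^k)(v)$, and for $r\in\mathbb{Q}$ put $$t_{r,\gamma}=\exp\bigl(r\,\sigma((\log\gamma)^2)\bigr).$$ Then, for every closed curve $\gamma$ in $\Sigma$ and every $r\in\mathbb{Q}$, this exponential series converges pointwise on $\widehat{\mathbb{Q}\pi}$ to an algebra automorphism that restricts to a (unique) element $t_{r,\gamma}$ of $\widehat{\mathcal M}$. Moreover, the group $\widehat{\mathcal M}$ is topologically generated by these elements: the subgroup generated by all $t_{r,\gamma}$, with $\gamma$ a closed curve in $\Sigma$ and $r\in\mathbb{Q}$, is dense in $\widehat{\mathcal M}$. -/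

import Mathlib

open scoped TensorProduct

noncomputable section

namespace GenTwist

/-! ## Completion of an augmented algebra -/

section Completion

variable {B C : Type*} [Ring B] [Algebra ℚ B] [Ring C] [Algebra ℚ C]

/-- The augmentation ideal of a `ℚ`-algebra `B` with augmentation `ε : B → ℚ`. -/
abbrev augIdeal (ε : B →ₐ[ℚ] ℚ) : Ideal B := RingHom.ker ε

/-- The completion `lim_m B / I ^ m` of an augmented algebra, `I` being the augmentation ideal:
the algebra of compatible sequences. -/
def Completion (ε : B →ₐ[ℚ] ℚ) : Subalgebra ℚ (∀ m : ℕ, B ⧸ augIdeal ε ^ m) where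
  carrier := {x | ∀ m n (h : m ≤ n),
    Ideal.Quotient.factor (Ideal.pow_le_pow_right h) (x n) = x m}
  mul_mem' hx hy m n h := by
    simp only [Set.mem_ofPred_eq] at hx hy
    rw [Pi.mul_apply, map_mul, hx m n h, hy m n h, Pi.mul_apply]
  add_mem' hx hy m n h := by
    simp only [Set.mem_ofPred_eq] at hx hy
    rw [Pi.add_apply, map_add, hx m n h, hy m n h, Pi.add_apply]
  algebraMap_mem' _ _ _ _ := rfl

/-- The canonical homomorphism from an augmented algebra to its completion. -/
def toCompletion (ε : B →ₐ[ℚ] ℚ) : B →ₐ[ℚ] Completion ε :=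
  AlgHom.codRestrict (AlgHom.pi fun m => Ideal.Quotient.mkₐ ℚ (augIdeal ε ^ m))
    (Completion ε) fun _ _ _ _ => rfl

/-- The projection of the completion onto `B / I ^ m`. -/
def Completion.proj (ε : B →ₐ[ℚ] ℚ) (m : ℕ) : Completion ε →ₐ[ℚ] B ⧸ augIdeal ε ^ m :=
  (Pi.evalAlgHom ℚ (fun m : ℕ => B ⧸ augIdeal ε ^ m) m).comp (Completion ε).val

/-- The `m`-th term of the natural filtration of the completion: the kernel of the projection
onto `B / I ^ m`. -/
def Completion.filt (ε : B →ₐ[ℚ] ℚ) (m : ℕ) : Ideal (Completion ε) :=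
  RingHom.ker (Completion.proj ε m)

/-- The topology of the completion given by its filtration, that is, the inverse limit topology
for the discrete topologies on the quotients `B / I ^ m`. -/
instance (ε : B →ₐ[ℚ] ℚ) : TopologicalSpace (Completion ε) :=
  ⨅ m : ℕ, TopologicalSpace.induced (Completion.proj ε m) ⊥

theorem augIdeal_pow_le {εB : B →ₐ[ℚ] ℚ} {εC : C →ₐ[ℚ] ℚ} (f : B →ₐ[ℚ] C)
    (hf : εC.comp f = εB) (m : ℕ) : augIdeal εB ^ m ≤ (augIdeal εC ^ m).comap f := by
  have h1 : augIdeal εB ≤ (augIdeal εC).comap f := by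
    intro x hx
    have hx' : εB x = 0 := hx
    rw [← hf] at hx'
    exact hx'
  induction m with
  | zero =>
    intro x _
    rw [Ideal.mem_comap, Submodule.pow_zero, Ideal.one_eq_top]
    trivial
  | succ m ih =>
    rw [Ideal.IsTwoSided.pow_succ, Ideal.mul_le]
    intro a ha b hb
    rw [Ideal.mem_comap, map_mul, Ideal.IsTwoSided.pow_succ]
    exact Ideal.mul_mem_mul (h1 ha) (ih hb)

/-- Functoriality of the completion for homomorphisms of augmented algebras. -/
def Completion.map {εB : B →ₐ[ℚ] ℚ} {εC : C →ₐ[ℚ] ℚ} (f : B →ₐ[ℚ] C)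
    (hf : εC.comp f = εB) : Completion εB →ₐ[ℚ] Completion εC :=
  AlgHom.codRestrict
    (AlgHom.pi fun m =>
      (Ideal.quotientMapₐ (augIdeal εC ^ m) f (augIdeal_pow_le f hf m)).comp
        (Completion.proj εB m))
    (Completion εC) (by
      rintro ⟨x, hx⟩ m n h
      obtain ⟨b, hb⟩ := Ideal.Quotient.mk_surjective (x n)
      have hm : x m = Ideal.Quotient.mk _ b := by rw [← hx m n h, ← hb]; rfl
      change Ideal.Quotient.factor _ (Ideal.quotientMapₐ _ f (augIdeal_pow_le f hf n) (x n)) =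
        Ideal.quotientMapₐ _ f (augIdeal_pow_le f hf m) (x m)
      rw [hm, ← hb]
      rfl)

end Completion

/-! ## The surface `Σ_{g,1}` cut open along arcs

Let `α_1, β_1, …, α_g, β_g` be the standard free basis of `π₁(Σ_{g,1}, *)`, with `*` on the
boundary.  There are `2 g` disjoint proper arcs in the surface such that each of these loops
crosses exactly one arc, exactly once.  Cutting along the arcs gives a disc, a polygon having two
sides for each arc, which are glued by an orientation-reversing homeomorphism; between consecutive
sides there are pieces of the boundary of the surface, one of which contains `*`.  Going around
the disc counterclockwise from `*`, the sides are met in the following order, for `i = 1, …, g`: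
the side through which `α_i` leaves the disc, the side through which `β_i` enters it, the side
through which `α_i` enters it, the side through which `β_i` leaves it.  The boundary curve of the
surface, followed from `*` with the surface on its left, then reads `∏ [α_i, β_i]`. -/

/-- The names of the loops `α_i` (`Sum.inl i`) and `β_i` (`Sum.inr i`). -/
abbrev Gen (g : ℕ) : Type := Fin g ⊕ Fin g

/-- The fundamental group of `Σ_{g,1}`, free on the `α_i` and `β_i`. -/
abbrev Pi1 (g : ℕ) : Type := FreeGroup (Gen g)

/-- The boundary element `ζ = [α_1, β_1] ⋯ [α_g, β_g]`. -/
def boundary (g : ℕ) : Pi1 g :=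
  (List.ofFn fun i : Fin g =>
    FreeGroup.of (Sum.inl i : Gen g) * FreeGroup.of (Sum.inr i) *
      (FreeGroup.of (Sum.inl i))⁻¹ * (FreeGroup.of (Sum.inr i))⁻¹).prod

/-- A passage through one of the arcs: `(x, true)` in the direction of the loop `x`, and
`(x, false)` in the direction of `x⁻¹`.  A curve in general position with respect to the arcs is
recorded by the word of its passages. -/
abbrev Passage (g : ℕ) : Type := Gen g × Bool

/-- The passage in the opposite direction. -/
def Passage.rev {g : ℕ} (l : Passage g) : Passage g := (l.1, !l.2)

/-- The rank, counterclockwise from `*`, of the side of the polygon through which a passage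
leaves it.  The passage enters the polygon again through the side `side l.rev`. -/
def side {g : ℕ} : Passage g → ℕ
  | (Sum.inl i, true) => 4 * i
  | (Sum.inr i, false) => 4 * i + 1
  | (Sum.inl i, false) => 4 * i + 2
  | (Sum.inr i, true) => 4 * i + 3

/-- Position on the boundary circle of the polygon (counterclockwise from `*`, which has position
`0`) of the points where a free loop passes through the side `side l`.  A free loop and a based
loop are always drawn in such a way that on each arc all points of the free loop precede all
points of the based loop; since the two sides of an arc are glued by reversing the orientation,
this gives one order on the sides where generators leave and the other order on the sides where
they enter. -/
def freePos {g : ℕ} (l : Passage g) : ℕ := 2 * side l + (if l.2 then 1 else 2)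

/-- Position of the points where a based loop passes through the side `side l`. -/
def basedPos {g : ℕ} (l : Passage g) : ℕ := 2 * side l + (if l.2 then 2 else 1)

/-- `1` if `r` lies strictly between `p` and `q` (where `p < q`), and `0` otherwise. -/
def between (p q r : ℕ) : ℤ := if p < r ∧ r < q then 1 else 0

/-- The local intersection number of the oriented chord of a disc from `p` to `q` with the
oriented chord from `r` to `s`, where `p, q, r, s` are positions on the boundary circle, in
counterclockwise order: `1` if the second chord crosses the first one from right to left, `-1` if
it crosses from left to right, `0` if they do not cross. -/
def chordSign (p q r s : ℕ) : ℤ :=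
  (between p q r - between p q s) - (between q p r - between q p s)

/-- The group algebra `ℚ π`. -/
abbrev GrpAlg (g : ℕ) : Type := MonoidAlgebra ℚ (Pi1 g)

/-- The action `σ(α)(β) = ∑_p ε_p β_{*p} α_p β_{p*}` of a free loop `α` on a based loop `β`, both
given by words.  The `i`-th chord of `α` (cyclically) precedes its `i`-th passage, and `α` read
from there is `a.rotate i`.  The `j`-th chord of `β` comes after `β.take j` and precedes
`β.drop j`; its first chord starts at `*` and its last chord ends at `*`. -/
def sigmaWord {g : ℕ} (a b : List (Passage g)) : GrpAlg g :=
  ∑ i ∈ Finset.range a.length, ∑ j ∈ Finset.range (b.length + 1),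
    ((chordSign
      ((a.rotate i).getLast?.elim 0 fun l => freePos l.rev)
      ((a.rotate i).head?.elim 0 freePos)
      ((b.take j).getLast?.elim 0 fun l => basedPos l.rev)
      ((b.drop j).head?.elim 0 basedPos) : ℤ) : ℚ) •
    MonoidAlgebra.of ℚ (Pi1 g)
      (FreeGroup.mk (b.take j) * FreeGroup.mk (a.rotate i) * FreeGroup.mk (b.drop j))

/-- The action `σ(u)(v)`, extended bilinearly to `ℚ π`.  (A free loop is represented by any element
of its conjugacy class in `π`, and a linear combination of free loops by an element of `ℚ π`.) -/
def sigma {g : ℕ} (u v : GrpAlg g) : GrpAlg g :=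
  u.coeff.sum fun a c => v.coeff.sum fun b d => (c * d) • sigmaWord a.toWord b.toWord

/-! ## The complete Hopf algebra and the Malcev completion -/

/-- The augmentation of `ℚ π`. -/
abbrev aug (g : ℕ) : GrpAlg g →ₐ[ℚ] ℚ := Bialgebra.counitAlgHom ℚ (GrpAlg g)

/-- The augmentation `ε ⊗ ε` of `ℚ π ⊗ ℚ π`.  The `m`-th power of its kernel is
`∑_{i + j = m} I ^ i ⊗ I ^ j`. -/
abbrev augTensor (g : ℕ) : GrpAlg g ⊗[ℚ] GrpAlg g →ₐ[ℚ] ℚ :=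
  Algebra.TensorProduct.lift (aug g) (aug g) fun _ _ => Commute.all _ _

/-- The `I`-adic completion of `ℚ π`. -/
abbrev Hat (g : ℕ) : Type := Completion (aug g)

/-- The completed tensor square of the completion of `ℚ π`. -/
abbrev HatTensor (g : ℕ) : Type := Completion (augTensor g)

/-- The coproduct of the complete Hopf algebra, induced by `Δ(x) = x ⊗ x` for `x ∈ π`. -/
def comulHat (g : ℕ) : Hat g →ₐ[ℚ] HatTensor g :=
  Completion.map (Bialgebra.comulAlgHom ℚ (GrpAlg g)) (by
    apply MonoidAlgebra.algHom_ext
    · intro x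
      simp
    · ext)

/-- The map `x ↦ x ⊗ 1`. -/
def inlHat (g : ℕ) : Hat g →ₐ[ℚ] HatTensor g :=
  Completion.map Algebra.TensorProduct.includeLeft (by ext; simp)

/-- The map `x ↦ 1 ⊗ x`. -/
def inrHat (g : ℕ) : Hat g →ₐ[ℚ] HatTensor g :=
  Completion.map Algebra.TensorProduct.includeRight (by ext; simp)

theorem inlHat_apply (g : ℕ) (x : Hat g) (m : ℕ) (a : GrpAlg g)
    (ha : Ideal.Quotient.mk (augIdeal (aug g) ^ m) a = x.1 m) :
    (inlHat g x).1 m = Ideal.Quotient.mk (augIdeal (augTensor g) ^ m) (a ⊗ₜ[ℚ] 1) := by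
  change Ideal.quotientMapₐ _ _ (augIdeal_pow_le _ (by ext; simp) m) (x.1 m) = _
  rw [← ha]
  rfl

theorem inrHat_apply (g : ℕ) (x : Hat g) (m : ℕ) (a : GrpAlg g)
    (ha : Ideal.Quotient.mk (augIdeal (aug g) ^ m) a = x.1 m) :
    (inrHat g x).1 m = Ideal.Quotient.mk (augIdeal (augTensor g) ^ m) (1 ⊗ₜ[ℚ] a) := by
  change Ideal.quotientMapₐ _ _ (augIdeal_pow_le _ (by ext; simp) m) (x.1 m) = _
  rw [← ha]
  rfl

theorem inlHat_commute_inrHat (g : ℕ) (x y : Hat g) : Commute (inlHat g x) (inrHat g y) := by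
  apply Subtype.ext
  funext m
  obtain ⟨a, ha⟩ := Ideal.Quotient.mk_surjective (x.1 m)
  obtain ⟨b, hb⟩ := Ideal.Quotient.mk_surjective (y.1 m)
  change (inlHat g x).1 m * (inrHat g y).1 m = (inrHat g y).1 m * (inlHat g x).1 m
  rw [inlHat_apply g x m a ha, inrHat_apply g y m b hb, ← map_mul, ← map_mul]
  simp [Algebra.TensorProduct.tmul_mul_tmul]

/-- The Malcev completion of `π`: the group of group-like elements `Δ(x) = x ⊗ x` of the complete
Hopf algebra.  (A non-zero group-like element has augmentation `1`, hence is invertible.) -/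
def malcev (g : ℕ) : Subgroup (Hat g)ˣ where
  carrier := {x | comulHat g x = inlHat g x * inrHat g x}
  one_mem' := by simp
  mul_mem' {x y} hx hy := by
    simp only [Set.mem_ofPred_eq, Units.val_mul, map_mul] at hx hy ⊢
    rw [hx, hy]
    exact (inlHat_commute_inrHat g y x).symm.mul_mul_mul_comm _ _
  inv_mem' {x} hx := by
    simp only [Set.mem_ofPred_eq] at hx ⊢
    have h : comulHat g (x⁻¹ : (Hat g)ˣ) * comulHat g x = 1 := by
      rw [← map_mul, Units.inv_mul, map_one]
    have h' : comulHat g x * (inlHat g (x⁻¹ : (Hat g)ˣ) * inrHat g (x⁻¹ : (Hat g)ˣ)) = 1 := by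
      rw [hx, (inlHat_commute_inrHat g _ _).symm.mul_mul_mul_comm, ← map_mul, ← map_mul,
        Units.mul_inv, map_one, map_one, one_mul]
    exact left_inv_eq_right_inv h h'

/-- The canonical homomorphism from `π` to its Malcev completion. -/
def toMalcev (g : ℕ) : Pi1 g →* malcev g :=
  (Units.map ((toCompletion (aug g) : GrpAlg g →* Hat g).comp
      (MonoidAlgebra.of ℚ (Pi1 g)))).comp (toUnits (G := Pi1 g)).toMonoidHom |>.codRestrict
    (malcev g) (by
      intro x
      apply Subtype.ext
      funext m
      change Ideal.Quotient.mk (augIdeal (augTensor g) ^ m)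
          (Bialgebra.comulAlgHom ℚ (GrpAlg g) (MonoidAlgebra.of ℚ _ x)) =
        Ideal.Quotient.mk (augIdeal (augTensor g) ^ m)
            (MonoidAlgebra.of ℚ _ x ⊗ₜ[ℚ] (1 : GrpAlg g)) *
          Ideal.Quotient.mk (augIdeal (augTensor g) ^ m)
            ((1 : GrpAlg g) ⊗ₜ[ℚ] MonoidAlgebra.of ℚ _ x)
      rw [← map_mul]
      simp)

/-- The underlying element of the complete Hopf algebra. -/
abbrev malcevVal {g : ℕ} (x : malcev g) : Hat g := ((x : (Hat g)ˣ) : Hat g)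

/-- The `m`-th term `π̂ ∩ (1 + Î^m)` of the filtration of the Malcev completion. -/
def malcevFilt (g m : ℕ) : Set (malcev g) :=
  {x | malcevVal x - 1 ∈ Completion.filt (aug g) m}

/-! ## The generalized mapping class group -/

/-- The generalized mapping class group `Aut_∂(π̂)`: the automorphisms of the filtered group `π̂`
that fix the boundary element `ζ`. -/
def GenMCG (g : ℕ) : Subgroup (MulAut (malcev g)) where
  carrier := {u | (∀ m x, u x ∈ malcevFilt g m ↔ x ∈ malcevFilt g m) ∧
    u (toMalcev g (boundary g)) = toMalcev g (boundary g)}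
  one_mem' := ⟨fun _ _ => Iff.rfl, rfl⟩
  mul_mem' {u v} hu hv := by
    refine ⟨fun m x => (hu.1 m (v x)).trans (hv.1 m x), ?_⟩
    rw [MulAut.mul_apply, hv.2, hu.2]
  inv_mem' {u} hu := by
    refine ⟨fun m x => ?_, ?_⟩
    · rw [← hu.1 m, MulAut.apply_inv_self]
    · nth_rw 1 [← hu.2]
      rw [MulAut.inv_apply_self]

/-- The Johnson filtration: the `k`-th term acts trivially modulo `Î^{k+1}`. -/
def johnson (g k : ℕ) : Subgroup (GenMCG g) where
  carrier := {u | ∀ x : malcev g,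
    malcevVal (u.1 x) - malcevVal x ∈ Completion.filt (aug g) (k + 1)}
  one_mem' x := by simp
  mul_mem' {u v} hu hv x := by
    have h := add_mem (hu (v.1 x)) (hv x)
    rwa [sub_add_sub_cancel] at h
  inv_mem' {u} hu x := by
    have h := neg_mem (hu (u.1⁻¹ x))
    rwa [MulAut.apply_inv_self, neg_sub] at h

theorem johnson_anti (g : ℕ) : Antitone (johnson g) := by
  intro k l h u hu x
  have hx : (malcevVal (u.1 x) - malcevVal x).1 (l + 1) = 0 := hu x
  change (malcevVal (u.1 x) - malcevVal x).1 (k + 1) = 0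
  rw [← (malcevVal (u.1 x) - malcevVal x).2 (k + 1) (l + 1) (by omega), hx, map_zero]

/-- The topology of the generalized mapping class group given by the Johnson filtration: the
cosets of the terms of the filtration form a basis of open sets. -/
instance (g : ℕ) : TopologicalSpace (GenMCG g) where
  IsOpen U := ∀ u ∈ U, ∃ k, ∀ v, u⁻¹ * v ∈ johnson g k → v ∈ U
  isOpen_univ _ _ := ⟨0, fun _ _ => trivial⟩
  isOpen_inter U V hU hV u hu := by
    obtain ⟨k, hk⟩ := hU u hu.1
    obtain ⟨l, hl⟩ := hV u hu.2
    exact ⟨max k l, fun v hv => ⟨hk v (johnson_anti g (le_max_left k l) hv),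
      hl v (johnson_anti g (le_max_right k l) hv)⟩⟩
  isOpen_sUnion S hS u hu := by
    obtain ⟨U, hU, huU⟩ := hu
    obtain ⟨k, hk⟩ := hS U hU u huU
    exact ⟨k, fun v hv => ⟨U, hU, hk v hv⟩⟩

/-! ## Rational powers of generalized Dehn twists -/

/-- `D` is the operator `σ(f(γ))` on the completion of `ℚ π`, where `f = ∑ c_k (x - 1)^k` is given
by the power series `∑ c_k X^k`: it is the continuous linear map whose value at `v ∈ ℚ π` is the
convergent sum `∑ c_k σ((γ - 1)^k)(v)`. -/
def IsSigmaSeries {g : ℕ} (f : PowerSeries ℚ) (γ : Pi1 g) (D : Hat g →L[ℚ] Hat g) : Prop :=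
  ∀ v : GrpAlg g,
    HasSum (fun k : ℕ => PowerSeries.coeff k f •
      toCompletion (aug g) (sigma ((MonoidAlgebra.of ℚ (Pi1 g) γ - 1) ^ k) v))
    (D (toCompletion (aug g) v))

/-- `t` is the element `t_{r,γ} = exp (r σ((log γ)²))` of the generalized mapping class group:
the exponential series converges on the completion of `ℚ π` to an algebra automorphism which
restricts to `t` on the Malcev completion.  (`PowerSeries.log ℚ` is `log (1 + X)`.) -/
def IsRationalTwist {g : ℕ} (r : ℚ) (γ : Pi1 g) (t : GenMCG g) : Prop :=
  ∃ (D : Hat g →L[ℚ] Hat g) (T : Hat g ≃ₐ[ℚ] Hat g),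
    IsSigmaSeries (PowerSeries.log ℚ ^ 2) γ D ∧
    (∀ x : Hat g, HasSum (fun n : ℕ => (r ^ n / n.factorial : ℚ) • (D^[n]) x) (T x)) ∧
    ∀ x : malcev g, T (malcevVal x) = malcevVal (t.1 x)

end GenTwist

end

open GenTwist

/-!
The action `σ` of a free loop on based loops is a derivation of the group algebra `A` of `π`, with
values on the generators given by sums of cyclic Fox derivatives (`sigmaL_of`). This formula shows
that `σ(u)` kills the boundary element (`sigmaL_boundary`), that it maps `I ^ n` to `I ^ (m + n - 2)`
if `u ∈ I ^ m` (`sigmaL_mem`), and that its leading terms on `α_i` and `β_i` are, up to sign, the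
cyclic derivatives of `u` with respect to `β_i` and `α_i` (`sigmaL_inl_congr`, `sigmaL_inr_congr`).

*Existence of the twists.* The cyclic derivatives of `(log γ) ^ 2` are combinations of conjugates of
`2 log γ`, which is primitive. Therefore `σ((log γ) ^ 2)` is compatible with the coproduct
(`comul_sigmaL_congr`). It acts on homology by `a ↦ 2 ω(a, γ) γ`, whose square is zero, and so it is
nilpotent modulo every power of `I` (`exists_iterate_sigmaL_mem`). Its exponential is an automorphism
of the completion (`expAut`) that preserves the group-like elements, the filtration and the boundary
element (`twistAut_mem`).

*Density.* An element of the generalized mapping class group is trivial up to a given order as soon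
as it is so on the generators of `π`, because in each degree of the filtration a power of an element
of the Malcev completion agrees with an element of `π`, and roots are unique
(`sub_mem_filt_of_gen`). By induction on `n`, an element `w` is corrected by products of twists until
it is trivial up to order `n` on the generators.

On homology `w` preserves the intersection form, and the twists act as the symplectic transvections,
which move any symplectic basis to any other one (`exists_transv_basis`, `exists_twist_two`).

If `w` is trivial up to order `n ≥ 2`, the leading terms `y_x` of `w(x) - x` are primitive, hence Lie
polynomials by the theorems of Friedrichs and Dynkin (`smul_sub_sum_lieMono_mem`). That `w` fixes the
boundary element means that the element `Z` of `I ^ (n + 1)` corresponding to `y` by Poincaré duality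
has a cyclically symmetric leading term. Its cyclic derivatives then are `n + 1` times its coordinates,
and so `y` is the leading term of `σ(Z)` up to the factor `n + 1` (`cyc_sum_congr`,
`exists_displacement_eq`). Here `Z` is a combination of elements `(x - 1) L` with `L` a left-normed
bracket of generators. The bracket `L` is the leading term of an iterated commutator `v` in `π`, and
`(log (x v)) ^ 2 - (log x) ^ 2` has the leading term `(x - 1) L + L (x - 1)`. Consequently the product
of the twist with parameter `r` along `x v` and the one with parameter `-r` along `x` is trivial up to
order `n`, with a leading term that is a polynomial in `r` and has the linear coefficient
`2 σ((x - 1) L)`. A subgroup of a rational vector space that contains all values of such a polynomial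
contains the rational multiples of its linear coefficient (`smul_linear_coeff_mem`). Hence `σ((x - 1) L)`
is realized by products of twists (`smul_sigmaL_mem_twistLead`).
-/

noncomputable section

namespace GenTwist

/-! ### The group algebra and the powers of its augmentation ideal -/

section GroupAlgebra

variable {g : ℕ} {M : Type*} [AddCommGroup M] [Module ℚ M]

/-- The inclusion of `π` into its group algebra. -/
def pt : Pi1 g →* GrpAlg g := MonoidAlgebra.of ℚ (Pi1 g)

@[elab_as_elim]
theorem pt_induction {motive : GrpAlg g → Prop} (a : GrpAlg g) (pt : ∀ v, motive (GenTwist.pt v))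
    (add : ∀ a b, motive a → motive b → motive (a + b))
    (smul : ∀ (c : ℚ) a, motive a → motive (c • a)) : motive a :=
  MonoidAlgebra.induction_on a pt add smul

theorem pt_inv_mul (v : Pi1 g) : pt v⁻¹ * pt v = 1 := by rw [← map_mul, inv_mul_cancel, map_one]

theorem pt_mul_inv (v : Pi1 g) : pt v * pt v⁻¹ = 1 := by rw [← map_mul, mul_inv_cancel, map_one]

theorem pt_inv_mul_cancel_left (v : Pi1 g) (a : GrpAlg g) : pt v⁻¹ * (pt v * a) = a := by
  rw [← mul_assoc, pt_inv_mul, one_mul]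

theorem pt_mul_inv_cancel_left (v : Pi1 g) (a : GrpAlg g) : pt v * (pt v⁻¹ * a) = a := by
  rw [← mul_assoc, pt_mul_inv, one_mul]

@[simp] theorem aug_pt (v : Pi1 g) : aug g (pt v) = 1 := by
  simp [pt]

/-- The linear extension to the group algebra of a function on the group. -/
def linExt (f : Pi1 g → M) : GrpAlg g →ₗ[ℚ] M :=
  (Finsupp.lift M ℚ (Pi1 g) f) ∘ₗ (MonoidAlgebra.coeffLinearEquiv ℚ).toLinearMap

@[simp] theorem linExt_pt (f : Pi1 g → M) (v : Pi1 g) : linExt f (pt v) = f v := by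
  simp [linExt, pt]

theorem linearMap_ext_pt {f h : GrpAlg g →ₗ[ℚ] M} (H : ∀ v, f (pt v) = h (pt v)) : f = h := by
  refine LinearMap.ext fun a => ?_
  induction a using pt_induction with
  | pt v => exact H v
  | add a b ha hb => rw [map_add, map_add, ha, hb]
  | smul c a ha => rw [map_smul, map_smul, ha]

/-- The `m`-th power of the augmentation ideal of the group algebra. -/
abbrev augPow (g m : ℕ) : Ideal (GrpAlg g) := augIdeal (aug g) ^ m

theorem augPow_zero (a : GrpAlg g) : a ∈ augPow g 0 := by
  rw [augPow, Submodule.pow_zero, Ideal.one_eq_top]; trivial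

theorem augPow_anti {m n : ℕ} (h : m ≤ n) {a : GrpAlg g} (ha : a ∈ augPow g n) :
    a ∈ augPow g m :=
  Ideal.pow_le_pow_right h ha

theorem mul_mem_augPow {m n : ℕ} {a b : GrpAlg g} (ha : a ∈ augPow g m) (hb : b ∈ augPow g n) :
    a * b ∈ augPow g (m + n) := by
  rw [augPow, Ideal.IsTwoSided.pow_add]
  exact Ideal.mul_mem_mul ha hb

theorem mul_mem_augPow_of_le {k m n : ℕ} {a b : GrpAlg g} (ha : a ∈ augPow g m)
    (hb : b ∈ augPow g n) (h : k ≤ m + n) : a * b ∈ augPow g k :=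
  augPow_anti h (mul_mem_augPow ha hb)

theorem augPow_mul_right {m : ℕ} {a : GrpAlg g} (b : GrpAlg g) (ha : a ∈ augPow g m) :
    a * b ∈ augPow g m := Ideal.mul_mem_right _ _ ha

theorem augPow_mul_left {m : ℕ} {a : GrpAlg g} (b : GrpAlg g) (ha : a ∈ augPow g m) :
    b * a ∈ augPow g m := Ideal.mul_mem_left _ _ ha

theorem augPow_smul {m : ℕ} {a : GrpAlg g} (c : ℚ) (ha : a ∈ augPow g m) :
    c • a ∈ augPow g m := Submodule.smul_of_tower_mem _ c ha

theorem mem_augPow_one {a : GrpAlg g} : a ∈ augPow g 1 ↔ aug g a = 0 := by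
  rw [augPow, Submodule.pow_one]; rfl

theorem pt_sub_one_mem (v : Pi1 g) : pt v - 1 ∈ augPow g 1 := by
  rw [mem_augPow_one, map_sub, aug_pt, map_one, sub_self]

theorem sub_aug_mem (a : GrpAlg g) : a - aug g a • 1 ∈ augPow g 1 := by
  rw [mem_augPow_one, map_sub, map_smul, map_one, smul_eq_mul, mul_one, sub_self]

/-- The powers of the augmentation ideal as rational subspaces. -/
abbrev augPowQ (g m : ℕ) : Submodule ℚ (GrpAlg g) := (augPow g m).restrictScalars ℚ

/-- The degree one element `x - 1` of the group algebra attached to a generator `x`. -/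
def gX (x : Gen g) : GrpAlg g := pt (FreeGroup.of x) - 1

theorem gX_mem (x : Gen g) : gX x ∈ augPow g 1 := pt_sub_one_mem _

theorem augPow_succ_le_of_pt {S : Submodule ℚ (GrpAlg g)} {m : ℕ}
    (h : ∀ a ∈ augPow g m, ∀ v : Pi1 g, a * (pt v - 1) ∈ S) {b : GrpAlg g}
    (hb : b ∈ augPow g (m + 1)) : b ∈ S := by
  have h2 : ∀ a ∈ augPow g m, ∀ c : GrpAlg g, a * (c - aug g c • 1) ∈ S := by
    intro a ha c
    induction c using pt_induction with
    | pt v => rw [aug_pt, one_smul]; exact h a ha v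
    | add b c hb hc =>
      have := S.add_mem hb hc
      rwa [← mul_add, show b - aug g b • 1 + (c - aug g c • 1) =
        b + c - aug g (b + c) • (1 : GrpAlg g) by rw [map_add, add_smul]; abel] at this
    | smul q c hc =>
      rw [map_smul, smul_assoc, ← smul_sub, mul_smul_comm]
      exact S.smul_mem q hc
  rw [augPow, Ideal.IsTwoSided.pow_add, Submodule.pow_one] at hb
  refine Submodule.smul_induction_on (p := fun b => b ∈ S) hb ?_ fun a b => S.add_mem
  intro a ha c hc
  have hc' : aug g c = 0 := hc
  simpa [hc'] using h2 a ha c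

/-- As a left ideal, `I` is generated by the elements `x - 1`, where `x` is a generator. -/
theorem augPow_succ_le {S : Submodule ℚ (GrpAlg g)} {m : ℕ}
    (h : ∀ a ∈ augPow g m, ∀ x : Gen g, a * gX x ∈ S) {b : GrpAlg g}
    (hb : b ∈ augPow g (m + 1)) : b ∈ S := by
  refine augPow_succ_le_of_pt (fun a ha v => ?_) hb
  induction v using FreeGroup.induction_on generalizing a with
  | C1 => simp
  | of x => exact h a ha x
  | inv_of x _ =>
    have := S.neg_mem (h (a * pt (FreeGroup.of x)⁻¹) (augPow_mul_right _ ha) x)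
    rwa [gX, mul_assoc, mul_sub (pt (FreeGroup.of x)⁻¹), pt_inv_mul, mul_one, ← mul_neg,
      neg_sub] at this
  | mul v w hv hw =>
    have := S.add_mem (hw (a * pt v) (augPow_mul_right _ ha)) (hv a ha)
    rwa [mul_assoc, ← mul_add, mul_sub (pt v), ← map_mul, mul_one, sub_add_sub_cancel] at this

/-! ### Crossed homomorphisms and derivations on the group algebra of a free group -/

/-- A crossed homomorphism on a free group is prescribed by its values on the generators: it is the
translation part of a homomorphism to the affine group of the module. -/
theorem exists_cocycle {α : Type*} (ρ : FreeGroup α →* (M ≃ₗ[ℚ] M)) (f₀ : α → M) :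
    ∃ f : FreeGroup α → M, (∀ x, f (FreeGroup.of x) = f₀ x) ∧
      ∀ v w, f (v * w) = f v + ρ v (f w) := by
  let F : FreeGroup α →* Equiv.Perm M := FreeGroup.lift fun x =>
    (ρ (FreeGroup.of x)).toEquiv.trans (Equiv.addLeft (f₀ x))
  have hF : ∀ v m, F v m = F v 0 + ρ v m := by
    intro v
    induction v using FreeGroup.induction_on with
    | C1 => simp
    | of x => intro m; simp [F]
    | inv_of x ih =>
      intro m
      apply (F (FreeGroup.of x)).injective
      have h0 : ∀ n, F (FreeGroup.of x) (F (FreeGroup.of x)⁻¹ n) = n := fun n => by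
        rw [map_inv]; exact Equiv.apply_symm_apply _ n
      rw [h0, ih, map_add, ← add_assoc, ← ih, h0, zero_add, map_inv]
      exact ((ρ (FreeGroup.of x)).apply_symm_apply m).symm
    | mul v w hv hw =>
      intro m
      rw [map_mul, Equiv.Perm.mul_apply, Equiv.Perm.mul_apply, hv, hw, hv (F w 0), map_add, map_mul,
        add_assoc]
      rfl
  refine ⟨fun v => F v 0, fun x => by simp [F], fun v w => ?_⟩
  change F (v * w) 0 = _
  rw [map_mul, Equiv.Perm.mul_apply, hF]

/-- Left multiplication by a group element, as a linear automorphism of the group algebra. -/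
def leftMulHom (g : ℕ) : Pi1 g →* (GrpAlg g ≃ₗ[ℚ] GrpAlg g) where
  toFun v := LinearEquiv.ofLinearMap (LinearMap.mulLeft ℚ (pt v)) (LinearMap.mulLeft ℚ (pt v⁻¹))
    (by ext; simp [← mul_assoc, pt_mul_inv]) (by ext; simp [← mul_assoc, pt_inv_mul])
  map_one' := by ext; simp
  map_mul' v w := by ext; simp

/-- Conjugation by a group element, as a linear automorphism of the group algebra. -/
def conjHom (g : ℕ) : Pi1 g →* (GrpAlg g ≃ₗ[ℚ] GrpAlg g) where
  toFun v := LinearEquiv.ofLinearMap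
    (LinearMap.mulLeft ℚ (pt v) ∘ₗ LinearMap.mulRight ℚ (pt v⁻¹))
    (LinearMap.mulLeft ℚ (pt v⁻¹) ∘ₗ LinearMap.mulRight ℚ (pt v))
    (by ext; simp [mul_assoc, pt_mul_inv, pt_mul_inv_cancel_left])
    (by ext; simp [mul_assoc, pt_inv_mul, pt_inv_mul_cancel_left])
  map_one' := by ext; simp
  map_mul' v w := by ext; simp [mul_assoc]

/-- A linear endomorphism of the group algebra satisfying the Leibniz rule. -/
def IsDer (D : GrpAlg g →ₗ[ℚ] GrpAlg g) : Prop := ∀ a b, D (a * b) = D a * b + a * D b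

theorem exists_isDer (d : Gen g → GrpAlg g) : ∃ D : GrpAlg g →ₗ[ℚ] GrpAlg g, IsDer D ∧
    ∀ x, D (pt (FreeGroup.of x)) = d x := by
  obtain ⟨f, hf, hf'⟩ := exists_cocycle (conjHom g) fun x => d x * pt (FreeGroup.of x)⁻¹
  refine ⟨linExt fun v => f v * pt v, fun a b => ?_, fun x => ?_⟩
  · induction a using pt_induction with
    | add a a' h h' => simp only [add_mul, map_add, h, h']; abel
    | smul c a h => simp only [smul_mul_assoc, map_smul, h, smul_add]
    | pt v =>
      induction b using pt_induction with
      | add a a' h h' => simp only [mul_add, map_add, h, h']; abel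
      | smul c a h => simp only [mul_smul_comm, map_smul, h, smul_add]
      | pt w =>
        rw [← map_mul, linExt_pt, linExt_pt, linExt_pt, hf', add_mul, map_mul]
        simp [conjHom, mul_assoc, pt_inv_mul_cancel_left]
  · rw [linExt_pt, hf, mul_assoc, pt_inv_mul, mul_one]

theorem IsDer.map_one {D : GrpAlg g →ₗ[ℚ] GrpAlg g} (hD : IsDer D) : D 1 = 0 := by
  have := hD 1 1
  simpa using this

theorem IsDer.map_inv {D : GrpAlg g →ₗ[ℚ] GrpAlg g} (hD : IsDer D) (v : Pi1 g) :
    D (pt v⁻¹) = - (pt v⁻¹ * D (pt v) * pt v⁻¹) := by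
  have h := hD (pt v⁻¹) (pt v)
  rw [pt_inv_mul, hD.map_one] at h
  have h2 : D (pt v⁻¹) * pt v = -(pt v⁻¹ * D (pt v)) := eq_neg_of_add_eq_zero_left h.symm
  calc D (pt v⁻¹) = D (pt v⁻¹) * pt v * pt v⁻¹ := by rw [mul_assoc, pt_mul_inv, mul_one]
    _ = _ := by rw [h2, neg_mul]

theorem IsDer.mem_augPow_of_gen {D : GrpAlg g →ₗ[ℚ] GrpAlg g} (hD : IsDer D) {s : ℕ}
    (h : ∀ x, D (pt (FreeGroup.of x)) ∈ augPow g s) (a : GrpAlg g) : D a ∈ augPow g s := by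
  induction a using pt_induction with
  | add a b ha hb => rw [map_add]; exact add_mem ha hb
  | smul c a ha => rw [map_smul]; exact augPow_smul c ha
  | pt v =>
    induction v using FreeGroup.induction_on with
    | C1 => rw [MonoidHom.map_one, hD.map_one]; exact zero_mem _
    | of x => exact h x
    | inv_of x hx =>
      rw [hD.map_inv]
      exact neg_mem (augPow_mul_right _ (augPow_mul_left _ hx))
    | mul v w hv hw =>
      rw [map_mul, hD]
      exact add_mem (augPow_mul_right _ hv) (augPow_mul_left _ hw)

/-- A derivation that maps the generators into `I ^ s` maps `I ^ m` into `I ^ (m + s - 1)`. -/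
theorem IsDer.mem_augPow {D : GrpAlg g →ₗ[ℚ] GrpAlg g} (hD : IsDer D) {s : ℕ}
    (h : ∀ x, D (pt (FreeGroup.of x)) ∈ augPow g s) {m k : ℕ} {a : GrpAlg g} (ha : a ∈ augPow g m)
    (hk : k ≤ m + s - 1) : D a ∈ augPow g k := by
  have h1 : ∀ m : ℕ, ∀ a ∈ augPow g (m + 1), D a ∈ augPow g (m + s) := by
    intro m
    induction m with
    | zero => intro a _; rw [zero_add]; exact hD.mem_augPow_of_gen h a
    | succ m ih =>
      intro a ha
      refine augPow_succ_le (S := (augPowQ g (m + 1 + s)).comap D) (fun b hb x => ?_) ha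
      change D (b * gX x) ∈ augPow g (m + 1 + s)
      rw [hD]
      exact add_mem (mul_mem_augPow_of_le (ih b hb) (gX_mem x) (by omega))
        (mul_mem_augPow_of_le hb (hD.mem_augPow_of_gen h _) (by omega))
  cases m with
  | zero => exact augPow_anti (by omega) (hD.mem_augPow_of_gen h a)
  | succ m => exact augPow_anti (by omega) (h1 m a ha)

theorem IsDer.ext {D E : GrpAlg g →ₗ[ℚ] GrpAlg g} (hD : IsDer D) (hE : IsDer E)
    (h : ∀ x, D (pt (FreeGroup.of x)) = E (pt (FreeGroup.of x))) : D = E := by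
  refine linearMap_ext_pt fun v => ?_
  induction v using FreeGroup.induction_on with
  | C1 => rw [MonoidHom.map_one, hD.map_one, hE.map_one]
  | of x => exact h x
  | inv_of x hx => rw [hD.map_inv, hE.map_inv, hx]
  | mul v w hv hw => rw [map_mul, hD, hE, hv, hw]

end GroupAlgebra

/-! ### Fox derivatives and cyclic derivatives -/

section Fox

variable {g : ℕ}

/-- The Fox derivative with respect to the generator `x`. -/
def fox (x : Gen g) : GrpAlg g →ₗ[ℚ] GrpAlg g :=
  linExt (exists_cocycle (leftMulHom g) (Pi.single x (1 : GrpAlg g))).choose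

theorem fox_of (x y : Gen g) : fox x (pt (FreeGroup.of y)) = if y = x then 1 else 0 := by
  rw [fox, linExt_pt,
    (exists_cocycle (leftMulHom g) (Pi.single x (1 : GrpAlg g))).choose_spec.1, Pi.single_apply]

theorem fox_mul (x : Gen g) (a b : GrpAlg g) :
    fox x (a * b) = aug g b • fox x a + a * fox x b := by
  induction a using pt_induction with
  | add a a' h h' => simp only [add_mul, map_add, h, h', smul_add]; abel
  | smul c a h => rw [smul_mul_assoc, map_smul, h, map_smul, smul_add, smul_comm, smul_mul_assoc]
  | pt v =>
    induction b using pt_induction with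
    | add a a' h h' =>
      rw [mul_add, map_add, h, h', map_add, map_add, add_smul, mul_add]; abel
    | smul c a h =>
      rw [mul_smul_comm, map_smul, h, map_smul, map_smul, smul_add, mul_smul_comm, smul_assoc]
    | pt w =>
      rw [← map_mul, fox, linExt_pt, linExt_pt, linExt_pt,
        (exists_cocycle (leftMulHom g) (Pi.single x (1 : GrpAlg g))).choose_spec.2, aug_pt,
        one_smul]
      rfl

theorem fox_one (x : Gen g) : fox x 1 = 0 := by
  have := fox_mul x 1 1
  simpa using this

theorem fox_inv (x : Gen g) (v : Pi1 g) :
    fox x (pt v⁻¹) = -(pt v⁻¹ * fox x (pt v)) := by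
  have h := fox_mul x (pt v⁻¹) (pt v)
  rw [pt_inv_mul, fox_one, aug_pt, one_smul] at h
  exact eq_neg_of_add_eq_zero_left h.symm

theorem fox_gX (x y : Gen g) : fox x (gX y) = if y = x then 1 else 0 := by
  rw [gX, map_sub, fox_of, fox_one, sub_zero]

/-- The fundamental formula of the Fox calculus. -/
theorem sum_fox_mul_gX (v : Pi1 g) : ∑ x, fox x (pt v) * gX x = pt v - 1 := by
  induction v using FreeGroup.induction_on with
  | C1 => simp [fox_one]
  | of y => simp [fox_of, gX]
  | inv_of y h =>
    simp only [fox_inv, neg_mul, mul_assoc, Finset.sum_neg_distrib]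
    rw [← Finset.mul_sum, h, mul_sub, pt_inv_mul, mul_one, neg_sub]
  | mul v w hv hw =>
    simp only [map_mul, fox_mul, aug_pt, one_smul, add_mul, mul_assoc, Finset.sum_add_distrib]
    rw [← Finset.mul_sum, hv, hw, mul_sub, mul_one]; abel

/-- `∑ p_h h⁻¹ a h`, for `p = ∑ p_h h` in the group algebra. -/
def conjSum : GrpAlg g →ₗ[ℚ] GrpAlg g →ₗ[ℚ] GrpAlg g :=
  linExt fun h => LinearMap.mulLeft ℚ (pt h⁻¹) ∘ₗ LinearMap.mulRight ℚ (pt h)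

theorem conjSum_pt (h : Pi1 g) (a : GrpAlg g) : conjSum (pt h) a = pt h⁻¹ * (a * pt h) := by
  simp [conjSum]

theorem conjSum_one (a : GrpAlg g) : conjSum 1 a = a := by
  rw [← (pt : Pi1 g →* _).map_one, conjSum_pt]; simp

theorem conjSum_pt_mul (w : Pi1 g) (p a : GrpAlg g) :
    conjSum (pt w * p) a = conjSum p (pt w⁻¹ * (a * pt w)) := by
  induction p using pt_induction with
  | add p q hp hq => simp only [mul_add, map_add, LinearMap.add_apply, hp, hq]
  | smul c p hp => simp only [mul_smul_comm, map_smul, LinearMap.smul_apply, hp]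
  | pt h => rw [← map_mul, conjSum_pt, conjSum_pt]; simp [mul_assoc]

theorem conjSum_mul_pt (w : Pi1 g) (p a : GrpAlg g) :
    conjSum (p * pt w) a = pt w⁻¹ * (conjSum p a * pt w) := by
  induction p using pt_induction with
  | add p q hp hq => simp only [mul_add, add_mul, map_add, LinearMap.add_apply, hp, hq]
  | smul c p hp =>
    simp only [mul_smul_comm, smul_mul_assoc, map_smul, LinearMap.smul_apply, hp]
  | pt h => rw [← map_mul, conjSum_pt, conjSum_pt]; simp [mul_assoc]

theorem conjSum_mem {m : ℕ} (p : GrpAlg g) {a : GrpAlg g} (ha : a ∈ augPow g m) :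
    conjSum p a ∈ augPow g m := by
  induction p using pt_induction with
  | add p q hp hq => rw [map_add]; exact add_mem hp hq
  | smul c p hp => rw [map_smul]; exact augPow_smul c hp
  | pt h => rw [conjSum_pt]; exact augPow_mul_left _ (augPow_mul_right _ ha)

theorem mul_pt_congr {m : ℕ} (h : Pi1 g) {a : GrpAlg g} (ha : a ∈ augPow g m) :
    a * pt h - a ∈ augPow g (m + 1) := by
  have := mul_mem_augPow ha (pt_sub_one_mem h)
  rwa [mul_sub, mul_one] at this

theorem pt_mul_congr {m : ℕ} (h : Pi1 g) {a : GrpAlg g} (ha : a ∈ augPow g m) :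
    pt h * a - a ∈ augPow g (m + 1) := by
  have := mul_mem_augPow (pt_sub_one_mem h) ha
  rwa [sub_mul, one_mul, add_comm] at this

theorem conj_congr {m : ℕ} (h w : Pi1 g) {a : GrpAlg g} (ha : a ∈ augPow g m) :
    pt h * (a * pt w) - a ∈ augPow g (m + 1) := by
  have := add_mem (pt_mul_congr h (augPow_mul_right (pt w) ha)) (mul_pt_congr w ha)
  rwa [sub_add_sub_cancel] at this

theorem conjSum_congr {m : ℕ} (p : GrpAlg g) {a : GrpAlg g} (ha : a ∈ augPow g m) :
    conjSum p a - aug g p • a ∈ augPow g (m + 1) := by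
  induction p using pt_induction with
  | add p q hp hq =>
    rw [map_add, map_add, add_smul, LinearMap.add_apply, add_sub_add_comm]; exact add_mem hp hq
  | smul c p hp =>
    rw [map_smul, map_smul, smul_assoc, LinearMap.smul_apply, ← smul_sub]; exact augPow_smul c hp
  | pt h => rw [conjSum_pt, aug_pt, one_smul]; exact conj_congr _ _ ha

/-- The polarised cyclic derivative: for a word `γ = u x v` the occurrence of `x` contributes
`x v c u` to the value at `c`. -/
def nabla (x : Gen g) : GrpAlg g →ₗ[ℚ] GrpAlg g →ₗ[ℚ] GrpAlg g :=
  linExt fun v => conjSum (fox x (pt v)) ∘ₗ LinearMap.mulLeft ℚ (pt v)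

theorem nabla_pt (x : Gen g) (v : Pi1 g) (c : GrpAlg g) :
    nabla x (pt v) c = conjSum (fox x (pt v)) (pt v * c) := by
  simp [nabla]

theorem nabla_mul (x : Gen g) (a b c : GrpAlg g) :
    nabla x (a * b) c = nabla x a (b * c) + nabla x b (c * a) := by
  induction a using pt_induction with
  | add a a' h h' => simp only [add_mul, mul_add, map_add, LinearMap.add_apply, h, h']; abel
  | smul q a h =>
    simp only [smul_mul_assoc, mul_smul_comm, map_smul, LinearMap.smul_apply, h, smul_add]
  | pt v =>
    induction b using pt_induction with
    | add a a' h h' => simp only [add_mul, mul_add, map_add, LinearMap.add_apply, h, h']; abel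
    | smul q a h =>
      simp only [smul_mul_assoc, mul_smul_comm, map_smul, LinearMap.smul_apply, h, smul_add]
    | pt w =>
      rw [← map_mul, nabla_pt, nabla_pt, nabla_pt, map_mul pt v w, fox_mul, aug_pt, one_smul, map_add,
        LinearMap.add_apply, conjSum_pt_mul]
      simp only [mul_assoc, pt_inv_mul_cancel_left]

theorem nabla_one (x : Gen g) (c : GrpAlg g) : nabla x 1 c = 0 := by
  have := nabla_mul x 1 1 c
  simpa using this

theorem nabla_mem_self (x : Gen g) {n : ℕ} (a : GrpAlg g) {c : GrpAlg g}
    (hc : c ∈ augPow g n) : nabla x a c ∈ augPow g n := by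
  induction a using pt_induction with
  | add p q hp hq => rw [map_add]; exact add_mem hp hq
  | smul c p hp => rw [map_smul]; exact augPow_smul c hp
  | pt h => rw [nabla_pt]; exact conjSum_mem _ (augPow_mul_left _ hc)

theorem nabla_mem (x : Gen g) {m n k : ℕ} {a c : GrpAlg g} (ha : a ∈ augPow g m)
    (hc : c ∈ augPow g n) (hk : k ≤ m + n - 1) : nabla x a c ∈ augPow g k := by
  have h1 : ∀ m n : ℕ, ∀ a ∈ augPow g (m + 1), ∀ c ∈ augPow g n,
      nabla x a c ∈ augPow g (m + n) := by
    intro m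
    induction m with
    | zero => intro n a _ c hc; rw [zero_add]; exact nabla_mem_self x a hc
    | succ m ih =>
      intro n a ha c hc
      refine augPow_succ_le (S := (augPowQ g (m + 1 + n)).comap ((nabla x).flip c))
        (fun b hb y => ?_) ha
      change nabla x (b * gX y) c ∈ augPow g (m + 1 + n)
      rw [nabla_mul]
      refine add_mem ?_ ?_
      · exact augPow_anti (by omega) (ih (1 + n) b hb _ (mul_mem_augPow (gX_mem y) hc))
      · exact augPow_anti (by omega) (nabla_mem_self x (gX y) (mul_mem_augPow hc hb))
  cases m with
  | zero => exact augPow_anti (by omega) (nabla_mem_self x a hc)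
  | succ m => exact augPow_anti (by omega) (h1 m n a ha c hc)

theorem nabla_gX_congr (x y : Gen g) {n : ℕ} {c : GrpAlg g} (hc : c ∈ augPow g n) :
    nabla x (gX y) c - (if y = x then c else 0) ∈ augPow g (n + 1) := by
  rw [gX, map_sub, LinearMap.sub_apply, nabla_one, sub_zero, nabla_pt, fox_of]
  split_ifs
  · rw [conjSum_one]; exact pt_mul_congr _ hc
  · simp

/-- The cyclic derivative with respect to the generator `x`: a word `u x v` contributes `x v u`. -/
def cyc (x : Gen g) : GrpAlg g →ₗ[ℚ] GrpAlg g := (nabla x).flip 1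

theorem cyc_apply (x : Gen g) (u : GrpAlg g) : cyc x u = nabla x u 1 := rfl

theorem cyc_pt (x : Gen g) (v : Pi1 g) : cyc x (pt v) = conjSum (fox x (pt v)) (pt v) := by
  rw [cyc_apply, nabla_pt, mul_one]

theorem cyc_mem (x : Gen g) {m k : ℕ} {u : GrpAlg g} (hu : u ∈ augPow g m) (hk : k ≤ m - 1) :
    cyc x u ∈ augPow g k := by
  rw [cyc_apply]
  exact nabla_mem x hu (augPow_zero 1) hk

theorem cyc_mul_comm (x : Gen g) (a b : GrpAlg g) : cyc x (a * b) = cyc x (b * a) := by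
  rw [cyc_apply, cyc_apply, nabla_mul, nabla_mul]; simp [add_comm]

theorem nabla_pow (x : Gen g) (u : GrpAlg g) (n : ℕ) (c : GrpAlg g) (hc : Commute c u) :
    nabla x (u ^ n) c = (n : ℚ) • nabla x u (u ^ (n - 1) * c) := by
  induction n generalizing c with
  | zero => simp [nabla_one]
  | succ n ih =>
    rw [pow_succ, nabla_mul, ih _ ((Commute.refl u).mul_left hc)]
    have h1 : c * u ^ n = u ^ n * c := (hc.pow_right n).eq
    rw [h1]
    cases n with
    | zero => simp
    | succ n =>
      rw [Nat.add_sub_cancel, Nat.add_sub_cancel, ← mul_assoc, ← pow_succ, Nat.cast_succ (n + 1),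
        add_smul, one_smul]

/-- The global relation between the cyclic derivatives. -/
theorem sum_cyc_sub_conj (u : GrpAlg g) :
    ∑ x, (cyc x u - pt (FreeGroup.of x)⁻¹ * (cyc x u * pt (FreeGroup.of x))) = 0 := by
  induction u using pt_induction with
  | add a b ha hb =>
    rw [← add_zero (0 : GrpAlg g)]
    nth_rw 1 [← ha]
    rw [← hb, ← Finset.sum_add_distrib]
    refine Finset.sum_congr rfl fun x _ => ?_
    rw [map_add, add_mul, mul_add]; abel
  | smul c a ha =>
    rw [← smul_zero c, ← ha, Finset.smul_sum]
    refine Finset.sum_congr rfl fun x _ => ?_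
    rw [map_smul, smul_mul_assoc, mul_smul_comm, smul_sub]
  | pt v =>
    have h : ∀ x : Gen g, cyc x (pt v) - pt (FreeGroup.of x)⁻¹ * (cyc x (pt v) *
        pt (FreeGroup.of x)) = -conjSum (fox x (pt v) * gX x) (pt v) := by
      intro x
      rw [gX, mul_sub, mul_one, map_sub, LinearMap.sub_apply, conjSum_mul_pt, cyc_pt, neg_sub]
    simp only [h]
    rw [Finset.sum_neg_distrib, ← LinearMap.sum_apply, ← map_sum, sum_fox_mul_gX, map_sub,
      LinearMap.sub_apply, conjSum_pt, conjSum_one, pt_inv_mul_cancel_left, sub_self, neg_zero]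

end Fox

/-! ### The action of free loops on based loops in terms of cyclic derivatives -/

section SigmaFormula

variable {g : ℕ}

/-- `1` if the position `p` comes after the position `r`, and `0` otherwise. -/
def after (r p : ℕ) : ℚ := if r < p then 1 else 0

/-- The sum of the free loop `u` based at the position `r` on the boundary of the polygon over its
crossings with an arc from `*` to that position. -/
def crossSum (r : ℕ) : GrpAlg g →ₗ[ℚ] GrpAlg g :=
  ∑ x, (after r (freePos (x, true)) • cyc x - after r (freePos (x, false)) •
    (LinearMap.mulLeft ℚ (pt (FreeGroup.of x)⁻¹) ∘ₗ
      LinearMap.mulRight ℚ (pt (FreeGroup.of x)) ∘ₗ cyc x))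

theorem crossSum_apply (r : ℕ) (u : GrpAlg g) : crossSum r u =
    ∑ x, (after r (freePos (x, true)) • cyc x u - after r (freePos (x, false)) •
      (pt (FreeGroup.of x)⁻¹ * (cyc x u * pt (FreeGroup.of x)))) := by
  simp [crossSum]

/-- The image in `π` of a passage. -/
def letter (l : Passage g) : GrpAlg g := pt (FreeGroup.mk [l])

theorem letter_true (x : Gen g) : letter (x, true) = pt (FreeGroup.of x) := rfl

theorem letter_false (x : Gen g) : letter (x, false) = pt (FreeGroup.of x)⁻¹ := rfl

theorem pt_mk_cons (l : Passage g) (L : List (Passage g)) :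
    pt (FreeGroup.mk (l :: L)) = letter l * pt (FreeGroup.mk L) := by
  rw [letter, ← map_mul, FreeGroup.mul_mk]; rfl

/-- The value on a word of the derivation with prescribed crossing sums `K`. -/
def wordDer (K : ℕ → GrpAlg g) : List (Passage g) → GrpAlg g
  | [] => 0
  | l :: b => (letter l * K (basedPos l.rev) - K (basedPos l) * letter l) * pt (FreeGroup.mk b) +
      letter l * wordDer K b

theorem wordDer_sum {ι : Type*} (s : Finset ι) (K : ι → ℕ → GrpAlg g) (b : List (Passage g)) :
    ∑ i ∈ s, wordDer (K i) b = wordDer (fun r => ∑ i ∈ s, K i r) b := by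
  induction b with
  | nil => simp [wordDer]
  | cons l b ih =>
    simp only [wordDer, Finset.sum_add_distrib, ← Finset.mul_sum, ← Finset.sum_mul,
      Finset.sum_sub_distrib, ih]

theorem wordDer_congr {K K' : ℕ → GrpAlg g} (h : ∀ l : Passage g, K (basedPos l) = K' (basedPos l))
    (b : List (Passage g)) : wordDer K b = wordDer K' b := by
  induction b with
  | nil => rfl
  | cons l b ih => simp only [wordDer, ih, h]

theorem getLast?_cons_elim {α β : Type*} (l : α) (L : List α) (r : β) (f : α → β) :
    (l :: L).getLast?.elim r f = L.getLast?.elim (f l) f := by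
  cases L with
  | nil => rfl
  | cons m L => rw [List.getLast?_cons_cons, List.getLast?_cons]; rfl

/-- Summation by parts along the word of the based loop. -/
theorem sum_chord_eq (φ : ℕ → ℚ) (h0 : φ 0 = 0) (c : GrpAlg g) (b : List (Passage g)) (r : ℕ) :
    ∑ j ∈ Finset.range (b.length + 1),
      (φ ((b.take j).getLast?.elim r fun l => basedPos l.rev) -
        φ ((b.drop j).head?.elim 0 basedPos)) •
        (pt (FreeGroup.mk (b.take j)) * c * pt (FreeGroup.mk (b.drop j))) =
      φ r • (c * pt (FreeGroup.mk b)) + wordDer (fun r => φ r • c) b := by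
  induction b generalizing r with
  | nil => simp [h0, wordDer, ← FreeGroup.one_eq_mk]
  | cons l b ih =>
    have h : ∀ j, (φ (((l :: b).take (j + 1)).getLast?.elim r fun l => basedPos l.rev) -
        φ (((l :: b).drop (j + 1)).head?.elim 0 basedPos)) •
        (pt (FreeGroup.mk ((l :: b).take (j + 1))) * c *
          pt (FreeGroup.mk ((l :: b).drop (j + 1)))) =
        letter l * ((φ ((b.take j).getLast?.elim (basedPos l.rev) fun l => basedPos l.rev) -
        φ ((b.drop j).head?.elim 0 basedPos)) •
        (pt (FreeGroup.mk (b.take j)) * c * pt (FreeGroup.mk (b.drop j)))) := by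
      intro j
      rw [List.take_succ_cons, List.drop_succ_cons, getLast?_cons_elim, pt_mk_cons, mul_smul_comm,
        mul_assoc, mul_assoc, mul_assoc]
    rw [List.length_cons, Finset.sum_range_succ', Finset.sum_congr rfl fun j _ => h j,
      ← Finset.mul_sum, ih (basedPos l.rev)]
    simp only [List.take_zero, List.drop_zero, List.getLast?_nil, List.head?_cons, Option.elim_none,
      Option.elim_some, ← FreeGroup.one_eq_mk, pt_mk_cons, wordDer, sub_smul, mul_add, sub_mul,
      mul_assoc, MonoidHom.map_one, one_mul, mul_smul_comm, smul_mul_assoc]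
    abel

theorem freePos_ne_basedPos (l m : Passage g) : freePos l ≠ basedPos m := by
  obtain ⟨x | x, _ | _⟩ := l <;> obtain ⟨y | y, _ | _⟩ := m <;>
    simp only [freePos, basedPos, side] <;> simp <;> omega

theorem between_sub_between {p q r : ℕ} (hp : p ≠ r) (hq : q ≠ r) :
    ((between p q r - between q p r : ℤ) : ℚ) = after r q - after r p := by
  simp only [between, after]
  split_ifs <;> first | omega | norm_num

theorem pt_mk_rotate (a : List (Passage g)) {i : ℕ} (hi : i ≤ a.length) :
    pt (FreeGroup.mk (a.rotate i)) =
      conjSum (pt (FreeGroup.mk (a.take i))) (pt (FreeGroup.mk a)) := by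
  have h : FreeGroup.mk a = FreeGroup.mk (a.take i) * FreeGroup.mk (a.drop i) := by
    rw [FreeGroup.mul_mk, List.take_append_drop]
  rw [conjSum_pt, ← map_mul, ← map_mul, List.rotate_eq_drop_append_take hi, ← FreeGroup.mul_mk, h]
  congr 1
  group

/-- The coefficients of `after r`-weighted crossings of a word, as a sum of Fox derivatives. -/
theorem sum_take_eq (θ : Passage g → ℚ) (a : List (Passage g)) :
    ∑ i : Fin a.length, (θ (a.get i) • pt (FreeGroup.mk (a.take i)) -
      θ (a.get i).rev • pt (FreeGroup.mk (a.take (i + 1)))) =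
    ∑ x, fox x (pt (FreeGroup.mk a)) * (θ (x, true) • 1 - θ (x, false) • pt (FreeGroup.of x)) := by
  induction a with
  | nil => simp [← FreeGroup.one_eq_mk, fox_one]
  | cons l a ih =>
    refine (Fin.sum_univ_succ (n := a.length) _).trans ?_
    change (θ l • pt (FreeGroup.mk []) - θ l.rev • pt (FreeGroup.mk [l])) +
      ∑ i : Fin a.length, (θ (a.get i) • pt (FreeGroup.mk (l :: a.take i)) -
        θ (a.get i).rev • pt (FreeGroup.mk (l :: a.take (i + 1)))) = _
    simp only [pt_mk_cons l]
    simp only [← mul_smul_comm, ← mul_sub, ← Finset.mul_sum]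
    rw [ih]
    simp only [fox_mul, aug_pt, one_smul, add_mul, Finset.sum_add_distrib, mul_assoc,
      ← Finset.mul_sum]
    congr 1
    obtain ⟨y, _ | _⟩ := l
    · rw [Finset.sum_eq_single y, letter_false, fox_inv, fox_of, if_pos rfl]
      · simp only [← FreeGroup.one_eq_mk, MonoidHom.map_one, Passage.rev, Bool.not_false,
          mul_one, mul_sub, neg_mul,
          mul_smul_comm, pt_inv_mul, smul_neg]
        abel
      · intro x _ hx
        rw [letter_false, fox_inv, fox_of, if_neg hx.symm, mul_zero, neg_zero, zero_mul]
      · simp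
    · simp [letter_true, fox_of, ← FreeGroup.one_eq_mk, Passage.rev]

theorem rotate_head? (a : List (Passage g)) (i : Fin a.length) :
    (a.rotate i).head? = some (a.get i) := by
  rw [List.head?_rotate i.2]; simp

theorem rotate_succ_getLast? (a : List (Passage g)) (i : Fin a.length) :
    (a.rotate (i + 1)).getLast? = some (a.get i) := by
  rw [List.rotate_eq_drop_append_take i.2, List.take_add_one, ← List.append_assoc,
    List.getElem?_eq_getElem i.2, Option.toList_some, List.getLast?_concat]
  rfl

/-- The crossing sums of a word, computed chord by chord. -/
theorem sum_rotate_eq (r : ℕ) (a : List (Passage g)) :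
    ∑ i ∈ Finset.range a.length,
      (after r ((a.rotate i).head?.elim 0 freePos) -
        after r ((a.rotate i).getLast?.elim 0 fun l => freePos l.rev)) •
        pt (FreeGroup.mk (a.rotate i)) = crossSum r (pt (FreeGroup.mk a)) := by
  -- Shifting the index pairs the two ends of one letter instead of those of one chord.
  have key : ∑ i ∈ Finset.range a.length,
      after r ((a.rotate i).getLast?.elim 0 fun l => freePos l.rev) •
        pt (FreeGroup.mk (a.rotate i)) =
      ∑ i ∈ Finset.range a.length,
      after r ((a.rotate (i + 1)).getLast?.elim 0 fun l => freePos l.rev) •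
        pt (FreeGroup.mk (a.rotate (i + 1))) := by
    cases h : a.length with
    | zero => rfl
    | succ n =>
      rw [Finset.sum_range_succ', Finset.sum_range_succ]
      congr 1
      rw [← h, List.rotate_length, List.rotate_zero]
  simp only [sub_smul]
  rw [Finset.sum_sub_distrib, key, ← Finset.sum_sub_distrib, Finset.sum_range]
  have h2 : ∀ i : Fin a.length,
      after r ((a.rotate i).head?.elim 0 freePos) • pt (FreeGroup.mk (a.rotate i)) -
      after r ((a.rotate (i + 1)).getLast?.elim 0 fun l => freePos l.rev) •
        pt (FreeGroup.mk (a.rotate (i + 1))) =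
      conjSum (after r (freePos (a.get i)) • pt (FreeGroup.mk (a.take i)) -
        after r (freePos (a.get i).rev) • pt (FreeGroup.mk (a.take (i + 1))))
        (pt (FreeGroup.mk a)) := by
    intro i
    rw [rotate_head?, rotate_succ_getLast?, pt_mk_rotate a i.2.le, pt_mk_rotate a i.2]
    simp
  simp only [h2]
  rw [← LinearMap.sum_apply, ← map_sum, sum_take_eq (fun l => after r (freePos l)), crossSum_apply,
    map_sum, LinearMap.sum_apply]
  refine Finset.sum_congr rfl fun x _ => ?_
  rw [mul_sub, mul_smul_comm, mul_smul_comm, mul_one, map_sub, map_smul, map_smul,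
    LinearMap.sub_apply, LinearMap.smul_apply, LinearMap.smul_apply, conjSum_mul_pt, cyc_pt]

/-- Whether a chord of the free loop separates two positions is a difference of values of `after`,
so that the signed chord crossings along the based loop telescope into `wordDer`. -/
theorem sigmaWord_eq (a b : List (Passage g)) :
    sigmaWord a b = wordDer (fun r => crossSum r (pt (FreeGroup.mk a))) b := by
  have h : ∀ i ∈ Finset.range a.length, ∑ j ∈ Finset.range (b.length + 1),
      ((chordSign
        ((a.rotate i).getLast?.elim 0 fun l => freePos l.rev)
        ((a.rotate i).head?.elim 0 freePos)
        ((b.take j).getLast?.elim 0 fun l => basedPos l.rev)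
        ((b.drop j).head?.elim 0 basedPos) : ℤ) : ℚ) •
      MonoidAlgebra.of ℚ (Pi1 g)
        (FreeGroup.mk (b.take j) * FreeGroup.mk (a.rotate i) * FreeGroup.mk (b.drop j)) =
      wordDer (fun r => (after r ((a.rotate i).head?.elim 0 freePos) -
        after r ((a.rotate i).getLast?.elim 0 fun l => freePos l.rev)) •
        pt (FreeGroup.mk (a.rotate i))) b := by
    intro i hi
    set p := (a.rotate i).getLast?.elim 0 fun l => freePos l.rev with hp
    set q := (a.rotate i).head?.elim 0 freePos with hq
    have := sum_chord_eq (fun r => ((between p q r - between q p r : ℤ) : ℚ)) (by simp [between])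
      (pt (FreeGroup.mk (a.rotate i))) b 0
    rw [show ((between p q 0 - between q p 0 : ℤ) : ℚ) = 0 by simp [between], zero_smul,
      zero_add] at this
    have hn : a.rotate i ≠ [] := by
      rw [Ne, List.rotate_eq_nil_iff]; rintro rfl; simp at hi
    obtain ⟨l, hl⟩ : ∃ l, p = freePos l := by
      rw [hp, List.getLast?_eq_getLast_of_ne_nil hn]; exact ⟨_, rfl⟩
    obtain ⟨m, hm⟩ : ∃ m, q = freePos m := by
      rw [hq, List.head?_eq_some_head hn]; exact ⟨_, rfl⟩
    rw [wordDer_congr (K' := fun r => ((between p q r - between q p r : ℤ) : ℚ) •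
      pt (FreeGroup.mk (a.rotate i))), ← this]
    · refine Finset.sum_congr rfl fun j _ => ?_
      rw [chordSign, Int.cast_sub, ← map_mul, ← map_mul]
      congr 1
      push_cast; ring
    · intro l'
      rw [between_sub_between (by rw [hl]; exact freePos_ne_basedPos _ _)
        (by rw [hm]; exact freePos_ne_basedPos _ _)]
  rw [sigmaWord, Finset.sum_congr rfl h, wordDer_sum]
  simp only [sum_rotate_eq]

/-- The derivation that is the action of the linear combination `u` of free loops. -/
theorem exists_sigma_der (u : GrpAlg g) : ∃ D : GrpAlg g →ₗ[ℚ] GrpAlg g, IsDer D ∧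
    ∀ x, D (pt (FreeGroup.of x)) = pt (FreeGroup.of x) * crossSum (basedPos (x, false)) u -
      crossSum (basedPos (x, true)) u * pt (FreeGroup.of x) := exists_isDer _

/-- The rule of `wordDer` for inverse letters agrees with the Leibniz rule, so that a derivation with
the right values on the generators is given by `wordDer` on all words. -/
theorem IsDer.eq_wordDer {D : GrpAlg g →ₗ[ℚ] GrpAlg g} (hD : IsDer D) {K : ℕ → GrpAlg g}
    (h : ∀ x, D (pt (FreeGroup.of x)) = pt (FreeGroup.of x) * K (basedPos (x, false)) -
      K (basedPos (x, true)) * pt (FreeGroup.of x)) (b : List (Passage g)) :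
    D (pt (FreeGroup.mk b)) = wordDer K b := by
  induction b with
  | nil => rw [← FreeGroup.one_eq_mk, MonoidHom.map_one, hD.map_one]; rfl
  | cons l b ih =>
    rw [pt_mk_cons, hD, ih, wordDer]
    congr 2
    obtain ⟨x, _ | _⟩ := l
    · rw [letter_false, hD.map_inv, h]
      simp only [Passage.rev, Bool.not_false, mul_sub, sub_mul, pt_inv_mul_cancel_left, mul_assoc,
        pt_mul_inv, mul_one, neg_sub]
    · exact h x

/-- The action `σ` as a bilinear map. -/
def sigmaL : GrpAlg g →ₗ[ℚ] GrpAlg g →ₗ[ℚ] GrpAlg g :=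
  linExt fun a => linExt fun b => sigmaWord a.toWord b.toWord

theorem sigma_eq_sigmaL (u v : GrpAlg g) : sigma u v = sigmaL u v := by
  simp only [sigma, sigmaL, linExt, LinearMap.comp_apply, Finsupp.lift_apply,
    LinearEquiv.coe_coe, MonoidAlgebra.coeffLinearEquiv_apply, Finsupp.sum, LinearMap.sum_apply,
    LinearMap.smul_apply, Finset.smul_sum, mul_smul]

theorem wordDer_add (K K' : ℕ → GrpAlg g) (b : List (Passage g)) :
    wordDer (fun r => K r + K' r) b = wordDer K b + wordDer K' b := by
  induction b with
  | nil => simp [wordDer]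
  | cons l b ih =>
    simp only [wordDer, ih, mul_add, add_mul, sub_mul]
    abel

theorem wordDer_smul (c : ℚ) (K : ℕ → GrpAlg g) (b : List (Passage g)) :
    wordDer (fun r => c • K r) b = c • wordDer K b := by
  induction b with
  | nil => simp [wordDer]
  | cons l b ih =>
    simp only [wordDer, ih, mul_smul_comm, smul_mul_assoc, ← smul_sub, ← smul_add]

theorem sigmaL_pt (u : GrpAlg g) (w : Pi1 g) :
    sigmaL u (pt w) = wordDer (fun r => crossSum r u) w.toWord := by
  induction u using pt_induction with
  | pt v => rw [sigmaL, linExt_pt, linExt_pt, sigmaWord_eq, FreeGroup.mk_toWord]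
  | add a b ha hb => simp only [map_add, LinearMap.add_apply, ha, hb, wordDer_add]
  | smul c a h => simp only [map_smul, LinearMap.smul_apply, h, wordDer_smul]

theorem sigmaL_eq (u : GrpAlg g) {D : GrpAlg g →ₗ[ℚ] GrpAlg g} (hD : IsDer D)
    (h : ∀ x, D (pt (FreeGroup.of x)) = pt (FreeGroup.of x) * crossSum (basedPos (x, false)) u -
      crossSum (basedPos (x, true)) u * pt (FreeGroup.of x)) : sigmaL u = D := by
  refine linearMap_ext_pt fun w => ?_
  rw [sigmaL_pt, ← hD.eq_wordDer (K := fun r => crossSum r u) h, FreeGroup.mk_toWord]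

theorem sigmaL_isDer (u : GrpAlg g) : IsDer (sigmaL u) := by
  obtain ⟨D, hD, h⟩ := exists_sigma_der u
  rw [sigmaL_eq u hD h]; exact hD

theorem sigmaL_of (u : GrpAlg g) (x : Gen g) : sigmaL u (pt (FreeGroup.of x)) =
    pt (FreeGroup.of x) * crossSum (basedPos (x, false)) u -
      crossSum (basedPos (x, true)) u * pt (FreeGroup.of x) := by
  obtain ⟨D, hD, h⟩ := exists_sigma_der u
  rw [sigmaL_eq u hD h, h]

end SigmaFormula

/-! ### Filtration degree, leading term and boundary invariance of the action -/

section SigmaProperties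

variable {g : ℕ}

theorem freePos_inl_true (i : Fin g) : freePos (Sum.inl i, true) = 8 * i + 1 := by
  simp only [freePos, side, if_true]; ring

theorem freePos_inl_false (i : Fin g) : freePos (Sum.inl i, false) = 8 * i + 6 := by
  simp only [freePos, side, Bool.false_eq_true, if_false]; ring

theorem freePos_inr_true (i : Fin g) : freePos (Sum.inr i, true) = 8 * i + 7 := by
  simp only [freePos, side, if_true]; ring

theorem freePos_inr_false (i : Fin g) : freePos (Sum.inr i, false) = 8 * i + 4 := by
  simp only [freePos, side, Bool.false_eq_true, if_false]; ring

theorem basedPos_inl_true (i : Fin g) : basedPos (Sum.inl i, true) = 8 * i + 2 := by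
  simp only [basedPos, side, if_true]; ring

theorem basedPos_inl_false (i : Fin g) : basedPos (Sum.inl i, false) = 8 * i + 5 := by
  simp only [basedPos, side, Bool.false_eq_true, if_false]; ring

theorem basedPos_inr_true (i : Fin g) : basedPos (Sum.inr i, true) = 8 * i + 8 := by
  simp only [basedPos, side, if_true]; ring

theorem basedPos_inr_false (i : Fin g) : basedPos (Sum.inr i, false) = 8 * i + 3 := by
  simp only [basedPos, side, Bool.false_eq_true, if_false]; ring

theorem crossSum_mem (r : ℕ) {m k : ℕ} {u : GrpAlg g} (hu : u ∈ augPow g m) (hk : k ≤ m - 1) :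
    crossSum r u ∈ augPow g k := by
  rw [crossSum_apply]
  refine sum_mem fun x _ => sub_mem (augPow_smul _ (cyc_mem x hu hk)) (augPow_smul _ ?_)
  exact augPow_mul_left _ (augPow_mul_right _ (cyc_mem x hu hk))

theorem sigmaL_mem {m n k : ℕ} {u v : GrpAlg g} (hu : u ∈ augPow g m) (hv : v ∈ augPow g n)
    (hk : k ≤ n + (m - 1) - 1) : sigmaL u v ∈ augPow g k := by
  refine (sigmaL_isDer u).mem_augPow (s := m - 1) (fun x => ?_) hv hk
  rw [sigmaL_of]
  exact sub_mem (augPow_mul_left _ (crossSum_mem _ hu le_rfl))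
    (augPow_mul_right _ (crossSum_mem _ hu le_rfl))

theorem crossSum_congr (r : ℕ) {m : ℕ} {u : GrpAlg g} (hu : u ∈ augPow g (m + 1)) :
    crossSum r u - ∑ y : Gen g, (after r (freePos (y, true)) - after r (freePos (y, false))) •
      cyc y u ∈ augPow g (m + 1) := by
  rw [crossSum_apply, ← Finset.sum_sub_distrib]
  refine sum_mem fun y _ => ?_
  have h := conj_congr (FreeGroup.of y)⁻¹ (FreeGroup.of y) (cyc_mem y hu (k := m) le_rfl)
  have := augPow_smul (-after r (freePos (y, false))) h
  rw [neg_smul, ← smul_neg, neg_sub, smul_sub] at this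
  rw [sub_smul, sub_sub_sub_cancel_left]
  exact this

theorem sigmaL_of_congr (x : Gen g) {m : ℕ} {u : GrpAlg g} (hu : u ∈ augPow g (m + 1)) :
    sigmaL u (pt (FreeGroup.of x)) - ∑ y : Gen g,
      ((after (basedPos (x, false)) (freePos (y, true)) -
        after (basedPos (x, false)) (freePos (y, false))) -
      (after (basedPos (x, true)) (freePos (y, true)) -
        after (basedPos (x, true)) (freePos (y, false)))) • cyc y u ∈ augPow g (m + 1) := by
  have h1 := pt_mul_congr (FreeGroup.of x) (crossSum_mem (basedPos (x, false)) hu (k := m) le_rfl)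
  have h2 := mul_pt_congr (FreeGroup.of x) (crossSum_mem (basedPos (x, true)) hu (k := m) le_rfl)
  have h3 := sub_mem (add_mem h1 (crossSum_congr (basedPos (x, false)) hu))
    (add_mem h2 (crossSum_congr (basedPos (x, true)) hu))
  rw [sub_add_sub_cancel, sub_add_sub_cancel, sub_sub_sub_comm, ← Finset.sum_sub_distrib] at h3
  rw [sigmaL_of]
  simpa only [← sub_smul] using h3

/-- The leading term of the action on `α_i` is the cyclic derivative with respect to `β_i`. -/
theorem sigmaL_inl_congr (i : Fin g) {m : ℕ} {u : GrpAlg g} (hu : u ∈ augPow g (m + 1)) :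
    sigmaL u (pt (FreeGroup.of (Sum.inl i))) - cyc (Sum.inr i) u ∈ augPow g (m + 1) := by
  have h := sigmaL_of_congr (Sum.inl i) hu
  rw [Finset.sum_eq_single (Sum.inr i)] at h
  · convert h using 2
    convert (one_smul ℚ _).symm
    simp only [after, freePos_inl_true, freePos_inl_false, freePos_inr_true,
        freePos_inr_false, basedPos_inl_true, basedPos_inl_false, basedPos_inr_true,
        basedPos_inr_false]
    split_ifs <;> first | omega | norm_num
  · rintro (j | j) _ hj
    · convert zero_smul ℚ _
      simp only [after, freePos_inl_true, freePos_inl_false, freePos_inr_true,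
        freePos_inr_false, basedPos_inl_true, basedPos_inl_false, basedPos_inr_true,
        basedPos_inr_false]
      split_ifs <;> first | omega | norm_num
    · have hij : (j : ℕ) ≠ i := fun h => hj (by rw [Fin.ext h])
      convert zero_smul ℚ _
      simp only [after, freePos_inl_true, freePos_inl_false, freePos_inr_true,
        freePos_inr_false, basedPos_inl_true, basedPos_inl_false, basedPos_inr_true,
        basedPos_inr_false]
      split_ifs <;> first | omega | norm_num
  · simp

/-- The leading term of the action on `β_i` is the negative of the cyclic derivative with respect
to `α_i`. -/
theorem sigmaL_inr_congr (i : Fin g) {m : ℕ} {u : GrpAlg g} (hu : u ∈ augPow g (m + 1)) :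
    sigmaL u (pt (FreeGroup.of (Sum.inr i))) + cyc (Sum.inl i) u ∈ augPow g (m + 1) := by
  have h := sigmaL_of_congr (Sum.inr i) hu
  rw [Finset.sum_eq_single (Sum.inl i)] at h
  · convert h using 1
    rw [sub_eq_add_neg, ← neg_smul]
    congr 1
    convert (one_smul ℚ _).symm
    simp only [after, freePos_inl_true, freePos_inl_false, freePos_inr_true,
        freePos_inr_false, basedPos_inl_true, basedPos_inl_false, basedPos_inr_true,
        basedPos_inr_false]
    split_ifs <;> first | omega | norm_num
  · rintro (j | j) _ hj
    · have hij : (j : ℕ) ≠ i := fun h => hj (by rw [Fin.ext h])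
      convert zero_smul ℚ _
      simp only [after, freePos_inl_true, freePos_inl_false, freePos_inr_true,
        freePos_inr_false, basedPos_inl_true, basedPos_inl_false, basedPos_inr_true,
        basedPos_inr_false]
      split_ifs <;> first | omega | norm_num
    · convert zero_smul ℚ _
      simp only [after, freePos_inl_true, freePos_inl_false, freePos_inr_true,
        freePos_inr_false, basedPos_inl_true, basedPos_inl_false, basedPos_inr_true,
        basedPos_inr_false]
      split_ifs <;> first | omega | norm_num
  · simp

/-- The contribution of the `i`-th handle to the crossing sum. -/
def handleSum (u : GrpAlg g) (i : Fin g) : GrpAlg g :=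
  (cyc (Sum.inl i) u - pt (FreeGroup.of (Sum.inl i))⁻¹ *
    (cyc (Sum.inl i) u * pt (FreeGroup.of (Sum.inl i)))) +
  (cyc (Sum.inr i) u - pt (FreeGroup.of (Sum.inr i))⁻¹ *
    (cyc (Sum.inr i) u * pt (FreeGroup.of (Sum.inr i))))

/-- The contribution of the handles from the `n`-th one on to the crossing sum. -/
def tailSum (u : GrpAlg g) (n : ℕ) : GrpAlg g := ∑ j : Fin g, if n ≤ j then handleSum u j else 0

theorem tailSum_zero (u : GrpAlg g) : tailSum u 0 = 0 := by
  have h := sum_cyc_sub_conj u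
  rw [Fintype.sum_sum_type, ← Finset.sum_add_distrib] at h
  simpa [tailSum, handleSum] using h

theorem tailSum_top (u : GrpAlg g) : tailSum u g = 0 :=
  Finset.sum_eq_zero fun j _ => if_neg (by omega)

theorem sum_ite_le_succ {M : Type*} [AddCommGroup M] (f : Fin g → M) (i : Fin g) :
    ∑ j : Fin g, (if (i : ℕ) ≤ j then f j else 0) =
      ∑ j : Fin g, (if (i : ℕ) + 1 ≤ j then f j else 0) + f i := by
  rw [← Finset.sum_erase_add _ _ (Finset.mem_univ i),
    ← Finset.sum_erase_add (f := fun j : Fin g => if (i : ℕ) + 1 ≤ j then f j else 0) _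
      (Finset.mem_univ i), if_pos le_rfl, if_neg (by omega), add_zero]
  congr 1
  refine Finset.sum_congr rfl fun j hj => ?_
  have : (j : ℕ) ≠ i := fun h => (Finset.mem_erase.1 hj).1 (Fin.ext h)
  exact if_congr (by omega) rfl rfl

theorem tailSum_eq (u : GrpAlg g) (i : Fin g) :
    tailSum u i = tailSum u (i + 1) + handleSum u i := sum_ite_le_succ _ i

/-- The crossing sum at a position in the `i`-th handle. -/
theorem crossSum_handle (u : GrpAlg g) (i : Fin g) {r : ℕ} (h1 : 8 * (i : ℕ) < r)
    (h2 : r ≤ 8 * i + 8) : crossSum r u = tailSum u (i + 1) +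
      (after r (freePos (Sum.inl i, true)) • cyc (Sum.inl i) u -
        after r (freePos (Sum.inl i, false)) • (pt (FreeGroup.of (Sum.inl i))⁻¹ *
          (cyc (Sum.inl i) u * pt (FreeGroup.of (Sum.inl i)))) +
      (after r (freePos (Sum.inr i, true)) • cyc (Sum.inr i) u -
        after r (freePos (Sum.inr i, false)) • (pt (FreeGroup.of (Sum.inr i))⁻¹ *
          (cyc (Sum.inr i) u * pt (FreeGroup.of (Sum.inr i)))))) := by
  rw [crossSum_apply, Fintype.sum_sum_type, ← Finset.sum_add_distrib, tailSum,
    ← Finset.sum_erase_add _ _ (Finset.mem_univ i)]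
  congr 1
  rw [← Finset.sum_erase_add (f := fun j : Fin g => if (i : ℕ) + 1 ≤ j then _ else _) _
      (Finset.mem_univ i), if_neg (by omega), add_zero]
  refine Finset.sum_congr rfl fun j hj => ?_
  have hne : (j : ℕ) ≠ i := fun h => (Finset.mem_erase.1 hj).1 (Fin.ext h)
  split_ifs with hij
  · have h : ∀ p, 8 * (j : ℕ) < p → after r p = 1 := fun p hp => if_pos (by omega)
    rw [freePos_inl_true, freePos_inl_false, freePos_inr_true, freePos_inr_false, h _ (by omega),
      h _ (by omega), h _ (by omega), h _ (by omega)]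
    simp only [one_smul, handleSum]
  · have h : ∀ p, p ≤ 8 * (j : ℕ) + 8 → after r p = 0 := fun p hp => if_neg (by omega)
    rw [freePos_inl_true, freePos_inl_false, freePos_inr_true, freePos_inr_false, h _ (by omega),
      h _ (by omega), h _ (by omega), h _ (by omega)]
    simp

/-- The commutator `[α_i, β_i]`. -/
def handle (i : Fin g) : Pi1 g :=
  FreeGroup.of (Sum.inl i : Gen g) * FreeGroup.of (Sum.inr i) *
      (FreeGroup.of (Sum.inl i))⁻¹ * (FreeGroup.of (Sum.inr i))⁻¹

/-- The handles before the `i`-th one do not contribute, and those after it contribute the same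
crossing sum at all positions of the `i`-th handle. -/
theorem sigmaL_handle (u : GrpAlg g) (i : Fin g) :
    sigmaL u (pt (handle i)) =
      pt (handle i) * tailSum u (i + 1) - tailSum u i * pt (handle i) := by
  have hD := sigmaL_isDer u
  have e1 := crossSum_handle u i (r := 8 * i + 2) (by omega) (by omega)
  have e2 := crossSum_handle u i (r := 8 * i + 5) (by omega) (by omega)
  have e3 := crossSum_handle u i (r := 8 * i + 8) (by omega) (by omega)
  have e4 := crossSum_handle u i (r := 8 * i + 3) (by omega) (by omega)
  rw [freePos_inl_true, freePos_inl_false, freePos_inr_true, freePos_inr_false] at e1 e2 e3 e4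
  have a0 : ∀ r p, p ≤ r → after r p = 0 := fun r p h => if_neg (by omega)
  have a1 : ∀ r p, r < p → after r p = 1 := fun r p h => if_pos h
  rw [a0 _ _ (by omega), a1 _ _ (by omega), a1 _ _ (by omega), a1 _ _ (by omega)] at e1
  rw [a0 _ _ (by omega), a1 _ _ (by omega), a1 _ _ (by omega), a0 _ _ (by omega)] at e2
  rw [a0 _ _ (by omega), a0 _ _ (by omega), a0 _ _ (by omega), a0 _ _ (by omega)] at e3
  rw [a0 _ _ (by omega), a1 _ _ (by omega), a1 _ _ (by omega), a1 _ _ (by omega)] at e4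
  simp only [handle, map_mul pt]
  rw [hD, hD, hD, hD.map_inv, hD.map_inv, sigmaL_of, sigmaL_of, basedPos_inl_true,
    basedPos_inl_false, basedPos_inr_true, basedPos_inr_false, e1, e2, e3, e4, tailSum_eq,
    handleSum]
  simp only [one_smul, zero_smul, mul_add, add_mul, mul_sub, sub_mul, mul_assoc, zero_mul, mul_zero,
    pt_inv_mul_cancel_left, pt_mul_inv_cancel_left, pt_mul_inv, mul_one, neg_sub]
  abel

theorem IsDer.ofFn_prod {D : GrpAlg g →ₗ[ℚ] GrpAlg g} (hD : IsDer D) {n : ℕ} (f : Fin n → Pi1 g)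
    (S : ℕ → GrpAlg g) (h : ∀ i : Fin n, D (pt (f i)) = pt (f i) * S (i + 1) - S i * pt (f i)) :
    D (pt (List.ofFn f).prod) = pt (List.ofFn f).prod * S n - S 0 * pt (List.ofFn f).prod := by
  induction n generalizing S with
  | zero => simp [hD.map_one]
  | succ n ih =>
    have h0 := h 0
    rw [Fin.val_zero] at h0
    rw [List.ofFn_succ, List.prod_cons, map_mul pt, hD, h0, zero_add,
      ih (fun i => f i.succ) (fun n => S (n + 1)) (fun i => h i.succ)]
    simp only [sub_mul, mul_sub, mul_assoc]
    abel

/-- A free loop can be moved away from the boundary: the values on the handles telescope to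
`tailSum u g` and `tailSum u 0`, of which the first is empty and the second vanishes by the global
relation between the cyclic derivatives. -/
theorem sigmaL_boundary (u : GrpAlg g) : sigmaL u (pt (boundary g)) = 0 := by
  have := (sigmaL_isDer u).ofFn_prod handle (tailSum u) (sigmaL_handle u)
  rw [tailSum_zero, tailSum_top, mul_zero, zero_mul, sub_zero] at this
  exact this

end SigmaProperties

/-! ### Leading terms: monomials, Magnus coefficients, cyclic words -/

section Words

variable {g : ℕ}

/-- The words of length `n` in the generators. -/
abbrev Word (g n : ℕ) : Type := List.Vector (Gen g) n

/-- The monomial in the elements `x - 1` given by a word, which is read from right to left. -/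
def mono : List (Gen g) → GrpAlg g
  | [] => 1
  | x :: w => mono w * gX x

theorem mono_append (v w : List (Gen g)) : mono (v ++ w) = mono w * mono v := by
  induction v with
  | nil => simp [mono]
  | cons x v ih => rw [List.cons_append, mono, ih, mono, mul_assoc]

theorem mono_singleton (x : Gen g) : mono [x] = gX x := one_mul _

theorem mono_mem (w : List (Gen g)) : mono w ∈ augPow g w.length := by
  induction w with
  | nil => exact augPow_zero _
  | cons x w ih => exact mul_mem_augPow ih (gX_mem x)

theorem aug_gX (x : Gen g) : aug g (gX x) = 0 := mem_augPow_one.1 (gX_mem x)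

theorem fox_mul_gX (x y : Gen g) (a : GrpAlg g) :
    fox x (a * gX y) = if y = x then a else 0 := by
  rw [fox_mul, aug_gX, zero_smul, zero_add, fox_gX]; split_ifs <;> simp

theorem fox_mem (x : Gen g) {m : ℕ} {a : GrpAlg g} (ha : a ∈ augPow g (m + 1)) :
    fox x a ∈ augPow g m := by
  refine augPow_succ_le (S := (augPowQ g m).comap (fox x)) (fun b hb y => ?_) ha
  change fox x (b * gX y) ∈ augPow g m
  rw [fox_mul_gX]
  split_ifs
  exacts [hb, zero_mem _]

/-- The coefficient of a monomial in the Magnus expansion, as an iterated Fox derivative. -/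
def coef : List (Gen g) → GrpAlg g →ₗ[ℚ] ℚ
  | [] => (aug g).toLinearMap
  | x :: w => coef w ∘ₗ fox x

theorem coef_cons (x : Gen g) (w : List (Gen g)) (a : GrpAlg g) :
    coef (x :: w) a = coef w (fox x a) := rfl

theorem coef_eq_zero (w : List (Gen g)) {a : GrpAlg g} (ha : a ∈ augPow g (w.length + 1)) :
    coef w a = 0 := by
  induction w generalizing a with
  | nil => exact mem_augPow_one.1 ha
  | cons x w ih => exact ih (fox_mem x ha)

theorem coef_cons_mul_gX (x y : Gen g) (w : List (Gen g)) (a : GrpAlg g) :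
    coef (x :: w) (a * gX y) = if y = x then coef w a else 0 := by
  rw [coef_cons, fox_mul_gX]; split_ifs <;> simp

theorem coef_mono (v w : List (Gen g)) (h : v.length = w.length) :
    coef v (mono w) = if w = v then 1 else 0 := by
  induction v generalizing w with
  | nil =>
    obtain rfl := List.length_eq_zero_iff.1 h.symm
    simp [coef, mono]
  | cons x v ih =>
    cases w with
    | nil => simp at h
    | cons y w =>
      rw [mono, coef_cons_mul_gX, ih w (by simpa using h)]
      by_cases h1 : y = x <;> by_cases h2 : w = v <;> simp [h1, h2]

theorem sum_word_succ {M : Type*} [AddCommMonoid M] {n : ℕ} (f : List (Gen g) → M) :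
    ∑ v : Word g (n + 1), f v.1 = ∑ x : Gen g, ∑ w : Word g n, f (x :: w.1) := by
  rw [← Fintype.sum_prod_type (f := fun p : Gen g × Word g n => f (p.1 :: p.2.1))]
  symm
  refine Fintype.sum_bijective (fun p : Gen g × Word g n => p.1 ::ᵥ p.2) ⟨?_, ?_⟩ _ _ ?_
  · rintro ⟨x, v⟩ ⟨y, w⟩ h
    have h' : (x ::ᵥ v) = (y ::ᵥ w) := h
    have h1 := congrArg List.Vector.head h'
    have h2 := congrArg List.Vector.tail h'
    simp only [List.Vector.head_cons, List.Vector.tail_cons] at h1 h2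
    rw [h1, h2]
  · intro v
    exact ⟨(v.head, v.tail), List.Vector.cons_head_tail v⟩
  · intro p
    simp

/-- The leading term of an element of `I ^ n` is given by its Magnus coefficients. -/
theorem sub_sum_coef_mem {n : ℕ} {a : GrpAlg g} (ha : a ∈ augPow g n) :
    a - ∑ w : Word g n, coef w.1 a • mono w.1 ∈ augPow g (n + 1) := by
  induction n generalizing a with
  | zero =>
    rw [Fintype.sum_subsingleton _ List.Vector.nil, zero_add]
    exact sub_aug_mem a
  | succ n ih =>
    let L : GrpAlg g →ₗ[ℚ] GrpAlg g :=
      LinearMap.id - ∑ w : Word g (n + 1), (coef w.1).smulRight (mono w.1)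
    have hL : ∀ a, L a = a - ∑ w : Word g (n + 1), coef w.1 a • mono w.1 := by
      intro a; simp [L]
    rw [← hL]
    refine augPow_succ_le (S := (augPowQ g (n + 2)).comap L) (fun b hb y => ?_) ha
    change L (b * gX y) ∈ augPow g (n + 2)
    rw [hL, sum_word_succ (fun w => coef w (b * gX y) • mono w), Finset.sum_eq_single y]
    · simp only [coef_cons_mul_gX, if_true, mono, ← smul_mul_assoc]
      rw [← Finset.sum_mul, ← sub_mul]
      exact mul_mem_augPow (m := n + 1) (ih hb) (gX_mem y)
    · intro x _ hx
      refine Finset.sum_eq_zero fun w _ => ?_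
      rw [coef_cons_mul_gX, if_neg hx.symm, zero_smul]
    · simp

theorem coef_congr (w : List (Gen g)) {a b : GrpAlg g} (h : a - b ∈ augPow g (w.length + 1)) :
    coef w a = coef w b := by
  rw [← sub_eq_zero, ← map_sub]; exact coef_eq_zero w h

theorem coef_concat_gX_mul (x y : Gen g) (w : List (Gen g)) {a : GrpAlg g}
    (ha : a ∈ augPow g w.length) :
    coef (w ++ [x]) (gX y * a) = if y = x then coef w a else 0 := by
  have hl : (w ++ [x]).length = w.length + 1 := by simp
  have h1 : gX y * a - gX y * ∑ v : Word g w.length, coef v.1 a • mono v.1 ∈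
      augPow g ((w ++ [x]).length + 1) := by
    rw [← mul_sub, hl]
    exact mul_mem_augPow_of_le (gX_mem y) (sub_sum_coef_mem ha) (by omega)
  rw [coef_congr _ h1, Finset.mul_sum, map_sum, Finset.sum_eq_single ⟨w, rfl⟩]
  · rw [mul_smul_comm, map_smul, ← mono_singleton, ← mono_append, coef_mono _ _ (by simp)]
    by_cases h : y = x <;> simp [h]
  · intro v _ hv
    rw [mul_smul_comm, map_smul, ← mono_singleton, ← mono_append,
      coef_mono _ _ (by simp [v.2]), if_neg, smul_zero]
    intro h
    exact hv (Subtype.ext (List.append_inj_left' h rfl))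
  · exact fun h => absurd (Finset.mem_univ _) h

theorem nabla_mono_congr (y : Gen g) (v : List (Gen g)) {n : ℕ} {c : GrpAlg g}
    (hc : c ∈ augPow g n) :
    nabla y (mono v) c - ∑ k ∈ Finset.range v.length,
      (if v[k]? = some y then mono (v.take k) * c * mono (v.drop (k + 1)) else 0) ∈
      augPow g (n + v.length) := by
  induction v generalizing n c with
  | nil => simp [mono, nabla_one]
  | cons x v ih =>
    have h1 := ih (mul_mem_augPow (gX_mem x) hc)
    have h2 := nabla_gX_congr y x (mul_mem_augPow hc (mono_mem v))
    rw [mono, nabla_mul, List.length_cons, Finset.sum_range_succ']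
    have h3 := add_mem (augPow_anti (m := n + (v.length + 1)) (by omega) h1)
      (augPow_anti (m := n + (v.length + 1)) (by omega) h2)
    rw [← add_sub_add_comm] at h3
    simpa [mono, mul_assoc] using h3

theorem cyc_mono_congr (y : Gen g) (v : List (Gen g)) :
    cyc y (mono v) - ∑ k ∈ Finset.range v.length,
      (if (v.rotate k).head? = some y then mono (v.rotate k).tail else 0) ∈
      augPow g v.length := by
  have h := nabla_mono_congr y v (augPow_zero 1)
  rw [zero_add] at h
  rw [cyc_apply]
  convert h using 2
  refine Finset.sum_congr rfl fun k hk => ?_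
  have hk' := Finset.mem_range.1 hk
  rw [List.head?_rotate hk', mul_one, ← mono_append, List.rotate_eq_drop_append_take hk'.le,
    List.drop_eq_getElem_cons hk']
  rfl

/-- The cyclic derivative of a cyclically symmetric element with leading term `∑ (x - 1) z_x` has
the leading term `(n + 1) z_y`. -/
theorem cyc_sum_congr {n : ℕ} (z : Gen g → GrpAlg g) (hz : ∀ x, z x ∈ augPow g n)
    (h : ∑ x, (gX x * z x - z x * gX x) ∈ augPow g (n + 2)) (y : Gen g) :
    cyc y (∑ x, gX x * z x) - ((n : ℚ) + 1) • z y ∈ augPow g (n + 1) := by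
  set Z := ∑ x, gX x * z x with hZ
  have hZm : Z ∈ augPow g (n + 1) :=
    sum_mem fun x _ => mul_mem_augPow_of_le (gX_mem x) (hz x) (by omega)
  have c1 : ∀ x (w : List (Gen g)), w.length = n → coef (w ++ [x]) Z = coef w (z x) := by
    rintro x w rfl
    rw [hZ, map_sum, Finset.sum_eq_single x]
    · rw [coef_concat_gX_mul _ _ _ (hz x), if_pos rfl]
    · intro y _ hy
      rw [coef_concat_gX_mul _ _ _ (hz y), if_neg hy]
    · simp
  have c2 : ∀ x (w : List (Gen g)), w.length = n → coef (x :: w) Z = coef w (z x) := by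
    rintro x w rfl
    rw [Finset.sum_sub_distrib] at h
    rw [coef_congr (x :: w) h, map_sum, Finset.sum_eq_single x]
    · rw [coef_cons_mul_gX, if_pos rfl]
    · intro y _ hy
      rw [coef_cons_mul_gX, if_neg hy]
    · simp
  have rot1 : ∀ v : List (Gen g), v.length = n + 1 → coef (v.rotate 1) Z = coef v Z := by
    intro v hv
    cases v with
    | nil => simp at hv
    | cons x w =>
      rw [List.rotate_cons_succ, List.rotate_zero, c1 x w (by simpa using hv),
        c2 x w (by simpa using hv)]
  have rot : ∀ (k : ℕ) (v : List (Gen g)), v.length = n + 1 →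
      coef (v.rotate k) Z = coef v Z := by
    intro k
    induction k with
    | zero => intro v _; rw [List.rotate_zero]
    | succ k ih =>
      intro v hv
      rw [← List.rotate_rotate, rot1 _ (by rw [List.length_rotate, hv]), ih v hv]
  have e1 : cyc y Z - ∑ v : Word g (n + 1), coef v.1 Z • cyc y (mono v.1) ∈
      augPow g (n + 1) := by
    have := cyc_mem y (sub_sum_coef_mem hZm) (k := n + 1) (by omega)
    simpa only [map_sub, map_sum, map_smul] using this
  have e2 : ∑ v : Word g (n + 1), coef v.1 Z • cyc y (mono v.1) -
      ∑ v : Word g (n + 1), coef v.1 Z • ∑ k ∈ Finset.range (n + 1),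
        (if (v.1.rotate k).head? = some y then mono (v.1.rotate k).tail else 0) ∈
      augPow g (n + 1) := by
    rw [← Finset.sum_sub_distrib]
    refine sum_mem fun v _ => ?_
    rw [← smul_sub]
    have := cyc_mono_congr y v.1
    rw [v.2] at this
    exact augPow_smul _ this
  have e3 : ∑ v : Word g (n + 1), coef v.1 Z • ∑ k ∈ Finset.range (n + 1),
        (if (v.1.rotate k).head? = some y then mono (v.1.rotate k).tail else 0) =
      ((n : ℚ) + 1) • ∑ w : Word g n, coef w.1 (z y) • mono w.1 := by
    simp only [Finset.smul_sum]
    rw [Finset.sum_comm]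
    have : ∀ k ∈ Finset.range (n + 1), ∑ v : Word g (n + 1), coef v.1 Z •
        (if (v.1.rotate k).head? = some y then mono (v.1.rotate k).tail else 0) =
        ∑ w : Word g n, coef w.1 (z y) • mono w.1 := by
      intro k _
      have h1 : ∑ v : Word g (n + 1), coef v.1 Z •
          (if (v.1.rotate k).head? = some y then mono (v.1.rotate k).tail else 0) =
          ∑ v : Word g (n + 1), coef v.1 Z • (if v.1.head? = some y then mono v.1.tail else 0) := by
        -- `Z` is cyclically symmetric, so all rotations contribute equally.
        let e : Word g (n + 1) → Word g (n + 1) := fun v =>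
          ⟨v.1.rotate k, by rw [List.length_rotate, v.2]⟩
        have he : Function.Bijective e := by
          refine Finite.injective_iff_bijective.1 fun v w hvw => Subtype.ext ?_
          exact List.rotate_injective k (congrArg Subtype.val hvw)
        refine Fintype.sum_bijective e he _ _ fun v => ?_
        rw [← rot k v.1 v.2]
      rw [h1, sum_word_succ (fun v => coef v Z • (if v.head? = some y then mono v.tail else 0)),
        Finset.sum_eq_single y]
      · refine Finset.sum_congr rfl fun w _ => ?_
        rw [c2 y w.1 w.2]; simp
      · intro x _ hx
        refine Finset.sum_eq_zero fun w _ => ?_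
        simp [hx]
      · simp
    rw [Finset.sum_congr rfl this, Finset.sum_const, Finset.card_range, ← Finset.smul_sum,
      ← Nat.cast_smul_eq_nsmul ℚ]
    push_cast
    rfl
  have e4 := augPow_smul ((n : ℚ) + 1) (sub_sum_coef_mem (hz y))
  rw [smul_sub] at e4
  have := sub_mem (add_mem e1 e2) e4
  rw [e3] at this
  convert this using 1
  abel

end Words

/-! ### The tensor square of the group algebra -/

section TensorSquare

variable {g : ℕ}

/-- The `m`-th power of the augmentation ideal of the tensor square of the group algebra. -/
abbrev tensPow (g m : ℕ) : Ideal (GrpAlg g ⊗[ℚ] GrpAlg g) := augIdeal (augTensor g) ^ m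

theorem tensPow_anti {m n : ℕ} (h : m ≤ n) {a : GrpAlg g ⊗[ℚ] GrpAlg g} (ha : a ∈ tensPow g n) :
    a ∈ tensPow g m :=
  Ideal.pow_le_pow_right h ha

theorem tensPow_smul {m : ℕ} {a : GrpAlg g ⊗[ℚ] GrpAlg g} (c : ℚ) (ha : a ∈ tensPow g m) :
    c • a ∈ tensPow g m := Submodule.smul_of_tower_mem _ c ha

theorem tmul_mem {i j m : ℕ} {a b : GrpAlg g} (ha : a ∈ augPow g i) (hb : b ∈ augPow g j)
    (h : m ≤ i + j) : a ⊗ₜ[ℚ] b ∈ tensPow g m := by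
  have h1 : a ⊗ₜ[ℚ] (1 : GrpAlg g) ∈ tensPow g i :=
    augIdeal_pow_le (εB := aug g) (εC := augTensor g) Algebra.TensorProduct.includeLeft
      (by ext; simp) i ha
  have h2 : (1 : GrpAlg g) ⊗ₜ[ℚ] b ∈ tensPow g j :=
    augIdeal_pow_le (εB := aug g) (εC := augTensor g) Algebra.TensorProduct.includeRight
      (by ext; simp) j hb
  refine tensPow_anti h ?_
  rw [tensPow, Ideal.IsTwoSided.pow_add]
  have := Ideal.mul_mem_mul h1 h2
  rwa [Algebra.TensorProduct.tmul_mul_tmul, one_mul, mul_one] at this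

/-- The tensors `a ⊗ b` with `a ∈ I ^ i` and `b ∈ I ^ j`, where `i + j = m`. -/
def pureTensors (g m : ℕ) : Set (GrpAlg g ⊗[ℚ] GrpAlg g) :=
  {t | ∃ i j a b, i + j = m ∧ a ∈ augPow g i ∧ b ∈ augPow g j ∧ t = a ⊗ₜ[ℚ] b}

theorem tensPow_le_span {m : ℕ} {t : GrpAlg g ⊗[ℚ] GrpAlg g} (ht : t ∈ tensPow g m) :
    t ∈ Submodule.span ℚ (pureTensors g m) := by
  have key : ∀ m, ∀ t ∈ Submodule.span ℚ (pureTensors g m), ∀ s : GrpAlg g ⊗[ℚ] GrpAlg g,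
      s * t - augTensor g s • t ∈ Submodule.span ℚ (pureTensors g (m + 1)) := by
    intro m t ht s
    induction ht using Submodule.span_induction with
    | zero => simp
    | add x y _ _ hx hy =>
      rw [mul_add, smul_add, add_sub_add_comm]; exact add_mem hx hy
    | smul c x _ hx =>
      rw [mul_smul_comm, smul_comm, ← smul_sub]; exact Submodule.smul_mem _ c hx
    | mem x hx =>
      obtain ⟨i, j, a, b, hij, ha, hb, rfl⟩ := hx
      induction s using TensorProduct.induction_on with
      | zero => simp
      | add x y hx hy =>
        rw [add_mul, map_add, add_smul, add_sub_add_comm]; exact add_mem hx hy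
      | tmul c d =>
        have e : augTensor g (c ⊗ₜ[ℚ] d) = aug g c * aug g d := rfl
        have h1 : (c * a - aug g c • a) ⊗ₜ[ℚ] (d * b) ∈
            Submodule.span ℚ (pureTensors g (m + 1)) := by
          refine Submodule.subset_span ⟨i + 1, j, _, _, by omega, ?_, augPow_mul_left _ hb, rfl⟩
          have := mul_mem_augPow (sub_aug_mem c) ha
          rwa [sub_mul, smul_one_mul, add_comm 1 i] at this
        have h2 : aug g c • (a ⊗ₜ[ℚ] (d * b - aug g d • b)) ∈
            Submodule.span ℚ (pureTensors g (m + 1)) := by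
          refine Submodule.smul_mem _ _ (Submodule.subset_span ⟨i, j + 1, _, _, by omega, ha, ?_,
            rfl⟩)
          have := mul_mem_augPow (sub_aug_mem d) hb
          rwa [sub_mul, smul_one_mul, add_comm 1 j] at this
        rw [e, Algebra.TensorProduct.tmul_mul_tmul]
        convert add_mem h1 h2 using 1
        rw [TensorProduct.sub_tmul, TensorProduct.tmul_sub, smul_sub, ← TensorProduct.smul_tmul',
          TensorProduct.tmul_smul, mul_smul]
        abel
  induction m generalizing t with
  | zero =>
    induction t using TensorProduct.induction_on with
    | zero => simp
    | add x y hx hy =>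
      have hT : ∀ x : GrpAlg g ⊗[ℚ] GrpAlg g, x ∈ tensPow g 0 := fun x => by
        rw [tensPow, Submodule.pow_zero, Ideal.one_eq_top]; trivial
      exact add_mem (hx (hT x)) (hy (hT y))
    | tmul a b =>
      exact Submodule.subset_span ⟨0, 0, a, b, rfl, augPow_zero a, augPow_zero b, rfl⟩
  | succ m ih =>
    rw [tensPow, Ideal.IsTwoSided.pow_succ] at ht
    refine Submodule.smul_induction_on
      (p := fun t => t ∈ Submodule.span ℚ (pureTensors g (m + 1))) ht ?_ fun a b => add_mem
    intro s hs t ht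
    have hs' : augTensor g s = 0 := hs
    have := key m t (ih ht) s
    rwa [hs', zero_smul, sub_zero] at this

theorem tensPow_map_le {M : Type*} [AddCommGroup M] [Module ℚ M] {m : ℕ} {S : Submodule ℚ M}
    (f : GrpAlg g ⊗[ℚ] GrpAlg g →ₗ[ℚ] M)
    (h : ∀ i j a b, i + j = m → a ∈ augPow g i → b ∈ augPow g j → f (a ⊗ₜ[ℚ] b) ∈ S)
    {t : GrpAlg g ⊗[ℚ] GrpAlg g} (ht : t ∈ tensPow g m) : f t ∈ S := by
  have : Submodule.span ℚ (pureTensors g m) ≤ S.comap f := by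
    rw [Submodule.span_le]
    rintro _ ⟨i, j, a, b, hij, ha, hb, rfl⟩
    exact h i j a b hij ha hb
  exact this (tensPow_le_span ht)

/-- The coproduct of the group algebra. -/
abbrev comul (g : ℕ) : GrpAlg g →ₐ[ℚ] GrpAlg g ⊗[ℚ] GrpAlg g :=
  Bialgebra.comulAlgHom ℚ (GrpAlg g)

theorem comul_pt (v : Pi1 g) : comul g (pt v) = pt v ⊗ₜ[ℚ] pt v := by
  simp [pt]

theorem comul_mem {m : ℕ} {a : GrpAlg g} (ha : a ∈ augPow g m) : comul g a ∈ tensPow g m :=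
  augIdeal_pow_le (εB := aug g) (εC := augTensor g) (comul g) (by
    apply MonoidAlgebra.algHom_ext
    · intro x
      simp
    · ext) m ha

end TensorSquare

/-! ### Primitive leading terms are Lie polynomials -/

section Dynkin

variable {g : ℕ}

/-- The antipode of the group algebra. -/
def antip : GrpAlg g →ₗ[ℚ] GrpAlg g := linExt fun v => pt v⁻¹

theorem antip_pt (v : Pi1 g) : antip (pt v) = pt v⁻¹ := linExt_pt _ _

theorem antip_mul (a b : GrpAlg g) : antip (a * b) = antip b * antip a := by
  induction a using pt_induction with
  | add a a' h h' => simp only [add_mul, mul_add, map_add, h, h']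
  | smul c a h => simp only [smul_mul_assoc, mul_smul_comm, map_smul, h]
  | pt v =>
    induction b using pt_induction with
    | add a a' h h' => simp only [mul_add, add_mul, map_add, h, h']
    | smul c a h => simp only [smul_mul_assoc, mul_smul_comm, map_smul, h]
    | pt w => rw [← map_mul, antip_pt, antip_pt, antip_pt, mul_inv_rev, map_mul]

theorem antip_mem {m : ℕ} {a : GrpAlg g} (ha : a ∈ augPow g m) : antip a ∈ augPow g m := by
  induction m generalizing a with
  | zero => exact augPow_zero _
  | succ m ih =>
    refine augPow_succ_le (S := (augPowQ g (m + 1)).comap antip) (fun b hb x => ?_) ha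
    change antip (b * gX x) ∈ augPow g (m + 1)
    rw [antip_mul]
    refine mul_mem_augPow_of_le (m := 1) ?_ (ih hb) (by omega)
    rw [gX, map_sub, antip_pt, ← (pt : Pi1 g →* _).map_one, antip_pt, inv_one, map_one]
    exact pt_sub_one_mem _

/-- The derivation of the group algebra that maps `x` to `x - 1` for every generator `x`; it
multiplies leading terms by their degree. -/
def euler (g : ℕ) : GrpAlg g →ₗ[ℚ] GrpAlg g := (exists_isDer (gX : Gen g → GrpAlg g)).choose

theorem euler_isDer : IsDer (euler g) := (exists_isDer (gX : Gen g → GrpAlg g)).choose_spec.1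

theorem euler_of (x : Gen g) : euler g (pt (FreeGroup.of x)) = gX x :=
  (exists_isDer (gX : Gen g → GrpAlg g)).choose_spec.2 x

theorem euler_gX (x : Gen g) : euler g (gX x) = gX x := by
  rw [gX, map_sub, euler_of, euler_isDer.map_one, sub_zero, gX]

theorem euler_mem {m : ℕ} {a : GrpAlg g} (ha : a ∈ augPow g m) : euler g a ∈ augPow g m :=
  euler_isDer.mem_augPow (s := 1) (fun x => by rw [euler_of]; exact gX_mem x) ha (by omega)

theorem euler_congr {n : ℕ} {a : GrpAlg g} (ha : a ∈ augPow g n) :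
    euler g a - (n : ℚ) • a ∈ augPow g (n + 1) := by
  induction n generalizing a with
  | zero =>
    rw [Nat.cast_zero, zero_smul, sub_zero]
    exact euler_isDer.mem_augPow_of_gen (s := 1) (fun x => by rw [euler_of]; exact gX_mem x) a
  | succ n ih =>
    refine augPow_succ_le (S := (augPowQ g (n + 2)).comap
      (euler g - ((n + 1 : ℕ) : ℚ) • LinearMap.id)) (fun b hb x => ?_) ha
    change euler g (b * gX x) - ((n + 1 : ℕ) : ℚ) • (b * gX x) ∈ augPow g (n + 2)
    have := mul_mem_augPow (ih hb) (gX_mem x)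
    rw [euler_isDer, euler_gX]
    convert this using 1
    rw [sub_mul, Nat.cast_succ, add_smul, one_smul, smul_mul_assoc]
    abel

/-- The convolution of the antipode with the Euler derivation. On leading terms it is the
left-normed bracketing operator of Dynkin. -/
def dynkin (g : ℕ) : GrpAlg g →ₗ[ℚ] GrpAlg g := linExt fun v => pt v⁻¹ * euler g (pt v)

theorem dynkin_eq (a : GrpAlg g) : dynkin g a =
    TensorProduct.lift ((LinearMap.mul ℚ (GrpAlg g)).compl₁₂ antip (euler g)) (comul g a) := by
  induction a using pt_induction with
  | add a b ha hb => simp only [map_add, ha, hb]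
  | smul c a ha => simp only [map_smul, ha]
  | pt v =>
    rw [comul_pt, TensorProduct.lift.tmul, LinearMap.compl₁₂_apply, antip_pt, dynkin, linExt_pt]
    rfl

theorem dynkin_mul_gX (x : Gen g) (a : GrpAlg g) : dynkin g (a * gX x) =
    pt (FreeGroup.of x)⁻¹ * (dynkin g a * gX x - gX x * dynkin g a) +
      aug g a • (pt (FreeGroup.of x)⁻¹ * gX x) := by
  induction a using pt_induction with
  | add a b ha hb => simp only [add_mul, map_add, ha, hb, mul_add, mul_sub, add_smul]; abel
  | smul c a ha =>
    simp only [smul_mul_assoc, mul_smul_comm, map_smul, ha, smul_add, smul_sub, mul_sub,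
      smul_assoc]
  | pt v =>
    have h1 : dynkin g (pt v * pt (FreeGroup.of x)) = pt (FreeGroup.of x)⁻¹ *
        (dynkin g (pt v) * pt (FreeGroup.of x)) + pt (FreeGroup.of x)⁻¹ * gX x := by
      rw [← map_mul, dynkin, linExt_pt, linExt_pt, mul_inv_rev, map_mul pt v, euler_isDer, euler_of,
        map_mul]
      simp only [mul_add, mul_assoc, pt_inv_mul_cancel_left]
    nth_rw 1 [gX]
    rw [mul_sub, mul_one, map_sub, h1, aug_pt, one_smul, show dynkin g (pt v) * gX x -
      gX x * dynkin g (pt v) = dynkin g (pt v) * pt (FreeGroup.of x) -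
        pt (FreeGroup.of x) * dynkin g (pt v) by rw [gX, mul_sub, sub_mul, mul_one, one_mul]; abel,
      mul_sub, pt_inv_mul_cancel_left]
    abel

/-- The left-normed bracket of the elements `x - 1` given by a word. -/
def lieMono : List (Gen g) → GrpAlg g
  | [] => 0
  | [x] => gX x
  | x :: y :: w => lieMono (y :: w) * gX x - gX x * lieMono (y :: w)

theorem lieMono_mem (w : List (Gen g)) : lieMono w ∈ augPow g w.length := by
  induction w with
  | nil => exact augPow_zero _
  | cons x w ih =>
    cases w with
    | nil => exact gX_mem x
    | cons y w =>
      exact sub_mem (mul_mem_augPow_of_le ih (gX_mem x) le_rfl)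
        (mul_mem_augPow_of_le (gX_mem x) ih (by simp))

theorem dynkin_mono_congr (w : List (Gen g)) :
    dynkin g (mono w) - lieMono w ∈ augPow g (w.length + 1) := by
  induction w with
  | nil =>
    rw [mono, lieMono, sub_zero, ← (pt : Pi1 g →* _).map_one, dynkin, linExt_pt, map_one,
      euler_isDer.map_one, mul_zero]
    exact zero_mem _
  | cons x w ih =>
    cases w with
    | nil =>
      rw [mono, dynkin_mul_gX]
      have h0 : dynkin g (mono []) = 0 := by
        rw [mono, ← (pt : Pi1 g →* _).map_one, dynkin, linExt_pt, map_one,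
          euler_isDer.map_one, mul_zero]
      rw [h0, zero_mul, mul_zero, sub_zero, mul_zero, zero_add, mono, map_one, one_smul]
      exact pt_mul_congr _ (gX_mem x)
    | cons y w =>
      have h0 : aug g (mono (y :: w)) = 0 :=
        mem_augPow_one.1 (augPow_anti (by simp) (mono_mem (y :: w)))
      rw [mono, dynkin_mul_gX, h0, zero_smul, add_zero]
      have h1 : dynkin g (mono (y :: w)) ∈ augPow g (y :: w).length := by
        have := add_mem (augPow_anti (Nat.le_succ _) ih) (lieMono_mem (y :: w))
        rwa [sub_add_cancel] at this
      have h2 : dynkin g (mono (y :: w)) * gX x - gX x * dynkin g (mono (y :: w)) ∈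
          augPow g ((y :: w).length + 1) :=
        sub_mem (mul_mem_augPow h1 (gX_mem x))
          (mul_mem_augPow_of_le (gX_mem x) h1 (by omega))
      have h3 := pt_mul_congr (FreeGroup.of x)⁻¹ h2
      have h4 := sub_mem (mul_mem_augPow ih (gX_mem x))
        (mul_mem_augPow_of_le (k := (y :: w).length + 1 + 1) (gX_mem x) ih (by omega))
      have := add_mem h3 h4
      rw [lieMono, show (x :: y :: w).length = (y :: w).length + 1 from rfl]
      convert this using 1
      simp only [sub_mul, mul_sub]
      abel

/-- An element of `I ^ n` whose leading term is primitive has a Lie polynomial as leading term: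
the operator `dynkin` is the convolution of the antipode with `euler`, hence agrees with `euler`, that
is with multiplication by `n`, on primitive leading terms. -/
theorem smul_sub_sum_lieMono_mem {n : ℕ} {b : GrpAlg g} (hb : b ∈ augPow g n)
    (h : comul g b - b ⊗ₜ[ℚ] 1 - 1 ⊗ₜ[ℚ] b ∈ tensPow g (n + 1)) :
    (n : ℚ) • b - ∑ w : Word g n, coef w.1 b • lieMono w.1 ∈ augPow g (n + 1) := by
  have hF : ∀ {m : ℕ} {t : GrpAlg g ⊗[ℚ] GrpAlg g}, t ∈ tensPow g m → TensorProduct.lift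
      ((LinearMap.mul ℚ (GrpAlg g)).compl₁₂ antip (euler g)) t ∈ augPowQ g m := by
    intro m t ht
    refine tensPow_map_le _ ?_ ht
    rintro i j a b rfl ha hb
    exact mul_mem_augPow (antip_mem ha) (euler_mem hb)
  have h1 : dynkin g b - euler g b ∈ augPow g (n + 1) := by
    have := hF h
    rw [map_sub, map_sub, ← dynkin_eq, TensorProduct.lift.tmul, TensorProduct.lift.tmul,
      LinearMap.compl₁₂_apply, LinearMap.compl₁₂_apply, euler_isDer.map_one, map_zero, sub_zero,
      ← (pt : Pi1 g →* _).map_one, antip_pt, inv_one, map_one] at this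
    simpa using this
  have h2 : dynkin g b - ∑ w : Word g n, coef w.1 b • lieMono w.1 ∈ augPow g (n + 1) := by
    have e : dynkin g (b - ∑ w : Word g n, coef w.1 b • mono w.1) ∈ augPow g (n + 1) := by
      rw [dynkin_eq]; exact hF (comul_mem (sub_sum_coef_mem hb))
    have e2 : ∑ w : Word g n, coef w.1 b • (dynkin g (mono w.1) - lieMono w.1) ∈
        augPow g (n + 1) := by
      refine sum_mem fun w _ => augPow_smul _ ?_
      have := dynkin_mono_congr w.1
      rwa [w.2] at this
    have := add_mem e e2
    rw [map_sub, map_sum] at this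
    simp only [map_smul, smul_sub, Finset.sum_sub_distrib] at this
    rwa [sub_add_sub_cancel] at this
  have h3 := sub_mem (sub_mem h2 h1) (euler_congr hb)
  convert h3 using 1
  abel

end Dynkin

/-! ### The truncated logarithm -/

section Log

/-- The truncation `∑_{j < N} l_j x ^ j` of `log (1 + x)`. -/
def logTrunc {S : Type*} [Ring S] [Algebra ℚ S] (N : ℕ) (x : S) : S :=
  ∑ j ∈ Finset.range N, PowerSeries.coeff j (PowerSeries.log ℚ) • x ^ j

theorem map_logTrunc {S T : Type*} [Ring S] [Algebra ℚ S] [Ring T] [Algebra ℚ T] (f : S →ₐ[ℚ] T)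
    (N : ℕ) (x : S) : f (logTrunc N x) = logTrunc N (f x) := by
  simp only [logTrunc, map_sum, map_smul, map_pow]

theorem logTrunc_zero {S : Type*} [Ring S] [Algebra ℚ S] (N : ℕ) : logTrunc N (0 : S) = 0 := by
  refine Finset.sum_eq_zero fun j _ => ?_
  rcases Nat.eq_zero_or_pos j with rfl | hj
  · simp
  · rw [zero_pow hj.ne', smul_zero]

theorem one_add_mul_derivative_logTrunc {S : Type*} [CommRing S] [Algebra ℚ S] {N : ℕ}
    {x : Polynomial S} (hx : x ^ N = 0) :
    (1 + x) * Polynomial.derivative (logTrunc (N + 1) x) = Polynomial.derivative x := by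
  have h1 : Polynomial.derivative (logTrunc (N + 1) x) =
      (∑ i ∈ Finset.range N, (-x) ^ i) * Polynomial.derivative x := by
    rw [logTrunc, Polynomial.derivative_sum, Finset.sum_range_succ', Finset.sum_mul]
    have h0 : Polynomial.derivative
        (PowerSeries.coeff 0 (PowerSeries.log ℚ) • x ^ 0) = 0 := by simp
    rw [h0, add_zero]
    refine Finset.sum_congr rfl fun i _ => ?_
    have hi : ((i : ℚ) + 1) ≠ 0 := by positivity
    rw [Polynomial.derivative_smul, Polynomial.derivative_pow, PowerSeries.coeff_log,
      if_neg (Nat.succ_ne_zero i), neg_pow x, Nat.add_sub_cancel]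
    have e : (Polynomial.C ((i + 1 : ℕ) : S) : Polynomial S) =
        algebraMap ℚ (Polynomial S) ((i : ℚ) + 1) := by
      simp
    have e2 : ((-1 : Polynomial S)) ^ i = algebraMap ℚ (Polynomial S) ((-1) ^ i) := by simp
    rw [e, e2, Algebra.smul_def, ← mul_assoc, ← mul_assoc, ← map_mul]
    congr 3
    simp only [Algebra.algebraMap_self, RingHom.id_apply]
    push_cast
    field_simp
    ring
  have h2 := mul_neg_geom_sum (-x) N
  rw [sub_neg_eq_add, neg_pow, hx, mul_zero, sub_zero] at h2
  rw [h1, ← mul_assoc, h2, one_mul]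

theorem exists_logTrunc_add_comm {S : Type*} [CommRing S] [Algebra ℚ S] {u v : S}
    (hu : IsNilpotent u) (hv : IsNilpotent v) :
    ∃ K, ∀ N, K ≤ N → logTrunc N (u + v + u * v) = logTrunc N u + logTrunc N v := by
  let w₁ : Polynomial S := Polynomial.C u * Polynomial.X
  let w₂ : Polynomial S := Polynomial.C v * Polynomial.X
  have h1 : IsNilpotent w₁ := (Commute.all _ _).isNilpotent_mul_right (hu.map Polynomial.C)
  have h2 : IsNilpotent w₂ := (Commute.all _ _).isNilpotent_mul_right (hv.map Polynomial.C)
  have h3 : IsNilpotent (w₁ + w₂ + w₁ * w₂) :=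
    (Commute.all _ _).isNilpotent_add ((Commute.all _ _).isNilpotent_add h1 h2)
      ((Commute.all _ _).isNilpotent_mul_right h1)
  obtain ⟨n₁, e₁⟩ := h1
  obtain ⟨n₂, e₂⟩ := h2
  obtain ⟨n₃, e₃⟩ := h3
  refine ⟨n₁ + n₂ + n₃ + 1, fun N hN => ?_⟩
  obtain ⟨M, rfl⟩ : ∃ M, N = M + 1 := ⟨N - 1, by omega⟩
  have d₁ := one_add_mul_derivative_logTrunc (pow_eq_zero_of_le (by omega : n₁ ≤ M) e₁)
  have d₂ := one_add_mul_derivative_logTrunc (pow_eq_zero_of_le (by omega : n₂ ≤ M) e₂)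
  have d₃ := one_add_mul_derivative_logTrunc (pow_eq_zero_of_le (by omega : n₃ ≤ M) e₃)
  have hunit : IsUnit (1 + (w₁ + w₂ + w₁ * w₂)) := IsNilpotent.isUnit_one_add ⟨n₃, e₃⟩
  have hd : Polynomial.derivative (logTrunc (M + 1) (w₁ + w₂ + w₁ * w₂) - logTrunc (M + 1) w₁ -
      logTrunc (M + 1) w₂) = 0 := by
    refine hunit.mul_right_eq_zero.mp ?_
    rw [map_sub, map_sub, mul_sub, mul_sub, d₃]
    have a₁ : (1 + (w₁ + w₂ + w₁ * w₂)) * Polynomial.derivative (logTrunc (M + 1) w₁) =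
        (1 + w₂) * Polynomial.derivative w₁ := by rw [← d₁]; ring
    have a₂ : (1 + (w₁ + w₂ + w₁ * w₂)) * Polynomial.derivative (logTrunc (M + 1) w₂) =
        (1 + w₁) * Polynomial.derivative w₂ := by rw [← d₂]; ring
    rw [a₁, a₂, map_add, map_add, Polynomial.derivative_mul (f := w₁) (g := w₂)]
    ring
  have : IsAddTorsionFree S := IsAddTorsionFree.of_module_rat S
  have hc := Polynomial.eq_C_of_natDegree_eq_zero (Polynomial.derivative_eq_zero.mp hd)
  have ev : ∀ (t : S) (p : Polynomial S), (logTrunc (M + 1) p).eval t =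
      logTrunc (M + 1) (p.eval t) := fun t p => by
    simp only [logTrunc, Polynomial.eval_finsetSum, Polynomial.eval_smul, Polynomial.eval_pow]
  have c0 := congrArg (Polynomial.eval 0) hc
  have c1 := congrArg (Polynomial.eval 1) hc
  simp only [Polynomial.eval_sub, ev, Polynomial.eval_C] at c0 c1
  simp only [w₁, w₂, Polynomial.eval_add, Polynomial.eval_mul, Polynomial.eval_C,
    Polynomial.eval_X, mul_zero, add_zero, mul_one, logTrunc_zero, sub_zero] at c0 c1
  rw [← c0, sub_sub, sub_eq_zero] at c1
  exact c1

/-- The functional equation of the logarithm for commuting nilpotent elements. -/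
theorem exists_logTrunc_add {S : Type*} [Ring S] [Algebra ℚ S] {u v : S} (huv : Commute u v)
    (hu : IsNilpotent u) (hv : IsNilpotent v) :
    ∃ K, ∀ N, K ≤ N → logTrunc N (u + v + u * v) = logTrunc N u + logTrunc N v := by
  let R := Algebra.adjoin ℚ ({u, v} : Set S)
  have : IsMulCommutative R := Algebra.isMulCommutative_adjoin ℚ (by
    rintro a (rfl | rfl) b (rfl | rfl)
    · rfl
    · exact huv
    · exact huv.symm
    · rfl)
  let _ : CommRing R := { (inferInstance : Ring R) with mul_comm := mul_comm' }
  let u' : R := ⟨u, Algebra.subset_adjoin (by simp)⟩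
  let v' : R := ⟨v, Algebra.subset_adjoin (by simp)⟩
  have hu' : IsNilpotent u' := by
    obtain ⟨n, hn⟩ := hu
    exact ⟨n, Subtype.ext hn⟩
  have hv' : IsNilpotent v' := by
    obtain ⟨n, hn⟩ := hv
    exact ⟨n, Subtype.ext hn⟩
  obtain ⟨K, hK⟩ := exists_logTrunc_add_comm hu' hv'
  refine ⟨K, fun N hN => ?_⟩
  have := congrArg R.val (hK N hN)
  rw [map_add, map_logTrunc, map_logTrunc, map_logTrunc] at this
  exact this

end Log

/-! ### Elements that are primitive up to a given order -/

section Primitive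

variable {g : ℕ}

/-- The elements `a` with `Δ a ≡ a ⊗ 1 + 1 ⊗ a` modulo the `m`-th power of the augmentation
ideal. -/
def primMod (g m : ℕ) : Submodule ℚ (GrpAlg g) :=
  ((tensPow g m).restrictScalars ℚ).comap ((comul g).toLinearMap -
    (Algebra.TensorProduct.includeLeft : GrpAlg g →ₐ[ℚ] _).toLinearMap -
    (Algebra.TensorProduct.includeRight : GrpAlg g →ₐ[ℚ] _).toLinearMap)

theorem mem_primMod {m : ℕ} {a : GrpAlg g} :
    a ∈ primMod g m ↔ comul g a - a ⊗ₜ[ℚ] 1 - 1 ⊗ₜ[ℚ] a ∈ tensPow g m := Iff.rfl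

theorem augPow_le_primMod {m : ℕ} {a : GrpAlg g} (ha : a ∈ augPow g m) : a ∈ primMod g m := by
  rw [mem_primMod]
  exact sub_mem (sub_mem (comul_mem ha) (tmul_mem ha (augPow_zero 1) (by omega)))
    (tmul_mem (augPow_zero 1) ha (by omega))

theorem conjSum_mem_primMod {m : ℕ} (p : GrpAlg g) {a : GrpAlg g} (ha : a ∈ primMod g m) :
    conjSum p a ∈ primMod g m := by
  induction p using pt_induction with
  | add p q hp hq => rw [map_add]; exact add_mem hp hq
  | smul c p hp => rw [map_smul]; exact Submodule.smul_mem _ c hp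
  | pt h =>
    rw [mem_primMod] at ha ⊢
    have := (tensPow g m).mul_mem_left (pt h⁻¹ ⊗ₜ[ℚ] pt h⁻¹)
      (Ideal.mul_mem_right (pt h ⊗ₜ[ℚ] pt h) _ ha)
    convert this using 1
    rw [conjSum_pt, map_mul, map_mul, comul_pt, comul_pt]
    simp only [sub_mul, mul_sub, Algebra.TensorProduct.tmul_mul_tmul, one_mul, pt_inv_mul]

theorem pow_mem_augPow {a : GrpAlg g} (ha : a ∈ augPow g 1) (n : ℕ) : a ^ n ∈ augPow g n := by
  rw [augPow, Submodule.pow_one] at ha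
  exact Ideal.pow_mem_pow ha n

theorem logTrunc_congr {m M N : ℕ} (h : m ≤ M) (h' : m ≤ N) {a : GrpAlg g} (ha : a ∈ augPow g 1) :
    logTrunc M a - logTrunc N a ∈ augPow g m := by
  have key : ∀ N, m ≤ N → logTrunc N a - logTrunc m a ∈ augPow g m := by
    intro N hN
    induction N, hN using Nat.le_induction with
    | base => rw [sub_self]; exact zero_mem _
    | succ n hn ih =>
      rw [logTrunc, Finset.sum_range_succ, add_sub_right_comm]
      refine add_mem ih (augPow_smul _ (augPow_anti hn (pow_mem_augPow ha n)))
  have := sub_mem (key M h) (key N h')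
  rwa [sub_sub_sub_cancel_right] at this

theorem logTrunc_mem_primMod {m N : ℕ} (h : m ≤ N) (γ : Pi1 g) :
    logTrunc N (pt γ - 1) ∈ primMod g m := by
  let q := Ideal.Quotient.mkₐ ℚ (tensPow g m)
  have hq : ∀ t, q t = 0 ↔ t ∈ tensPow g m := fun t => Ideal.Quotient.eq_zero_iff_mem
  have hnil : ∀ t ∈ tensPow g 1, IsNilpotent (q t) := fun t ht => ⟨m, by
    rw [← map_pow, hq]
    rw [tensPow, Submodule.pow_one] at ht
    exact Ideal.pow_mem_pow ht m⟩
  let u : GrpAlg g ⊗[ℚ] GrpAlg g := (pt γ - 1) ⊗ₜ[ℚ] 1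
  let v : GrpAlg g ⊗[ℚ] GrpAlg g := 1 ⊗ₜ[ℚ] (pt γ - 1)
  have huv : Commute (q u) (q v) := by
    refine Commute.map ?_ q
    change u * v = v * u
    simp [u, v, Algebra.TensorProduct.tmul_mul_tmul]
  obtain ⟨K, hK⟩ := exists_logTrunc_add huv
    (hnil u (tmul_mem (pt_sub_one_mem γ) (augPow_zero 1) (by omega)))
    (hnil v (tmul_mem (augPow_zero 1) (pt_sub_one_mem γ) (by omega)))
  have hK := hK (max K m) (le_max_left _ _)
  have e : comul g (pt γ - 1) = u + v + u * v := by
    rw [map_sub, comul_pt, map_one, Algebra.TensorProduct.one_def]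
    have e' : u * v = (pt γ - 1) ⊗ₜ[ℚ] (pt γ - 1) := by
      simp only [u, v, Algebra.TensorProduct.tmul_mul_tmul, one_mul, mul_one]
    rw [e']
    simp only [u, v, TensorProduct.sub_tmul, TensorProduct.tmul_sub]
    abel
  have h1 : logTrunc (max K m) (pt γ - 1) ∈ primMod g m := by
    rw [mem_primMod, ← hq, map_sub, map_sub, sub_sub, sub_eq_zero, map_logTrunc, map_logTrunc, e]
    rw [map_add, map_add, map_mul, hK]
    change _ = q ((Algebra.TensorProduct.includeLeft : GrpAlg g →ₐ[ℚ] _) _) +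
      q ((Algebra.TensorProduct.includeRight : GrpAlg g →ₐ[ℚ] _) _)
    rw [map_logTrunc, map_logTrunc, map_logTrunc, map_logTrunc]
    rfl
  have := add_mem h1 (augPow_le_primMod
    (logTrunc_congr h (le_max_right K m) (pt_sub_one_mem γ)))
  rwa [add_sub_cancel] at this

/-- The truncation `∑_{k < M} c_k (γ - 1) ^ k` of `(log γ) ^ 2`. -/
def logSqTrunc (M : ℕ) (γ : Pi1 g) : GrpAlg g :=
  ∑ k ∈ Finset.range M, PowerSeries.coeff k (PowerSeries.log ℚ ^ 2) • (pt γ - 1) ^ k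

theorem coeff_log_sq_zero : PowerSeries.coeff 0 (PowerSeries.log ℚ ^ 2) = 0 := by
  simp

theorem coeff_log_sq_one : PowerSeries.coeff 1 (PowerSeries.log ℚ ^ 2) = 0 := by
  rw [pow_two, PowerSeries.coeff_mul, Finset.Nat.antidiagonal_succ]
  simp

theorem coeff_log_sq_succ (j : ℕ) :
    ((j : ℚ) + 1) * PowerSeries.coeff (j + 1) (PowerSeries.log ℚ ^ 2) +
      (j : ℚ) * PowerSeries.coeff j (PowerSeries.log ℚ ^ 2) =
        2 * PowerSeries.coeff j (PowerSeries.log ℚ) := by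
  have h1 : (1 + PowerSeries.X) * PowerSeries.derivative ℚ (PowerSeries.log ℚ) = 1 := by
    rw [PowerSeries.deriv_log]
    ext n
    rw [add_mul, one_mul, map_add]
    cases n with
    | zero => simp
    | succ n =>
      rw [PowerSeries.coeff_succ_X_mul]
      simp [pow_succ]
  have h2 : (1 + PowerSeries.X) * PowerSeries.derivative ℚ (PowerSeries.log ℚ ^ 2) =
      2 * PowerSeries.log ℚ := by
    rw [pow_two, Derivation.leibniz, smul_eq_mul, ← two_mul, mul_left_comm, mul_left_comm _ _
      (PowerSeries.derivative ℚ _), h1, mul_one]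
  have h3 := congrArg (PowerSeries.coeff j) h2
  rw [add_mul, one_mul, map_add, PowerSeries.coeff_derivative] at h3
  have h4 : PowerSeries.coeff j (2 * PowerSeries.log ℚ) =
      2 * PowerSeries.coeff j (PowerSeries.log ℚ) := by
    rw [two_mul, two_mul, map_add]
  rw [h4] at h3
  rw [← h3, mul_comm]
  congr 1
  cases j with
  | zero => simp
  | succ n =>
    rw [PowerSeries.coeff_succ_X_mul, PowerSeries.coeff_derivative, mul_comm]
    push_cast
    rfl

theorem logSqTrunc_mem (M : ℕ) (γ : Pi1 g) : logSqTrunc M γ ∈ augPow g 2 := by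
  refine sum_mem fun k _ => ?_
  rcases Nat.lt_or_ge k 2 with h | h
  · have : PowerSeries.coeff k (PowerSeries.log ℚ ^ 2) = 0 := by
      interval_cases k
      · exact coeff_log_sq_zero
      · exact coeff_log_sq_one
    rw [this, zero_smul]; exact zero_mem _
  · exact augPow_smul _ (augPow_anti h (pow_mem_augPow (pt_sub_one_mem γ) k))

theorem logSqTrunc_sub_mem {M N : ℕ} (h : M ≤ N) (γ : Pi1 g) :
    logSqTrunc N γ - logSqTrunc M γ ∈ augPow g M := by
  induction N, h using Nat.le_induction with
  | base => rw [sub_self]; exact zero_mem _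
  | succ n hn ih =>
    rw [logSqTrunc, Finset.sum_range_succ, add_sub_right_comm]
    refine add_mem ih (augPow_smul _ (augPow_anti hn (pow_mem_augPow (pt_sub_one_mem γ) n)))

/-- The cyclic derivative of `(log γ) ^ 2` is a combination of conjugates of `2 log γ`, because
`(1 + X) d/dX log (1 + X) ^ 2 = 2 log (1 + X)`. -/
theorem cyc_logSqTrunc_congr (x : Gen g) (M : ℕ) (γ : Pi1 g) :
    cyc x (logSqTrunc (M + 1) γ) - conjSum (fox x (pt γ)) ((2 : ℚ) • logTrunc M (pt γ - 1)) ∈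
      augPow g M := by
  have h1 : ∀ c, nabla x (pt γ - 1) c = conjSum (fox x (pt γ)) (pt γ * c) := fun c => by
    rw [map_sub, LinearMap.sub_apply, nabla_one, sub_zero, nabla_pt]
  have h2 : cyc x (logSqTrunc (M + 1) γ) = conjSum (fox x (pt γ)) (∑ k ∈ Finset.range (M + 1),
      (PowerSeries.coeff k (PowerSeries.log ℚ ^ 2) * (k : ℚ)) •
        (pt γ * (pt γ - 1) ^ (k - 1))) := by
    rw [logSqTrunc, map_sum, map_sum]
    refine Finset.sum_congr rfl fun k _ => ?_
    rw [map_smul, map_smul, cyc_apply, nabla_pow x _ k 1 (Commute.one_left _), h1, mul_one,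
      mul_smul]
  rw [h2, ← map_sub]
  refine conjSum_mem _ ?_
  have h3 : ∑ k ∈ Finset.range (M + 1), (PowerSeries.coeff k (PowerSeries.log ℚ ^ 2) * (k : ℚ)) •
        (pt γ * (pt γ - 1) ^ (k - 1)) = (2 : ℚ) • logTrunc M (pt γ - 1) +
          (PowerSeries.coeff M (PowerSeries.log ℚ ^ 2) * (M : ℚ)) • (pt γ - 1) ^ M := by
    clear h2
    induction M with
    | zero => simp [logTrunc]
    | succ M ih =>
      rw [Finset.sum_range_succ, ih, logTrunc, logTrunc, Finset.sum_range_succ, smul_add,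
        smul_smul (2 : ℚ), ← coeff_log_sq_succ]
      have : pt γ * (pt γ - 1) ^ M = (pt γ - 1) ^ (M + 1) + (pt γ - 1) ^ M := by
        rw [pow_succ']; noncomm_ring
      rw [Nat.add_sub_cancel, this, add_smul, mul_comm (M : ℚ), smul_add]
      push_cast
      rw [mul_comm ((M : ℚ) + 1)]
      abel
  rw [h3, add_sub_cancel_left]
  exact augPow_smul _ (pow_mem_augPow (pt_sub_one_mem γ) M)

theorem cyc_logSqTrunc_mem_primMod (x : Gen g) {m M : ℕ} (h : m + 1 ≤ M) (γ : Pi1 g) :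
    cyc x (logSqTrunc M γ) ∈ primMod g m := by
  obtain ⟨N, rfl⟩ : ∃ N, M = N + 1 := ⟨M - 1, by omega⟩
  have h1 := augPow_le_primMod (augPow_anti (by omega : m ≤ N) (cyc_logSqTrunc_congr x N γ))
  have h2 := conjSum_mem_primMod (fox x (pt γ))
    (Submodule.smul_mem _ (2 : ℚ) (logTrunc_mem_primMod (by omega : m ≤ N) γ))
  have := add_mem h1 h2
  rwa [sub_add_cancel] at this

theorem crossSum_mem_primMod (r : ℕ) {m : ℕ} {u : GrpAlg g}
    (h : ∀ x, cyc x u ∈ primMod g m) : crossSum r u ∈ primMod g m := by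
  rw [crossSum_apply]
  refine sum_mem fun x _ => sub_mem (Submodule.smul_mem _ _ (h x)) (Submodule.smul_mem _ _ ?_)
  have := conjSum_mem_primMod (pt (FreeGroup.of x)) (h x)
  rwa [conjSum_pt] at this

/-- The endomorphism `d ⊗ 1 + 1 ⊗ d` of the tensor square. -/
def tensDer (d : GrpAlg g →ₗ[ℚ] GrpAlg g) :
    GrpAlg g ⊗[ℚ] GrpAlg g →ₗ[ℚ] GrpAlg g ⊗[ℚ] GrpAlg g :=
  d.rTensor (GrpAlg g) + d.lTensor (GrpAlg g)

theorem tensDer_tmul (d : GrpAlg g →ₗ[ℚ] GrpAlg g) (a b : GrpAlg g) :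
    tensDer d (a ⊗ₜ[ℚ] b) = d a ⊗ₜ[ℚ] b + a ⊗ₜ[ℚ] d b := rfl

theorem tensDer_mul {d : GrpAlg g →ₗ[ℚ] GrpAlg g} (hd : IsDer d) (s t : GrpAlg g ⊗[ℚ] GrpAlg g) :
    tensDer d (s * t) = tensDer d s * t + s * tensDer d t := by
  induction s using TensorProduct.induction_on with
  | zero => simp
  | add s s' h h' => rw [add_mul, map_add, map_add, h, h', add_mul, add_mul]; abel
  | tmul a b =>
    induction t using TensorProduct.induction_on with
    | zero => simp
    | add s s' h h' => rw [mul_add, map_add, map_add, h, h', mul_add, mul_add]; abel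
    | tmul a' b' =>
      simp only [Algebra.TensorProduct.tmul_mul_tmul, tensDer_tmul, hd a, hd b, add_mul, mul_add,
        TensorProduct.add_tmul, TensorProduct.tmul_add]
      abel

/-- The action of `u` is compatible with the coproduct up to order `m`, if the cyclic derivatives
of `u` are primitive up to order `m`. -/
theorem comul_sigmaL_congr {m : ℕ} {u : GrpAlg g} (h : ∀ x, cyc x u ∈ primMod g m)
    (a : GrpAlg g) :
    comul g (sigmaL u a) - tensDer (sigmaL u) (comul g a) ∈ tensPow g m := by
  have hd := sigmaL_isDer u
  set d := sigmaL u with hd'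
  have hmul : ∀ a b, comul g (d (a * b)) - tensDer d (comul g (a * b)) =
      (comul g (d a) - tensDer d (comul g a)) * comul g b +
        comul g a * (comul g (d b) - tensDer d (comul g b)) := by
    intro a b
    rw [hd, map_mul, tensDer_mul hd, map_add, map_mul, map_mul, sub_mul, mul_sub]
    abel
  have h1 : comul g (d 1) - tensDer d (comul g 1) = 0 := by
    rw [hd.map_one, map_zero, map_one, Algebra.TensorProduct.one_def, tensDer_tmul, hd.map_one]
    simp
  induction a using pt_induction with
  | add a b ha hb =>
    simp only [map_add, add_sub_add_comm]; exact add_mem ha hb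
  | smul c a ha =>
    have := tensPow_smul c ha
    rw [smul_sub] at this
    rw [map_smul, map_smul, map_smul, map_smul]
    exact this
  | pt v =>
    have hinv : ∀ v : Pi1 g, comul g (d (pt v)) - tensDer d (comul g (pt v)) ∈ tensPow g m →
        comul g (d (pt v⁻¹)) - tensDer d (comul g (pt v⁻¹)) ∈ tensPow g m := by
      intro v hv
      have e := hmul (pt v⁻¹) (pt v)
      rw [pt_inv_mul, h1] at e
      have e2 := congrArg (· * comul g (pt v⁻¹)) e
      simp only [zero_mul, add_mul, mul_assoc] at e2
      rw [← map_mul (comul g), pt_mul_inv, map_one, mul_one] at e2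
      rw [eq_neg_of_add_eq_zero_left e2.symm]
      exact neg_mem ((tensPow g m).mul_mem_left _ (Ideal.mul_mem_right _ _ hv))
    have hgen : ∀ x : Gen g, comul g (d (pt (FreeGroup.of x))) -
        tensDer d (comul g (pt (FreeGroup.of x))) ∈ tensPow g m := by
      intro x
      have h1 := crossSum_mem_primMod (basedPos (x, false)) h
      have h2 := crossSum_mem_primMod (basedPos (x, true)) h
      rw [hd', sigmaL_of, comul_pt, tensDer_tmul, sigmaL_of]
      set p := crossSum (basedPos (x, false)) u
      set q := crossSum (basedPos (x, true)) u
      rw [mem_primMod] at h1 h2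
      have h3 := (tensPow g m).mul_mem_left (pt (FreeGroup.of x) ⊗ₜ[ℚ] pt (FreeGroup.of x)) h1
      have h4 := Ideal.mul_mem_right (pt (FreeGroup.of x) ⊗ₜ[ℚ] pt (FreeGroup.of x)) _ h2
      convert sub_mem h3 h4 using 1
      rw [map_sub, map_mul, map_mul, comul_pt]
      simp only [sub_mul, mul_sub, Algebra.TensorProduct.tmul_mul_tmul, TensorProduct.sub_tmul,
        TensorProduct.tmul_sub, one_mul, mul_one]
      abel
    induction v using FreeGroup.induction_on with
    | C1 => rw [MonoidHom.map_one, h1]; exact zero_mem _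
    | of x => exact hgen x
    | inv_of x _ => exact hinv _ (hgen x)
    | mul v w hv hw =>
      rw [map_mul pt, hmul]
      exact add_mem (Ideal.mul_mem_right _ _ hv) ((tensPow g m).mul_mem_left _ hw)

end Primitive

/-! ### The derivation of a twist modulo powers of the augmentation ideal -/

section TwistDerivation

variable {g : ℕ}

/-- The coordinate of the homology class of `a` along the generator `x`. -/
def hcoef (x : Gen g) : GrpAlg g →ₗ[ℚ] ℚ := (aug g).toLinearMap ∘ₗ fox x

theorem hcoef_apply (x : Gen g) (a : GrpAlg g) : hcoef x a = aug g (fox x a) := rfl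

theorem sub_sum_hcoef_mem {a : GrpAlg g} (ha : a ∈ augPow g 1) :
    a - ∑ x, hcoef x a • gX x ∈ augPow g 2 := by
  have h : ∀ a : GrpAlg g, a - aug g a • 1 - ∑ x, hcoef x a • gX x ∈ augPow g 2 := by
    intro a
    induction a using pt_induction with
    | add a b ha hb =>
      convert add_mem ha hb using 1
      simp only [map_add, add_smul, Finset.sum_add_distrib]
      abel
    | smul c a ha =>
      convert augPow_smul c ha using 1
      rw [map_smul, smul_sub, smul_sub, Finset.smul_sum]
      simp only [map_smul, smul_smul, smul_eq_mul]
    | pt v =>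
      rw [aug_pt, one_smul, ← sum_fox_mul_gX, ← Finset.sum_sub_distrib]
      refine sum_mem fun x _ => ?_
      rw [hcoef_apply, ← smul_one_mul, ← sub_mul]
      exact mul_mem_augPow (sub_aug_mem _) (gX_mem x)
  have := h a
  rwa [mem_augPow_one.mp ha, zero_smul, sub_zero] at this

/-- The intersection form on homology. -/
def omega (a b : GrpAlg g) : ℚ :=
  ∑ i, (hcoef (Sum.inl i) a * hcoef (Sum.inr i) b - hcoef (Sum.inr i) a * hcoef (Sum.inl i) b)

theorem omega_self (a : GrpAlg g) : omega a a = 0 :=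
  Finset.sum_eq_zero fun i _ => by ring

theorem omega_sub_one (a b : GrpAlg g) : omega a (b - 1) = omega a b := by
  have : ∀ x : Gen g, hcoef x (b - 1) = hcoef x b := fun x => by
    rw [map_sub, hcoef_apply x 1, fox_one, map_zero, sub_zero]
  simp only [omega, this]

theorem sigmaL_mem_self {n : ℕ} {u v : GrpAlg g} (hu : u ∈ augPow g 2) (hv : v ∈ augPow g n) :
    sigmaL u v ∈ augPow g n :=
  sigmaL_mem hu hv (by omega)

theorem cyc_logSqTrunc_congr_two (x : Gen g) {M : ℕ} (hM : 3 ≤ M) (γ : Pi1 g) :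
    cyc x (logSqTrunc M γ) - (2 * hcoef x (pt γ)) • (pt γ - 1) ∈ augPow g 2 := by
  obtain ⟨N, rfl⟩ : ∃ N, M = N + 1 := ⟨M - 1, by omega⟩
  have h1 := augPow_anti (by omega : 2 ≤ N) (cyc_logSqTrunc_congr x N γ)
  have h2 : logTrunc N (pt γ - 1) - (pt γ - 1) ∈ augPow g 2 := by
    have := logTrunc_congr (by omega : 2 ≤ N) le_rfl (pt_sub_one_mem γ)
    convert this using 2
    simp [logTrunc, Finset.sum_range_succ]
  have h3 := conjSum_mem (fox x (pt γ)) (augPow_smul 2 h2)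
  have h4 := conjSum_congr (fox x (pt γ)) (augPow_smul 2 (pt_sub_one_mem γ))
  have h5 := add_mem (add_mem h1 h3) h4
  rw [smul_sub, map_sub, sub_add_sub_cancel, sub_add_sub_cancel, smul_smul, mul_comm] at h5
  exact h5

/-- On homology, the derivation of the twist along `γ` is `a ↦ 2 ω(a, γ) γ`. -/
theorem sigmaL_logSqTrunc_congr {M : ℕ} (hM : 3 ≤ M) (γ : Pi1 g) {a : GrpAlg g}
    (ha : a ∈ augPow g 1) :
    sigmaL (logSqTrunc M γ) a - (2 * omega a (pt γ)) • (pt γ - 1) ∈ augPow g 2 := by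
  have hu := logSqTrunc_mem M γ
  set u := logSqTrunc M γ with hu'
  have h1 := sigmaL_mem_self hu (sub_sum_hcoef_mem ha)
  rw [map_sub, map_sum] at h1
  have hinl : ∀ i, sigmaL u (gX (Sum.inl i)) - (2 * hcoef (Sum.inr i) (pt γ)) • (pt γ - 1) ∈
      augPow g 2 := fun i => by
    have := add_mem (sigmaL_inl_congr i hu) (cyc_logSqTrunc_congr_two (Sum.inr i) hM γ)
    rwa [sub_add_sub_cancel, ← sub_zero (sigmaL u (pt _)), ← (sigmaL_isDer u).map_one,
      ← map_sub] at this
  have hinr : ∀ i, sigmaL u (gX (Sum.inr i)) + (2 * hcoef (Sum.inl i) (pt γ)) • (pt γ - 1) ∈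
      augPow g 2 := fun i => by
    have := sub_mem (sigmaL_inr_congr i hu) (cyc_logSqTrunc_congr_two (Sum.inl i) hM γ)
    rwa [← hu', add_sub_assoc, sub_sub_self, ← sub_zero (sigmaL u (pt _)), ← (sigmaL_isDer u).map_one,
      ← map_sub] at this
  have h2 : ∑ x, sigmaL u (hcoef x a • gX x) - (2 * omega a (pt γ)) • (pt γ - 1) ∈
      augPow g 2 := by
    rw [omega, Finset.mul_sum, Finset.sum_smul, Fintype.sum_sum_type, ← Finset.sum_add_distrib,
      ← Finset.sum_sub_distrib]
    refine sum_mem fun i _ => ?_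
    have := add_mem (augPow_smul (hcoef (Sum.inl i) a) (hinl i))
      (augPow_smul (hcoef (Sum.inr i) a) (hinr i))
    convert this using 1
    rw [map_smul, map_smul]
    module
  have := add_mem h1 h2
  rwa [sub_add_sub_cancel] at this

/-- The derivation of a twist squares to zero on homology, as `ω(γ, γ) = 0`. -/
theorem sigmaL_sigmaL_logSqTrunc_mem {M : ℕ} (hM : 3 ≤ M) (γ : Pi1 g) {a : GrpAlg g}
    (ha : a ∈ augPow g 1) :
    sigmaL (logSqTrunc M γ) (sigmaL (logSqTrunc M γ) a) ∈ augPow g 2 := by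
  have h1 := sigmaL_mem_self (logSqTrunc_mem M γ) (sigmaL_logSqTrunc_congr hM γ ha)
  have h2 := augPow_smul (2 * omega a (pt γ)) (sigmaL_logSqTrunc_congr hM γ (pt_sub_one_mem γ))
  have h3 : omega (pt γ - 1) (pt γ) = 0 := by
    rw [← omega_sub_one, omega_self]
  rw [h3, mul_zero, zero_smul, sub_zero] at h2
  rw [map_sub, map_smul] at h1
  have := add_mem h1 h2
  rwa [sub_add_cancel] at this

theorem IsDer.iterate_mul_mem {d : GrpAlg g →ₗ[ℚ] GrpAlg g} (hd : IsDer d)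
    (hI : ∀ n, ∀ a ∈ augPow g n, d a ∈ augPow g n) (n p q : ℕ) {a b : GrpAlg g}
    (ha : a ∈ augPow g n) (hb : b ∈ augPow g 1) (hpa : (d ^ p) a ∈ augPow g (n + 1))
    (hqb : (d ^ q) b ∈ augPow g 2) : (d ^ (p + q)) (a * b) ∈ augPow g (n + 2) := by
  have hIk : ∀ k n, ∀ a ∈ augPow g n, (d ^ k) a ∈ augPow g n := by
    intro k
    induction k with
    | zero => intro n a ha; exact ha
    | succ k ih => intro n a ha; rw [pow_succ]; exact ih n _ (hI n a ha)
  induction p generalizing a b q with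
  | zero => exact hIk _ _ _ (mul_mem_augPow_of_le hpa hb (by omega))
  | succ p ihp =>
    induction q generalizing a b with
    | zero => exact hIk _ _ _ (mul_mem_augPow_of_le ha hqb (by omega))
    | succ q ihq =>
      rw [show p + 1 + (q + 1) = (p + (q + 1)) + 1 by omega, pow_succ]
      change (d ^ (p + (q + 1))) (d (a * b)) ∈ _
      rw [hd, map_add]
      refine add_mem (ihp _ (hI n a ha) hb ?_ hqb) ?_
      · rwa [pow_succ] at hpa
      · rw [show p + (q + 1) = p + 1 + q by omega]
        refine ihq ha (hI 1 b hb) hpa ?_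
        rwa [pow_succ] at hqb

/-- The derivation of a twist is nilpotent modulo `I ^ m`: it squares to zero on `I / I ^ 2`, hence
its power `2 n + 1` vanishes on `I ^ n / I ^ (n + 1)` by the Leibniz rule. -/
theorem exists_iterate_sigmaL_mem {M : ℕ} (hM : 3 ≤ M) (γ : Pi1 g) (m : ℕ) :
    ∃ K, ∀ a, (sigmaL (logSqTrunc M γ) ^ K) a ∈ augPow g m := by
  have hd := sigmaL_isDer (logSqTrunc M γ)
  have hI : ∀ n, ∀ a ∈ augPow g n, sigmaL (logSqTrunc M γ) a ∈ augPow g n :=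
    fun n a ha => sigmaL_mem_self (logSqTrunc_mem M γ) ha
  have hII : ∀ a ∈ augPow g 1, (sigmaL (logSqTrunc M γ) ^ 2) a ∈ augPow g 2 := fun a ha => by
    rw [pow_two]; exact sigmaL_sigmaL_logSqTrunc_mem hM γ ha
  set d := sigmaL (logSqTrunc M γ)
  have h0 : ∀ a, d a ∈ augPow g 1 := fun a => by
    have := hI 1 _ (sub_aug_mem a)
    rwa [map_sub, map_smul, hd.map_one, smul_zero, sub_zero] at this
  have step : ∀ n, ∀ a ∈ augPow g n, (d ^ (2 * n + 1)) a ∈ augPow g (n + 1) := by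
    intro n
    induction n with
    | zero => intro a _; rw [mul_zero, zero_add, pow_one]; exact h0 a
    | succ n ih =>
      intro a ha
      have := augPow_succ_le (S := (augPowQ g (n + 2)).comap (d ^ (2 * (n + 1) + 1)))
        (fun b hb x => ?_) ha
      · exact this
      · rw [show 2 * (n + 1) + 1 = 2 * n + 1 + 2 by omega]
        exact hd.iterate_mul_mem hI n _ _ hb (gX_mem x) (ih b hb) (hII _ (gX_mem x))
  induction m with
  | zero => exact ⟨0, fun a => augPow_zero _⟩
  | succ m ih =>
    obtain ⟨K, hK⟩ := ih
    refine ⟨2 * m + 1 + K, fun a => ?_⟩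
    rw [pow_add]
    exact step m _ (hK a)

end TwistDerivation

/-! ### Endomorphisms of the quotients by powers of the augmentation ideal -/

section Level

variable {B : Type*} [Ring B] [Algebra ℚ B] {ε : B →ₐ[ℚ] ℚ} {m : ℕ}

/-- The quotient map from `B` to `B / I ^ m`. -/
abbrev lvl (ε : B →ₐ[ℚ] ℚ) (m : ℕ) : B →ₐ[ℚ] B ⧸ augIdeal ε ^ m :=
  Ideal.Quotient.mkₐ ℚ (augIdeal ε ^ m)

theorem lvl_eq_zero {a : B} : lvl ε m a = 0 ↔ a ∈ augIdeal ε ^ m :=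
  Ideal.Quotient.eq_zero_iff_mem

theorem lvl_eq {a b : B} : lvl ε m a = lvl ε m b ↔ a - b ∈ augIdeal ε ^ m :=
  Ideal.Quotient.mk_eq_mk_iff_sub_mem a b

theorem lvl_surjective (q : B ⧸ augIdeal ε ^ m) : ∃ a, lvl ε m a = q :=
  Ideal.Quotient.mk_surjective q

/-- The endomorphism of `B / I ^ m` induced by an endomorphism of `B`. -/
def levelMap (ε : B →ₐ[ℚ] ℚ) (m : ℕ) (d : B →ₗ[ℚ] B)
    (h : ∀ a ∈ augIdeal ε ^ m, d a ∈ augIdeal ε ^ m) : Module.End ℚ (B ⧸ augIdeal ε ^ m) :=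
  have key : ∀ (q : B ⧸ augIdeal ε ^ m) (a : B), lvl ε m a = q →
      lvl ε m (d (lvl_surjective q).choose) = lvl ε m (d a) := fun q a ha => by
    rw [lvl_eq, ← map_sub]
    refine h _ (lvl_eq.mp ?_)
    rw [(lvl_surjective q).choose_spec, ha]
  { toFun := fun q => lvl ε m (d (lvl_surjective q).choose)
    map_add' := fun p q => by
      obtain ⟨a, ha⟩ := lvl_surjective p
      obtain ⟨b, hb⟩ := lvl_surjective q
      rw [key p a ha, key q b hb, key (p + q) (a + b) (by rw [map_add, ha, hb]), map_add, map_add]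
    map_smul' := fun c q => by
      obtain ⟨b, hb⟩ := lvl_surjective q
      rw [key q b hb, key (c • q) (c • b) (by rw [map_smul, hb]), map_smul, map_smul]
      rfl }

theorem levelMap_lvl (d : B →ₗ[ℚ] B) (h : ∀ a ∈ augIdeal ε ^ m, d a ∈ augIdeal ε ^ m) (a : B) :
    levelMap ε m d h (lvl ε m a) = lvl ε m (d a) := by
  change lvl ε m (d (lvl_surjective (lvl ε m a)).choose) = lvl ε m (d a)
  rw [lvl_eq, ← map_sub]
  exact h _ (lvl_eq.mp (lvl_surjective (lvl ε m a)).choose_spec)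

theorem levelMap_pow_lvl (d : B →ₗ[ℚ] B) (h : ∀ a ∈ augIdeal ε ^ m, d a ∈ augIdeal ε ^ m)
    (k : ℕ) (a : B) : (levelMap ε m d h ^ k) (lvl ε m a) = lvl ε m ((d ^ k) a) := by
  induction k generalizing a with
  | zero => rfl
  | succ k ih =>
    rw [pow_succ, pow_succ]
    change (levelMap ε m d h ^ k) (levelMap ε m d h (lvl ε m a)) = _
    rw [levelMap_lvl, ih]
    rfl

theorem levelMap_derivation {d : B →ₗ[ℚ] B} (hd : ∀ a b, d (a * b) = d a * b + a * d b)
    (h : ∀ a ∈ augIdeal ε ^ m, d a ∈ augIdeal ε ^ m) (p q : B ⧸ augIdeal ε ^ m) :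
    levelMap ε m d h (p * q) = p * levelMap ε m d h q + levelMap ε m d h p * q := by
  obtain ⟨a, rfl⟩ := lvl_surjective p
  obtain ⟨b, rfl⟩ := lvl_surjective q
  rw [← map_mul, levelMap_lvl, levelMap_lvl, levelMap_lvl, hd, map_add, map_mul, map_mul, add_comm]

end Level

/-- A vector killed by a power of the derivation `E`, times another such vector, is killed by a
power of `E`. -/
theorem iterate_derivation_mul_eq_zero {R : Type*} [Ring R] [Algebra ℚ R] {E : Module.End ℚ R}
    (hE : ∀ x y, E (x * y) = x * E y + E x * y) (p q : ℕ) {x y : R} (hx : (E ^ p) x = 0)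
    (hy : (E ^ q) y = 0) : (E ^ (p + q)) (x * y) = 0 := by
  induction p generalizing x y q with
  | zero =>
    rw [pow_zero] at hx
    change x = 0 at hx
    rw [hx, zero_mul, map_zero]
  | succ p ihp =>
    induction q generalizing x y with
    | zero =>
      rw [pow_zero] at hy
      change y = 0 at hy
      rw [hy, mul_zero, map_zero]
    | succ q ihq =>
      rw [show p + 1 + (q + 1) = (p + (q + 1)) + 1 by omega, pow_succ]
      change (E ^ (p + (q + 1))) (E (x * y)) = _
      rw [hE, map_add, ihp (q + 1) (x := E x) (by rwa [pow_succ] at hx) hy,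
        show p + (q + 1) = p + 1 + q by omega, ihq hx (by rwa [pow_succ] at hy), add_zero]

/-! ### The topology of the completion -/

section HatTopology

variable {B : Type*} [Ring B] [Algebra ℚ B] {ε : B →ₐ[ℚ] ℚ}

theorem Completion.tendsto_iff {ι : Type*} {l : Filter ι} {f : ι → Completion ε}
    {x : Completion ε} :
    Filter.Tendsto f l (nhds x) ↔ ∀ m, ∀ᶠ i in l, (f i).1 m = x.1 m := by
  have h : nhds x = ⨅ m : ℕ, Filter.comap (Completion.proj ε m) (pure (Completion.proj ε m x)) := by
    rw [nhds_iInf]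
    refine iInf_congr fun m => ?_
    rw [@nhds_induced _ _ ⊥]
    congr 1
    exact @nhds_discrete _ ⊥ (@DiscreteTopology.mk _ ⊥ rfl) ▸ rfl
  rw [h, Filter.tendsto_iInf]
  refine forall_congr' fun m => ?_
  rw [Filter.tendsto_comap_iff, Filter.tendsto_pure]
  rfl

theorem Completion.tendsto_unique {ι : Type*} {l : Filter ι} [l.NeBot] {f : ι → Completion ε}
    {x y : Completion ε} (hx : Filter.Tendsto f l (nhds x)) (hy : Filter.Tendsto f l (nhds y)) :
    x = y := by
  refine Subtype.ext (funext fun m => ?_)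
  obtain ⟨i, h1, h2⟩ := ((Completion.tendsto_iff.mp hx m).and (Completion.tendsto_iff.mp hy m)).exists
  exact h1.symm.trans h2

theorem Completion.hasSum_of_level {f : ℕ → Completion ε} {x : Completion ε}
    (h : ∀ m, ∃ K, (∀ n, K ≤ n → (f n).1 m = 0) ∧ ∑ n ∈ Finset.range K, (f n).1 m = x.1 m) :
    HasSum f x := by
  rw [HasSum, SummationFilter.unconditional_filter, Completion.tendsto_iff]
  intro m
  obtain ⟨K, h1, h2⟩ := h m
  filter_upwards [Filter.eventually_ge_atTop (Finset.range K)] with s hs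
  rw [← h2]
  have : (∑ n ∈ s, f n).1 m = ∑ n ∈ s, (f n).1 m := map_sum (Completion.proj ε m) f s
  rw [this]
  refine (Finset.sum_subset hs fun n _ hn => h1 n ?_).symm
  simpa using hn

/-- A sequence of elements of `B` converging to a given element of the completion. -/
theorem Completion.exists_tendsto (x : Completion ε) :
    ∃ a : ℕ → B, Filter.Tendsto (fun n => toCompletion ε (a n)) Filter.atTop (nhds x) := by
  choose a ha using fun n => lvl_surjective (x.1 n)
  refine ⟨a, Completion.tendsto_iff.mpr fun m => ?_⟩
  filter_upwards [Filter.eventually_ge_atTop m] with n hn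
  rw [← x.2 m n hn, ← ha n]
  rfl

theorem Completion.ext_of_continuous {D E : Completion ε → Completion ε} (hD : Continuous D)
    (hE : Continuous E) (h : ∀ a, D (toCompletion ε a) = E (toCompletion ε a)) : D = E := by
  funext x
  obtain ⟨a, ha⟩ := Completion.exists_tendsto x
  refine Completion.tendsto_unique ((hD.tendsto x).comp ha) ?_
  have := (hE.tendsto x).comp ha
  refine this.congr fun n => (h (a n)).symm

/-- A compatible family of endomorphisms of the quotients `B / I ^ m`. -/
def IsCompatible (f : ∀ m, Module.End ℚ (B ⧸ augIdeal ε ^ m)) : Prop :=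
  ∀ m n (h : m ≤ n), (Ideal.Quotient.factorₐ ℚ (Ideal.pow_le_pow_right h)).toLinearMap ∘ₗ f n =
    f m ∘ₗ (Ideal.Quotient.factorₐ ℚ (Ideal.pow_le_pow_right h)).toLinearMap

/-- The continuous endomorphism of the completion given by a compatible family. -/
def ofLevels (f : ∀ m, Module.End ℚ (B ⧸ augIdeal ε ^ m)) (hf : IsCompatible f) :
    Completion ε →L[ℚ] Completion ε where
  toFun x := ⟨fun m => f m (x.1 m), fun m n h =>
    (LinearMap.congr_fun (hf m n h) (x.1 n)).trans (congrArg (f m) (x.2 m n h))⟩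
  map_add' x y := Subtype.ext (funext fun m => map_add (f m) (x.1 m) (y.1 m))
  map_smul' c x := Subtype.ext (funext fun m => map_smul (f m) c (x.1 m))
  cont := by
    rw [continuous_iff_continuousAt]
    intro x
    refine Completion.tendsto_iff.mpr fun m => ?_
    filter_upwards [Completion.tendsto_iff.mp Filter.tendsto_id m] with y hy
    exact congrArg (f m) hy

theorem ofLevels_apply (f : ∀ m, Module.End ℚ (B ⧸ augIdeal ε ^ m)) (hf : IsCompatible f)
    (x : Completion ε) (m : ℕ) : (ofLevels f hf x).1 m = f m (x.1 m) := rfl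

theorem ofLevels_iterate (f : ∀ m, Module.End ℚ (B ⧸ augIdeal ε ^ m)) (hf : IsCompatible f)
    (n : ℕ) (x : Completion ε) (m : ℕ) :
    ((ofLevels f hf)^[n] x).1 m = (f m ^ n) (x.1 m) := by
  induction n with
  | zero => rfl
  | succ n ih =>
    rw [Function.iterate_succ_apply', ofLevels_apply, ih, pow_succ']
    rfl

theorem IsCompatible.exp {f : ∀ m, Module.End ℚ (B ⧸ augIdeal ε ^ m)} (hf : IsCompatible f)
    (hn : ∀ m, IsNilpotent (f m)) (r : ℚ) : IsCompatible fun m => IsNilpotent.exp (r • f m) := by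
  intro m n h
  refine (Module.End.commute_exp_left_of_commute ((hn n).smul r) ((hn m).smul r) ?_).symm
  rw [LinearMap.smul_comp, LinearMap.comp_smul, hf m n h]

theorem exp_smul_mul_exp_neg_smul {R : Type*} [Ring R] [Algebra ℚ R] {a : R} (ha : IsNilpotent a)
    (r : ℚ) : IsNilpotent.exp (r • a) * IsNilpotent.exp ((-r) • a) = 1 := by
  rw [neg_smul]
  exact IsNilpotent.exp_mul_exp_neg_self (ha.smul r)

/-- The exponential of a compatible family of nilpotent derivations, as an automorphism of the
completion. -/
def expAut (f : ∀ m, Module.End ℚ (B ⧸ augIdeal ε ^ m)) (hf : IsCompatible f)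
    (hn : ∀ m, IsNilpotent (f m)) (hd : ∀ m p q, f m (p * q) = p * f m q + f m p * q) (r : ℚ) :
    Completion ε ≃ₐ[ℚ] Completion ε :=
  AlgEquiv.ofLinearEquiv
    { (ofLevels _ (hf.exp hn r) : Completion ε →ₗ[ℚ] Completion ε) with
      invFun := ofLevels _ (hf.exp hn (-r))
      left_inv := fun x => Subtype.ext (funext fun m => by
        have := exp_smul_mul_exp_neg_smul (hn m) (-r)
        rw [neg_neg] at this
        exact LinearMap.congr_fun this (x.1 m))
      right_inv := fun x => Subtype.ext (funext fun m =>
        LinearMap.congr_fun (exp_smul_mul_exp_neg_smul (hn m) r) (x.1 m)) }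
    (Subtype.ext (funext fun m => by
      have h1 := hd m 1 1
      rw [mul_one, one_mul, mul_one, left_eq_add] at h1
      have h2 := IsNilpotent.exp_smul_eq_sum (a := r • f m) (m := (1 : B ⧸ augIdeal ε ^ m))
        (k := 1) (by
          rw [pow_one, Module.End.smul_def, LinearMap.smul_apply, h1, smul_zero])
        ((hn m).smul r)
      rw [Finset.sum_range_one, Nat.factorial_zero, pow_zero, one_smul, Nat.cast_one, inv_one,
        one_smul] at h2
      exact h2))
    (fun x y => Subtype.ext (funext fun m =>
      Module.End.exp_mul_of_derivation ℚ _ (r • f m) (fun p q => by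
        rw [LinearMap.smul_apply, hd, smul_add, LinearMap.smul_apply, LinearMap.smul_apply,
          mul_smul_comm, smul_mul_assoc]) ((hn m).smul r) (x.1 m) (y.1 m)))

theorem expAut_apply (f : ∀ m, Module.End ℚ (B ⧸ augIdeal ε ^ m)) (hf : IsCompatible f)
    (hn : ∀ m, IsNilpotent (f m)) (hd : ∀ m p q, f m (p * q) = p * f m q + f m p * q) (r : ℚ)
    (x : Completion ε) (m : ℕ) :
    (expAut f hf hn hd r x).1 m = IsNilpotent.exp (r • f m) (x.1 m) := rfl

theorem expAut_symm_apply (f : ∀ m, Module.End ℚ (B ⧸ augIdeal ε ^ m)) (hf : IsCompatible f)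
    (hn : ∀ m, IsNilpotent (f m)) (hd : ∀ m p q, f m (p * q) = p * f m q + f m p * q) (r : ℚ) :
    (expAut f hf hn hd r).symm = expAut f hf hn hd (-r) := by
  ext x
  rfl

theorem hasSum_expAut (f : ∀ m, Module.End ℚ (B ⧸ augIdeal ε ^ m)) (hf : IsCompatible f)
    (hn : ∀ m, IsNilpotent (f m)) (hd : ∀ m p q, f m (p * q) = p * f m q + f m p * q) (r : ℚ)
    (x : Completion ε) :
    HasSum (fun n : ℕ => (r ^ n / n.factorial : ℚ) • ((ofLevels f hf)^[n]) x)
      (expAut f hf hn hd r x) := by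
  refine Completion.hasSum_of_level fun m => ?_
  obtain ⟨K, hK⟩ := hn m
  have hv : ∀ n, ((r ^ n / n.factorial : ℚ) • ((ofLevels f hf)^[n]) x).1 m =
      (r ^ n / n.factorial : ℚ) • (f m ^ n) (x.1 m) := fun n => by
    rw [← ofLevels_iterate f hf]
    rfl
  refine ⟨K, fun n h => ?_, ?_⟩
  · rw [hv, pow_eq_zero_of_le h hK, LinearMap.zero_apply, smul_zero]
  · rw [expAut_apply, IsNilpotent.exp_eq_sum (k := K) (by rw [smul_pow, hK, smul_zero]),
      LinearMap.sum_apply]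
    refine Finset.sum_congr rfl fun n _ => ?_
    rw [hv, smul_pow, smul_smul, LinearMap.smul_apply]
    congr 1
    rw [div_eq_mul_inv, mul_comm]

end HatTopology

/-! ### Automorphisms of the complete Hopf algebra -/

section HatAut

variable {g : ℕ}

/-- Group-like elements of the complete Hopf algebra. -/
def IsGpLike (x : Hat g) : Prop := comulHat g x = inlHat g x * inrHat g x

/-- The automorphisms of the filtered algebra `Hat g` that preserve the group-like elements and
fix the boundary element. -/
def hatAut (g : ℕ) : Subgroup (Hat g ≃ₐ[ℚ] Hat g) where
  carrier := {T | (∀ m x, (T x).1 m = 0 ↔ x.1 m = 0) ∧ (∀ x, IsGpLike (T x) ↔ IsGpLike x) ∧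
    T (toCompletion (aug g) (pt (boundary g))) = toCompletion (aug g) (pt (boundary g))}
  one_mem' := ⟨fun _ _ => Iff.rfl, fun _ => Iff.rfl, rfl⟩
  mul_mem' {S T} hS hT := by
    refine ⟨fun m x => (hS.1 m (T x)).trans (hT.1 m x),
      fun x => (hS.2.1 (T x)).trans (hT.2.1 x), ?_⟩
    rw [AlgEquiv.mul_apply, hT.2.2, hS.2.2]
  inv_mem' {T} hT := by
    have h : ∀ x, T (T⁻¹ x) = x := fun x => T.apply_symm_apply x
    refine ⟨fun m x => ?_, fun x => ?_, ?_⟩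
    · rw [← hT.1 m, h]
    · rw [← hT.2.1, h]
    · apply T.injective
      rw [h, hT.2.2]

theorem hatAut_inv_apply (T : hatAut g) (x : Hat g) : T.1 (T⁻¹.1 x) = x :=
  T.1.apply_symm_apply x

theorem hatAut_inv_apply' (T : hatAut g) (x : Hat g) : T⁻¹.1 (T.1 x) = x :=
  T.1.symm_apply_apply x

/-- The automorphism of the Malcev completion induced by an automorphism of the complete Hopf
algebra. -/
def malcevAut (T : hatAut g) : MulAut (malcev g) where
  toFun x := ⟨Units.map (T.1 : Hat g →* Hat g) x.1, (T.2.2.1 _).mpr x.2⟩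
  invFun x := ⟨Units.map (T⁻¹.1 : Hat g →* Hat g) x.1, (T⁻¹.2.2.1 _).mpr x.2⟩
  left_inv _ := Subtype.ext (Units.ext (hatAut_inv_apply' T _))
  right_inv _ := Subtype.ext (Units.ext (hatAut_inv_apply T _))
  map_mul' x y := Subtype.ext (map_mul _ x.1 y.1)

theorem malcev_ext {x y : malcev g} (h : malcevVal x = malcevVal y) : x = y :=
  Subtype.ext (Units.ext h)

/-- The element of the generalized mapping class group induced by an automorphism of the complete
Hopf algebra. -/
def hatAutToMCG (g : ℕ) : hatAut g →* GenMCG g where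
  toFun T := ⟨malcevAut T, fun m x => by
      change (T.1 (malcevVal x) - 1).1 m = 0 ↔ (malcevVal x - 1).1 m = 0
      have := T.2.1 m (malcevVal x - 1)
      rwa [map_sub, map_one] at this,
    malcev_ext T.2.2.2⟩
  map_one' := rfl
  map_mul' _ _ := rfl

end HatAut

/-! ### Rational powers of generalized Dehn twists -/

section Twist

variable {g : ℕ}

theorem sigmaL_logSqTrunc_mem_level (M : ℕ) (γ : Pi1 g) (m : ℕ) :
    ∀ a ∈ augIdeal (aug g) ^ m, sigmaL (logSqTrunc M γ) a ∈ augIdeal (aug g) ^ m :=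
  fun _ ha => sigmaL_mem_self (logSqTrunc_mem M γ) ha

/-- The operator `σ((log γ) ^ 2)` on `A / I ^ m`. -/
def twistLevel (γ : Pi1 g) (m : ℕ) : Module.End ℚ (GrpAlg g ⧸ augIdeal (aug g) ^ m) :=
  levelMap (aug g) m (sigmaL (logSqTrunc (m + 3) γ)) (sigmaL_logSqTrunc_mem_level _ γ m)

theorem twistLevel_lvl (γ : Pi1 g) {m M : ℕ} (hM : m + 2 ≤ M) (a : GrpAlg g) :
    twistLevel γ m (lvl (aug g) m a) = lvl (aug g) m (sigmaL (logSqTrunc M γ) a) := by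
  have key : ∀ N, m + 2 ≤ N →
      sigmaL (logSqTrunc N γ) a - sigmaL (logSqTrunc (m + 2) γ) a ∈ augPow g m := fun N hN => by
    rw [← LinearMap.sub_apply, ← map_sub]
    exact sigmaL_mem (logSqTrunc_sub_mem hN γ) (augPow_zero a) (by omega)
  rw [twistLevel, levelMap_lvl, lvl_eq]
  have := sub_mem (key (m + 3) (by omega)) (key M hM)
  rwa [sub_sub_sub_cancel_right] at this

theorem isNilpotent_twistLevel (γ : Pi1 g) (m : ℕ) : IsNilpotent (twistLevel γ m) := by
  obtain ⟨K, hK⟩ := exists_iterate_sigmaL_mem (M := m + 3) (by omega) γ m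
  refine ⟨K, LinearMap.ext fun q => ?_⟩
  obtain ⟨a, rfl⟩ := lvl_surjective q
  rw [twistLevel, levelMap_pow_lvl, LinearMap.zero_apply, lvl_eq_zero]
  exact hK a

theorem twistLevel_derivation (γ : Pi1 g) (m : ℕ) (p q : GrpAlg g ⧸ augIdeal (aug g) ^ m) :
    twistLevel γ m (p * q) = p * twistLevel γ m q + twistLevel γ m p * q :=
  levelMap_derivation (sigmaL_isDer _) _ p q

theorem isCompatible_twistLevel (γ : Pi1 g) : IsCompatible (twistLevel γ) := by
  intro m n h
  refine LinearMap.ext fun q => ?_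
  obtain ⟨a, rfl⟩ := lvl_surjective q
  have h1 := twistLevel_lvl γ (m := n) (M := n + 2) le_rfl a
  have h2 := twistLevel_lvl γ (m := m) (M := n + 2) (by omega) a
  rw [LinearMap.comp_apply, LinearMap.comp_apply, h1]
  exact h2.symm

/-- The operator `σ((log γ) ^ 2)` on the completion. -/
def twistDer (γ : Pi1 g) : Hat g →L[ℚ] Hat g := ofLevels _ (isCompatible_twistLevel γ)

/-- The automorphism `exp (r σ((log γ) ^ 2))` of the completion. -/
def twistAut (r : ℚ) (γ : Pi1 g) : Hat g ≃ₐ[ℚ] Hat g :=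
  expAut _ (isCompatible_twistLevel γ) (isNilpotent_twistLevel γ) (twistLevel_derivation γ) r

theorem twistAut_level (r : ℚ) (γ : Pi1 g) (x : Hat g) (m : ℕ) :
    (twistAut r γ x).1 m = IsNilpotent.exp (r • twistLevel γ m) (x.1 m) := rfl

theorem isSigmaSeries_twistDer (γ : Pi1 g) :
    IsSigmaSeries (PowerSeries.log ℚ ^ 2) γ (twistDer γ) := by
  intro v
  refine Completion.hasSum_of_level fun m => ⟨m + 2, fun n hn => ?_, ?_⟩
  · change lvl (aug g) m (PowerSeries.coeff n (PowerSeries.log ℚ ^ 2) •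
      sigma ((pt γ - 1) ^ n) v) = 0
    rw [lvl_eq_zero, sigma_eq_sigmaL]
    exact augPow_smul _ (sigmaL_mem (pow_mem_augPow (pt_sub_one_mem γ) n) (augPow_zero v)
      (by omega))
  · refine Eq.trans ?_ (twistLevel_lvl γ (M := m + 2) le_rfl v).symm
    rw [logSqTrunc, map_sum, LinearMap.sum_apply, map_sum]
    refine Finset.sum_congr rfl fun n _ => ?_
    rw [map_smul, LinearMap.smul_apply, ← sigma_eq_sigmaL]
    rfl

/-- The map induced by the coproduct on the quotients by powers of the augmentation ideals. -/
def comulLvl (g m : ℕ) : GrpAlg g ⧸ augIdeal (aug g) ^ m →ₐ[ℚ]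
    (GrpAlg g ⊗[ℚ] GrpAlg g) ⧸ augIdeal (augTensor g) ^ m :=
  Ideal.quotientMapₐ _ (comul g) fun _ ha => comul_mem ha

/-- The map induced by `a ↦ a ⊗ 1` on the quotients by powers of the augmentation ideals. -/
def inlLvl (g m : ℕ) : GrpAlg g ⧸ augIdeal (aug g) ^ m →ₐ[ℚ]
    (GrpAlg g ⊗[ℚ] GrpAlg g) ⧸ augIdeal (augTensor g) ^ m :=
  Ideal.quotientMapₐ _ Algebra.TensorProduct.includeLeft
    fun _ ha => tmul_mem ha (augPow_zero 1) (by omega)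

/-- The map induced by `a ↦ 1 ⊗ a` on the quotients by powers of the augmentation ideals. -/
def inrLvl (g m : ℕ) : GrpAlg g ⧸ augIdeal (aug g) ^ m →ₐ[ℚ]
    (GrpAlg g ⊗[ℚ] GrpAlg g) ⧸ augIdeal (augTensor g) ^ m :=
  Ideal.quotientMapₐ _ Algebra.TensorProduct.includeRight
    fun _ ha => tmul_mem (augPow_zero 1) ha (by omega)

theorem isGpLike_iff (x : Hat g) :
    IsGpLike x ↔ ∀ m, comulLvl g m (x.1 m) = inlLvl g m (x.1 m) * inrLvl g m (x.1 m) :=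
  ⟨fun h m => congrFun (congrArg Subtype.val h) m, fun h => Subtype.ext (funext h)⟩

theorem tensDer_mem_level {d : GrpAlg g →ₗ[ℚ] GrpAlg g}
    (h : ∀ n, ∀ a ∈ augPow g n, d a ∈ augPow g n) (m : ℕ) :
    ∀ t ∈ augIdeal (augTensor g) ^ m, tensDer d t ∈ augIdeal (augTensor g) ^ m := by
  intro t ht
  refine tensPow_map_le (S := (tensPow g m).restrictScalars ℚ) (tensDer d)
    (fun i j a b hij ha hb => ?_) ht
  rw [tensDer_tmul]
  exact add_mem (tmul_mem (h i a ha) hb hij.ge) (tmul_mem ha (h j b hb) hij.ge)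

/-- The derivation induced by the tensor square of `σ((log γ) ^ 2)` on the quotient of the tensor
square by the `m`-th power of its augmentation ideal. -/
def tensLevel (γ : Pi1 g) (m : ℕ) :
    Module.End ℚ ((GrpAlg g ⊗[ℚ] GrpAlg g) ⧸ augIdeal (augTensor g) ^ m) :=
  levelMap (augTensor g) m (tensDer (sigmaL (logSqTrunc (m + 3) γ)))
    (tensDer_mem_level (fun _ _ ha => sigmaL_mem_self (logSqTrunc_mem _ γ) ha) m)

theorem tensLevel_derivation (γ : Pi1 g) (m : ℕ)
    (p q : (GrpAlg g ⊗[ℚ] GrpAlg g) ⧸ augIdeal (augTensor g) ^ m) :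
    tensLevel γ m (p * q) = p * tensLevel γ m q + tensLevel γ m p * q :=
  levelMap_derivation (tensDer_mul (sigmaL_isDer _)) _ p q

theorem tensLevel_lvl (γ : Pi1 g) (m : ℕ) (t : GrpAlg g ⊗[ℚ] GrpAlg g) :
    tensLevel γ m (lvl (augTensor g) m t) =
      lvl (augTensor g) m (tensDer (sigmaL (logSqTrunc (m + 3) γ)) t) :=
  levelMap_lvl _ _ t

theorem inlLvl_lvl (m : ℕ) (a : GrpAlg g) :
    inlLvl g m (lvl (aug g) m a) = lvl (augTensor g) m (a ⊗ₜ 1) := rfl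

theorem inrLvl_lvl (m : ℕ) (a : GrpAlg g) :
    inrLvl g m (lvl (aug g) m a) = lvl (augTensor g) m (1 ⊗ₜ a) := rfl

theorem comulLvl_lvl (m : ℕ) (a : GrpAlg g) :
    comulLvl g m (lvl (aug g) m a) = lvl (augTensor g) m (comul g a) := rfl

theorem tensLevel_comp_inlLvl (γ : Pi1 g) (m : ℕ) :
    tensLevel γ m ∘ₗ (inlLvl g m).toLinearMap =
      (inlLvl g m).toLinearMap ∘ₗ twistLevel γ m := by
  refine LinearMap.ext fun q => ?_
  obtain ⟨a, rfl⟩ := lvl_surjective q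
  rw [LinearMap.comp_apply, LinearMap.comp_apply, AlgHom.toLinearMap_apply,
    AlgHom.toLinearMap_apply, inlLvl_lvl, tensLevel_lvl, tensDer_tmul, (sigmaL_isDer _).map_one,
    TensorProduct.tmul_zero, add_zero, twistLevel_lvl γ (M := m + 3) (by omega), inlLvl_lvl]

theorem tensLevel_comp_inrLvl (γ : Pi1 g) (m : ℕ) :
    tensLevel γ m ∘ₗ (inrLvl g m).toLinearMap =
      (inrLvl g m).toLinearMap ∘ₗ twistLevel γ m := by
  refine LinearMap.ext fun q => ?_
  obtain ⟨a, rfl⟩ := lvl_surjective q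
  rw [LinearMap.comp_apply, LinearMap.comp_apply, AlgHom.toLinearMap_apply,
    AlgHom.toLinearMap_apply, inrLvl_lvl, tensLevel_lvl, tensDer_tmul, (sigmaL_isDer _).map_one,
    TensorProduct.zero_tmul, zero_add, twistLevel_lvl γ (M := m + 3) (by omega), inrLvl_lvl]

theorem tensLevel_comp_comulLvl (γ : Pi1 g) (m : ℕ) :
    tensLevel γ m ∘ₗ (comulLvl g m).toLinearMap =
      (comulLvl g m).toLinearMap ∘ₗ twistLevel γ m := by
  refine LinearMap.ext fun q => ?_
  obtain ⟨a, rfl⟩ := lvl_surjective q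
  rw [LinearMap.comp_apply, LinearMap.comp_apply, AlgHom.toLinearMap_apply,
    AlgHom.toLinearMap_apply, comulLvl_lvl, tensLevel_lvl,
    twistLevel_lvl γ (M := m + 3) (by omega), comulLvl_lvl]
  refine (lvl_eq.mpr ?_).symm
  exact comul_sigmaL_congr (fun x => cyc_logSqTrunc_mem_primMod x (by omega) γ) a

theorem isNilpotent_tensLevel (γ : Pi1 g) (m : ℕ) : IsNilpotent (tensLevel γ m) := by
  obtain ⟨K, hK⟩ := isNilpotent_twistLevel γ m
  refine ⟨K + K, LinearMap.ext fun t => ?_⟩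
  obtain ⟨s, rfl⟩ := lvl_surjective t
  rw [LinearMap.zero_apply]
  induction s using TensorProduct.induction_on with
  | zero => rw [map_zero, map_zero]
  | add s s' h h' => rw [map_add, map_add, h, h', add_zero]
  | tmul a b =>
    have e : lvl (augTensor g) m (a ⊗ₜ b) =
        inlLvl g m (lvl (aug g) m a) * inrLvl g m (lvl (aug g) m b) := by
      rw [inlLvl_lvl, inrLvl_lvl, ← map_mul, Algebra.TensorProduct.tmul_mul_tmul, one_mul, mul_one]
    rw [e]
    refine iterate_derivation_mul_eq_zero (tensLevel_derivation γ m) K K ?_ ?_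
    · refine (LinearMap.congr_fun (Module.End.commute_pow_left_of_commute
        (tensLevel_comp_inlLvl γ m) K) (lvl (aug g) m a)).trans ?_
      rw [hK, LinearMap.comp_zero, LinearMap.zero_apply]
    · refine (LinearMap.congr_fun (Module.End.commute_pow_left_of_commute
        (tensLevel_comp_inrLvl γ m) K) (lvl (aug g) m b)).trans ?_
      rw [hK, LinearMap.comp_zero, LinearMap.zero_apply]

/-- The exponential of a derivation compatible with a coproduct `φ` preserves the group-like
elements `φ q = ι₁ q * ι₂ q`. -/
theorem exp_map_eq_mul {Q R : Type*} [Ring Q] [Algebra ℚ Q] [Ring R] [Algebra ℚ R]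
    {D : Module.End ℚ Q} {E : Module.End ℚ R} (hD : IsNilpotent D) (hE : IsNilpotent E)
    (hder : ∀ x y, E (x * y) = x * E y + E x * y) {φ ι₁ ι₂ : Q →ₗ[ℚ] R} (hφ : E ∘ₗ φ = φ ∘ₗ D)
    (h₁ : E ∘ₗ ι₁ = ι₁ ∘ₗ D) (h₂ : E ∘ₗ ι₂ = ι₂ ∘ₗ D) {q : Q} (hq : φ q = ι₁ q * ι₂ q) :
    φ (IsNilpotent.exp D q) = ι₁ (IsNilpotent.exp D q) * ι₂ (IsNilpotent.exp D q) := by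
  have key : ∀ ψ : Q →ₗ[ℚ] R, E ∘ₗ ψ = ψ ∘ₗ D →
      ψ (IsNilpotent.exp D q) = IsNilpotent.exp E (ψ q) := fun ψ hψ =>
    (LinearMap.congr_fun (Module.End.commute_exp_left_of_commute hD hE hψ) q).symm
  rw [key φ hφ, key ι₁ h₁, key ι₂ h₂, hq]
  exact Module.End.exp_mul_of_derivation ℚ _ E hder hE _ _

theorem comulLvl_exp_twistLevel (r : ℚ) (γ : Pi1 g) (m : ℕ)
    (q : GrpAlg g ⧸ augIdeal (aug g) ^ m) (hq : comulLvl g m q = inlLvl g m q * inrLvl g m q) :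
    comulLvl g m (IsNilpotent.exp (r • twistLevel γ m) q) =
      inlLvl g m (IsNilpotent.exp (r • twistLevel γ m) q) *
        inrLvl g m (IsNilpotent.exp (r • twistLevel γ m) q) :=
  exp_map_eq_mul (φ := (comulLvl g m).toLinearMap) (ι₁ := (inlLvl g m).toLinearMap)
    (ι₂ := (inrLvl g m).toLinearMap) ((isNilpotent_twistLevel γ m).smul r)
    ((isNilpotent_tensLevel γ m).smul r)
    (fun p q => by
      rw [LinearMap.smul_apply, tensLevel_derivation, smul_add, LinearMap.smul_apply,
        LinearMap.smul_apply, mul_smul_comm, smul_mul_assoc])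
    (by rw [LinearMap.smul_comp, LinearMap.comp_smul, tensLevel_comp_comulLvl])
    (by rw [LinearMap.smul_comp, LinearMap.comp_smul, tensLevel_comp_inlLvl])
    (by rw [LinearMap.smul_comp, LinearMap.comp_smul, tensLevel_comp_inrLvl]) hq

theorem twistAut_apply_inv (r : ℚ) (γ : Pi1 g) (x : Hat g) :
    twistAut (-r) γ (twistAut r γ x) = x := by
  rw [twistAut, twistAut, ← expAut_symm_apply]
  exact AlgEquiv.symm_apply_apply _ _

theorem twistAut_mem (r : ℚ) (γ : Pi1 g) : twistAut r γ ∈ hatAut g := by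
  have h1 : ∀ r m (x : Hat g), x.1 m = 0 → (twistAut r γ x).1 m = 0 := fun r m x hx => by
    rw [twistAut_level, hx, map_zero]
  have h2 : ∀ r (x : Hat g), IsGpLike x → IsGpLike (twistAut r γ x) := fun r x hx => by
    rw [isGpLike_iff] at hx ⊢
    exact fun m => comulLvl_exp_twistLevel r γ m _ (hx m)
  refine ⟨fun m x => ⟨fun h => ?_, h1 r m x⟩, fun x => ⟨fun h => ?_, h2 r x⟩, ?_⟩
  · rw [← twistAut_apply_inv r γ x]; exact h1 _ _ _ h
  · rw [← twistAut_apply_inv r γ x]; exact h2 _ _ h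
  · refine Subtype.ext (funext fun m => ?_)
    rw [twistAut_level]
    change IsNilpotent.exp (r • twistLevel γ m) (lvl (aug g) m (pt (boundary g))) =
      lvl (aug g) m (pt (boundary g))
    have h3 := IsNilpotent.exp_smul_eq_sum (a := r • twistLevel γ m)
      (m := lvl (aug g) m (pt (boundary g))) (k := 1) (by
        rw [pow_one, Module.End.smul_def, LinearMap.smul_apply, twistLevel_lvl γ le_rfl,
          sigmaL_boundary, map_zero, smul_zero]) ((isNilpotent_twistLevel γ m).smul r)
    rw [Finset.sum_range_one, Nat.factorial_zero, pow_zero, one_smul, Nat.cast_one, inv_one,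
      one_smul] at h3
    exact h3

/-- The automorphism `exp (r σ((log γ) ^ 2))` as an element of the group of automorphisms of the
complete Hopf algebra. -/
def twist (r : ℚ) (γ : Pi1 g) : hatAut g := ⟨twistAut r γ, twistAut_mem r γ⟩

theorem isRationalTwist_twist (r : ℚ) (γ : Pi1 g) :
    IsRationalTwist r γ (hatAutToMCG g (twist r γ)) :=
  ⟨twistDer γ, twistAut r γ, isSigmaSeries_twistDer γ, fun x => hasSum_expAut _ _ _ _ r x,
    fun _ => rfl⟩

theorem IsRationalTwist.unique {r : ℚ} {γ : Pi1 g} {s t : GenMCG g} (hs : IsRationalTwist r γ s)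
    (ht : IsRationalTwist r γ t) : s = t := by
  obtain ⟨D, S, hD, hS, hs⟩ := hs
  obtain ⟨E, T, hE, hT, ht⟩ := ht
  have hDE : D.toFun = E.toFun := Completion.ext_of_continuous D.cont E.cont fun a => by
      have h1 := hD a
      have h2 := hE a
      rw [HasSum] at h1 h2
      exact Completion.tendsto_unique h1 h2
  refine Subtype.ext (MulEquiv.ext fun x => malcev_ext ?_)
  rw [← hs, ← ht]
  have h1 := hS (malcevVal x)
  have h2 := hT (malcevVal x)
  change HasSum (fun n : ℕ => (r ^ n / n.factorial : ℚ) • (D.toFun^[n]) (malcevVal x)) _ at h1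
  rw [hDE] at h1
  rw [HasSum] at h1 h2
  exact Completion.tendsto_unique h1 h2

theorem existsUnique_isRationalTwist (r : ℚ) (γ : Pi1 g) :
    ∃! t : GenMCG g, IsRationalTwist r γ t :=
  ⟨_, isRationalTwist_twist r γ, fun _ h => h.unique (isRationalTwist_twist r γ)⟩

end Twist

/-! ### The filtration of the completion -/

section Filtration

variable {g : ℕ}

/-- The canonical map from the group algebra to its completion. -/
abbrev hat (g : ℕ) : GrpAlg g →ₐ[ℚ] Hat g := toCompletion (aug g)

/-- The `m`-th term of the filtration of the completion. -/
abbrev filt (g m : ℕ) : Ideal (Hat g) := Completion.filt (aug g) m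

theorem mem_filt {m : ℕ} {x : Hat g} : x ∈ filt g m ↔ x.1 m = 0 := Iff.rfl

theorem hat_mem_filt {m : ℕ} {a : GrpAlg g} : hat g a ∈ filt g m ↔ a ∈ augPow g m := lvl_eq_zero

theorem filt_anti {m n : ℕ} (h : m ≤ n) {x : Hat g} (hx : x ∈ filt g n) : x ∈ filt g m := by
  rw [mem_filt] at hx ⊢
  rw [← x.2 m n h, hx, map_zero]

theorem filt_zero (x : Hat g) : x ∈ filt g 0 := by
  obtain ⟨a, ha⟩ := lvl_surjective (x.1 0)
  rw [mem_filt, ← ha, lvl_eq_zero]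
  exact augPow_zero a

theorem exists_sub_hat_mem (x : Hat g) (n : ℕ) : ∃ a, x - hat g a ∈ filt g n := by
  obtain ⟨a, ha⟩ := lvl_surjective (x.1 n)
  refine ⟨a, ?_⟩
  rw [mem_filt]
  change x.1 n - lvl (aug g) n a = 0
  rw [ha, sub_self]

theorem exists_mem_sub_hat_mem {m n : ℕ} {x : Hat g} (hx : x ∈ filt g m) (h : m ≤ n) :
    ∃ a ∈ augPow g m, x - hat g a ∈ filt g n := by
  obtain ⟨a, ha⟩ := exists_sub_hat_mem x n
  refine ⟨a, ?_, ha⟩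
  have := sub_mem hx (filt_anti h ha)
  rwa [sub_sub_cancel, hat_mem_filt] at this

theorem filt_mul_left {m : ℕ} (y : Hat g) {x : Hat g} (hx : x ∈ filt g m) : y * x ∈ filt g m :=
  Ideal.mul_mem_left _ y hx

theorem filt_mul_right {m : ℕ} (y : Hat g) {x : Hat g} (hx : x ∈ filt g m) : x * y ∈ filt g m := by
  rw [mem_filt] at hx ⊢
  change x.1 m * y.1 m = 0
  rw [hx, zero_mul]

theorem filt_smul {m : ℕ} (c : ℚ) {x : Hat g} (hx : x ∈ filt g m) : c • x ∈ filt g m := by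
  rw [mem_filt] at hx ⊢
  change c • x.1 m = 0
  rw [hx, smul_zero]

theorem mul_mem_filt {m n k : ℕ} {x y : Hat g} (hx : x ∈ filt g m) (hy : y ∈ filt g n)
    (h : k ≤ m + n) : x * y ∈ filt g k := by
  obtain ⟨a, ha, hxa⟩ := exists_mem_sub_hat_mem hx (Nat.le_add_right m n)
  obtain ⟨b, hb, hyb⟩ := exists_mem_sub_hat_mem hy (Nat.le_add_left n m)
  have h1 := filt_mul_right y hxa
  have h2 := filt_mul_left (hat g a) hyb
  have h3 : hat g (a * b) ∈ filt g (m + n) := hat_mem_filt.mpr (mul_mem_augPow ha hb)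
  have := add_mem (add_mem h1 h2) h3
  rw [map_mul, sub_mul, mul_sub, sub_add_sub_cancel, sub_add_cancel] at this
  exact filt_anti h this

theorem mul_congr_filt {m : ℕ} {x x' y y' : Hat g} (hx : x - x' ∈ filt g m)
    (hy : y - y' ∈ filt g m) : x * y - x' * y' ∈ filt g m := by
  have := add_mem (filt_mul_right y hx) (filt_mul_left x' hy)
  rwa [sub_mul, mul_sub, sub_add_sub_cancel] at this

theorem malcevVal_toMalcev (v : Pi1 g) : malcevVal (toMalcev g v) = hat g (pt v) := rfl

theorem malcevVal_mul (x y : malcev g) : malcevVal (x * y) = malcevVal x * malcevVal y := rfl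

theorem malcevVal_one : malcevVal (1 : malcev g) = 1 := rfl

theorem malcevVal_pow (x : malcev g) (n : ℕ) : malcevVal (x ^ n) = malcevVal x ^ n := by
  induction n with
  | zero => rfl
  | succ n ih => rw [pow_succ, pow_succ, malcevVal_mul, ih]

theorem malcevVal_mul_inv (x : malcev g) : malcevVal x * malcevVal x⁻¹ = 1 := by
  rw [← malcevVal_mul, mul_inv_cancel, malcevVal_one]

theorem malcevVal_inv_mul (x : malcev g) : malcevVal x⁻¹ * malcevVal x = 1 := by
  rw [← malcevVal_mul, inv_mul_cancel, malcevVal_one]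

theorem malcevVal_comul {n : ℕ} (y : malcev g) {a : GrpAlg g}
    (ha : malcevVal y - hat g a ∈ filt g n) : comul g a - a ⊗ₜ[ℚ] a ∈ tensPow g n := by
  have h := (isGpLike_iff _).mp y.2 n
  have e : (malcevVal y).1 n = lvl (aug g) n a := sub_eq_zero.mp ha
  rw [e, comulLvl_lvl, inlLvl_lvl, inrLvl_lvl, ← map_mul, Algebra.TensorProduct.tmul_mul_tmul,
    one_mul, mul_one] at h
  exact lvl_eq.mp h

theorem one_notMem_filt_one : (1 : Hat g) ∉ filt g 1 := by
  rw [← map_one (hat g), hat_mem_filt, mem_augPow_one, map_one]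
  exact one_ne_zero

/-- Elements of the Malcev completion have augmentation `1`. -/
theorem malcevVal_sub_one_mem (y : malcev g) : malcevVal y - 1 ∈ filt g 1 := by
  obtain ⟨a, ha⟩ := exists_sub_hat_mem (malcevVal y) 1
  have h1 := malcevVal_comul y ha
  rw [tensPow, Submodule.pow_one] at h1
  have h2 : augTensor g (comul g a - a ⊗ₜ[ℚ] a) = 0 := h1
  have h3 : augTensor g (comul g a) = aug g a := by
    have : (augTensor g).comp (comul g) = aug g := by
      apply MonoidAlgebra.algHom_ext
      · intro x
        simp
      · ext
    exact AlgHom.congr_fun this a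
  have h4 : augTensor g (a ⊗ₜ[ℚ] a) = aug g a * aug g a := rfl
  rw [map_sub, h3, h4] at h2
  have h5 : aug g a ≠ 0 := by
    intro h
    have h6 : malcevVal y ∈ filt g 1 := by
      have := add_mem ha (hat_mem_filt.mpr (mem_augPow_one.mpr h))
      rwa [sub_add_cancel] at this
    have := filt_mul_right (malcevVal y⁻¹) h6
    rw [malcevVal_mul_inv] at this
    exact one_notMem_filt_one this
  have h6 : aug g a = 1 := by
    have : aug g a * (1 - aug g a) = 0 := by rw [mul_sub, mul_one]; exact h2
    rcases mul_eq_zero.mp this with h | h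
    · exact absurd h h5
    · linarith
  have h7 : hat g (a - 1) ∈ filt g 1 := by
    rw [hat_mem_filt, mem_augPow_one, map_sub, h6, map_one, sub_self]
  have := add_mem ha h7
  rwa [map_sub, map_one, sub_add_sub_cancel] at this

/-- The leading term of an element of the Malcev completion is primitive. -/
theorem exists_primitive_leading {n : ℕ} (hn : 1 ≤ n) (y : malcev g)
    (hy : malcevVal y - 1 ∈ filt g n) :
    ∃ b ∈ augPow g n, malcevVal y - 1 - hat g b ∈ filt g (n + 1) ∧
      comul g b - b ⊗ₜ[ℚ] 1 - 1 ⊗ₜ[ℚ] b ∈ tensPow g (n + 1) := by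
  obtain ⟨b, hb, h⟩ := exists_mem_sub_hat_mem hy (Nat.le_succ n)
  refine ⟨b, hb, h, ?_⟩
  have h1 := malcevVal_comul y (a := 1 + b) (n := n + 1) (by
    rwa [map_add, map_one, ← sub_sub])
  have h2 : b ⊗ₜ[ℚ] b ∈ tensPow g (n + 1) := tmul_mem hb hb (by omega)
  convert add_mem h1 h2 using 1
  rw [map_add, map_one, Algebra.TensorProduct.one_def, TensorProduct.add_tmul,
    TensorProduct.tmul_add, TensorProduct.tmul_add]
  abel

end Filtration

/-! ### Leading terms of elements of the fundamental group -/

section Leading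

variable {g : ℕ}

/-- Left-normed commutators of the generators of `π`. -/
def grpComm : List (Gen g) → Pi1 g
  | [] => 1
  | [x] => FreeGroup.of x
  | x :: y :: w => grpComm (y :: w) * FreeGroup.of x * (grpComm (y :: w))⁻¹ * (FreeGroup.of x)⁻¹

theorem pt_commutator_congr {n : ℕ} {v : Pi1 g} {L : GrpAlg g} (hL : L ∈ augPow g n)
    (h : pt v - 1 - L ∈ augPow g (n + 1)) (x : Gen g) :
    pt (v * FreeGroup.of x * v⁻¹ * (FreeGroup.of x)⁻¹) - 1 - (L * gX x - gX x * L) ∈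
      augPow g (n + 2) := by
  have e : pt (v * FreeGroup.of x * v⁻¹ * (FreeGroup.of x)⁻¹) - 1 =
      ((pt v - 1) * gX x - gX x * (pt v - 1)) * pt (v⁻¹ * (FreeGroup.of x)⁻¹) := by
    have e1 : (pt v - 1) * gX x - gX x * (pt v - 1) =
        pt (v * FreeGroup.of x) - pt (FreeGroup.of x * v) := by
      rw [gX, map_mul pt, map_mul pt]; noncomm_ring
    have e2 : FreeGroup.of x * v * (v⁻¹ * (FreeGroup.of x)⁻¹) = 1 := by group
    rw [e1, sub_mul, ← map_mul pt, ← map_mul pt, e2, map_one, mul_assoc _ v⁻¹]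
  have hv : pt v - 1 ∈ augPow g n := by
    have := add_mem (augPow_anti (Nat.le_succ n) h) hL
    rwa [sub_add_cancel] at this
  have h1 : (pt v - 1) * gX x - gX x * (pt v - 1) ∈ augPow g (n + 1) :=
    sub_mem (mul_mem_augPow hv (gX_mem x)) (mul_mem_augPow_of_le (gX_mem x) hv (by omega))
  have h2 := mul_mem_augPow h1 (pt_sub_one_mem (v⁻¹ * (FreeGroup.of x)⁻¹))
  have h3 : (pt v - 1 - L) * gX x - gX x * (pt v - 1 - L) ∈ augPow g (n + 2) :=
    sub_mem (mul_mem_augPow_of_le h (gX_mem x) (by omega))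
      (mul_mem_augPow_of_le (gX_mem x) h (by omega))
  rw [e]
  convert add_mem h2 h3 using 1
  noncomm_ring

theorem grpComm_congr (w : List (Gen g)) (hw : w ≠ []) :
    pt (grpComm w) - 1 - lieMono w ∈ augPow g (w.length + 1) := by
  induction w with
  | nil => exact absurd rfl hw
  | cons x w ih =>
    cases w with
    | nil =>
      rw [grpComm, lieMono, gX, sub_self]; exact zero_mem _
    | cons y w =>
      rw [grpComm, lieMono]
      exact pt_commutator_congr (lieMono_mem _) (ih (by simp)) x

/-- The leading terms in degree `n` of the elements of `π`. -/
def leadGrp (g n : ℕ) (_ : 1 ≤ n) : AddSubgroup (GrpAlg g) where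
  carrier := {a | a ∈ augPow g n ∧ ∃ v : Pi1 g, pt v - 1 - a ∈ augPow g (n + 1)}
  zero_mem' := ⟨zero_mem _, 1, by rw [map_one, sub_self, sub_zero]; exact zero_mem _⟩
  add_mem' := by
    rintro a b ⟨ha, v, hv⟩ ⟨hb, w, hw⟩
    refine ⟨add_mem ha hb, v * w, ?_⟩
    have h1 : pt v - 1 ∈ augPow g n := by
      have := add_mem (augPow_anti (Nat.le_succ n) hv) ha
      rwa [sub_add_cancel] at this
    have h2 : (pt v - 1) * (pt w - 1) ∈ augPow g (n + 1) :=
      mul_mem_augPow_of_le h1 (pt_sub_one_mem w) (by omega)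
    convert add_mem (add_mem hv hw) h2 using 1
    rw [map_mul pt]
    noncomm_ring
  neg_mem' := by
    rintro a ⟨ha, v, hv⟩
    refine ⟨neg_mem ha, v⁻¹, ?_⟩
    have h1 : pt v - 1 ∈ augPow g n := by
      have := add_mem (augPow_anti (Nat.le_succ n) hv) ha
      rwa [sub_add_cancel] at this
    have h2 : (pt v⁻¹ - 1) * (pt v - 1) ∈ augPow g (n + 1) :=
      mul_mem_augPow_of_le (pt_sub_one_mem v⁻¹) h1 (by omega)
    convert neg_mem (add_mem hv h2) using 1
    rw [sub_mul, mul_sub, pt_inv_mul]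
    noncomm_ring

theorem lieMono_mem_leadGrp (w : List (Gen g)) (hw : 1 ≤ w.length) :
    lieMono w ∈ leadGrp g w.length hw :=
  ⟨lieMono_mem w, grpComm w, grpComm_congr w (by rintro rfl; simp at hw)⟩

/-- The elements having a positive multiple in a given subgroup form a rational subspace. -/
theorem exists_nsmul_sum_mem {M : Type*} [AddCommGroup M] [Module ℚ M] (S : AddSubgroup M)
    {ι : Type*} (s : Finset ι) (c : ι → ℚ) (v : ι → M) (hv : ∀ i ∈ s, v i ∈ S) :
    ∃ N : ℕ, 0 < N ∧ (N : ℚ) • ∑ i ∈ s, c i • v i ∈ S := by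
  classical
  induction s using Finset.induction_on with
  | empty => exact ⟨1, one_pos, by simp⟩
  | insert i s hi ih =>
    obtain ⟨N, hN, h⟩ := ih fun j hj => hv j (Finset.mem_insert_of_mem hj)
    refine ⟨N * (c i).den, mul_pos hN (c i).den_pos, ?_⟩
    rw [Finset.sum_insert hi, smul_add]
    refine add_mem ?_ ?_
    · have e : (((N * (c i).den : ℕ) : ℚ)) • c i • v i = (((N : ℤ) * (c i).num : ℤ)) • v i := by
        rw [smul_smul, ← Int.cast_smul_eq_zsmul ℚ]
        congr 1
        push_cast
        rw [mul_assoc, Rat.den_mul_eq_num]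
      rw [e]
      exact S.zsmul_mem (hv i (Finset.mem_insert_self i s)) _
    · rw [mul_comm, Nat.cast_mul, mul_smul, Nat.cast_smul_eq_nsmul ℚ]
      exact S.nsmul_mem h _

/-- Up to elements of higher order, a power of an element of the Malcev completion lies in `π`. -/
theorem exists_pow_congr {n : ℕ} (hn : 1 ≤ n) (y : malcev g) (hy : malcevVal y - 1 ∈ filt g n) :
    ∃ N : ℕ, 0 < N ∧ ∃ v : Pi1 g, malcevVal y ^ N - hat g (pt v) ∈ filt g (n + 1) := by
  obtain ⟨b, hb, hyb, hprim⟩ := exists_primitive_leading hn y hy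
  have h1 := smul_sub_sum_lieMono_mem hb hprim
  obtain ⟨N, hN, h2⟩ := exists_nsmul_sum_mem (leadGrp g n hn) (Finset.univ : Finset (Word g n))
    (fun w => coef w.1 b) (fun w => lieMono w.1) (fun w _ => by
      have h3 : w.1.length = n := w.2
      obtain ⟨w, rfl⟩ := w
      exact lieMono_mem_leadGrp w hn)
  obtain ⟨_, v, hv⟩ := h2
  refine ⟨N * n, mul_pos hN hn, v, ?_⟩
  -- In the leading degree, taking powers is multiplication by the exponent.
  have hpow : ∀ k : ℕ, malcevVal y ^ k - 1 - (k : ℚ) • hat g b ∈ filt g (n + 1) := by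
    intro k
    induction k with
    | zero => simp
    | succ k ih =>
      have h4 : (malcevVal y ^ k - 1) * (malcevVal y - 1) ∈ filt g (n + 1) := by
        refine mul_mem_filt (m := 1) ?_ hy (by omega)
        rw [← malcevVal_pow]
        exact malcevVal_sub_one_mem _
      convert add_mem (add_mem ih hyb) h4 using 1
      rw [pow_succ]
      push_cast
      rw [add_smul, one_smul]
      simp only [sub_mul, mul_sub, one_mul, mul_one]
      abel
  have h5 := hat_mem_filt.mpr (augPow_smul (N : ℚ) h1)
  have h6 := hat_mem_filt.mpr hv
  convert sub_mem (add_mem (hpow (N * n)) h5) h6 using 1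
  rw [smul_sub, map_sub, map_sub, map_sub, smul_smul, map_smul, map_one]
  push_cast
  abel

/-- Unipotent elements with congruent powers are congruent. -/
theorem sub_mem_of_pow_sub_mem {n N : ℕ} (hN : 0 < N) {p q : Hat g} (hp : p - 1 ∈ filt g 1)
    (hq : q - 1 ∈ filt g 1) (h : p ^ N - q ^ N ∈ filt g n) : p - q ∈ filt g n := by
  have key : ∀ i, i ≤ n → p - q ∈ filt g i := by
    intro i
    induction i with
    | zero => intro _; exact filt_zero _
    | succ i ih =>
      intro hi
      have he := ih (by omega)
      have hpow : ∀ k : ℕ, q ^ k - 1 ∈ filt g 1 := fun k => by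
        induction k with
        | zero => simp
        | succ k ih =>
          have := mul_congr_filt (g := g) (x' := 1) (y' := 1) ih hq
          rwa [mul_one, ← pow_succ] at this
      have h1 : ∀ k : ℕ, p ^ k - q ^ k - (k : ℚ) • (p - q) ∈ filt g (i + 1) := by
        intro k
        induction k with
        | zero => simp
        | succ k ihk =>
          have h2 : (p ^ k - q ^ k) * (p - 1) ∈ filt g (i + 1) := by
            refine mul_mem_filt (m := i) ?_ hp le_rfl
            have := add_mem (filt_anti (Nat.le_succ i) ihk) (filt_smul (k : ℚ) he)
            rwa [sub_add_cancel] at this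
          have h3 : (q ^ k - 1) * (p - q) ∈ filt g (i + 1) :=
            mul_mem_filt (hpow k) he (by omega)
          convert add_mem (add_mem ihk h2) h3 using 1
          rw [pow_succ, pow_succ]
          push_cast
          rw [add_smul, one_smul]
          simp only [sub_mul, mul_sub, one_mul, mul_one]
          abel
      have h2 := sub_mem (filt_anti hi h) (h1 N)
      rw [sub_sub_cancel] at h2
      have h3 := filt_smul (N : ℚ)⁻¹ h2
      rwa [smul_smul, inv_mul_cancel₀ (by positivity), one_smul] at h3
  exact key n le_rfl

/-- An element of the generalized mapping class group that fixes the generators of `π` up to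
elements of a given order fixes all of the Malcev completion up to elements of this order. -/
theorem sub_mem_filt_of_gen {n : ℕ} (w : GenMCG g)
    (h : ∀ x, malcevVal (w.1 (toMalcev g (FreeGroup.of x))) - hat g (pt (FreeGroup.of x)) ∈
      filt g n) (y : malcev g) : malcevVal (w.1 y) - malcevVal y ∈ filt g n := by
  have hinv : ∀ y : malcev g, malcevVal (w.1 y) - malcevVal y ∈ filt g n →
      malcevVal (w.1 y⁻¹) - malcevVal y⁻¹ ∈ filt g n := by
    intro y hy
    have := neg_mem (filt_mul_right (malcevVal y⁻¹) (filt_mul_left (malcevVal (w.1 y⁻¹)) hy))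
    rwa [mul_sub, sub_mul, ← malcevVal_mul, ← map_mul, inv_mul_cancel, map_one, malcevVal_one,
      one_mul, mul_assoc, malcevVal_mul_inv, mul_one, neg_sub] at this
  have hmul : ∀ y z : malcev g, malcevVal (w.1 y) - malcevVal y ∈ filt g n →
      malcevVal (w.1 z) - malcevVal z ∈ filt g n →
      malcevVal (w.1 (y * z)) - malcevVal (y * z) ∈ filt g n := by
    intro y z hy hz
    rw [map_mul, malcevVal_mul, malcevVal_mul]
    exact mul_congr_filt hy hz
  have hpi : ∀ v : Pi1 g, malcevVal (w.1 (toMalcev g v)) - malcevVal (toMalcev g v) ∈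
      filt g n := by
    intro v
    induction v using FreeGroup.induction_on with
    | C1 => rw [map_one, map_one, sub_self]; exact zero_mem _
    | of x => exact h x
    | inv_of x _ => rw [map_inv]; exact hinv _ (h x)
    | mul v v' hv hv' => rw [map_mul (toMalcev g)]; exact hmul _ _ hv hv'
  -- Descending induction on the depth `j` of `y`: some power of `y` is an element of `π` times an
  -- element of greater depth, and roots are unique.
  have key : ∀ i j, i + j = n → 1 ≤ j → ∀ y : malcev g, malcevVal y - 1 ∈ filt g j →
      malcevVal (w.1 y) - malcevVal y ∈ filt g n := by
    intro i
    induction i with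
    | zero =>
      intro j hj _ y hy
      rw [zero_add] at hj
      subst hj
      have h1 : malcevVal (w.1 y) - 1 ∈ filt g j := (w.2.1 j y).mpr hy
      have := sub_mem h1 hy
      rwa [sub_sub_sub_cancel_right] at this
    | succ i ih =>
      intro j hj hj1 y hy
      obtain ⟨N, hN, v, hv⟩ := exists_pow_congr hj1 y hy
      have h1 : malcevVal (y ^ N * (toMalcev g v)⁻¹) - 1 ∈ filt g (j + 1) := by
        have := filt_mul_right (malcevVal (toMalcev g v)⁻¹) hv
        rwa [sub_mul, ← malcevVal_toMalcev, malcevVal_mul_inv, ← malcevVal_pow,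
          ← malcevVal_mul] at this
      have h2 := hmul _ _ (ih (j + 1) (by omega) (by omega) _ h1) (hpi v)
      rw [inv_mul_cancel_right, map_pow, malcevVal_pow, malcevVal_pow] at h2
      exact sub_mem_of_pow_sub_mem hN (malcevVal_sub_one_mem _) (malcevVal_sub_one_mem _) h2
  rcases Nat.eq_zero_or_pos n with rfl | hn
  · exact filt_zero _
  · exact key (n - 1) 1 (by omega) le_rfl y (malcevVal_sub_one_mem y)

end Leading

/-! ### Transvections move one symplectic basis to another -/

section Transvection

variable {g : ℕ} {V : Type*} [AddCommGroup V] [Module ℚ V]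

/-- The intersection numbers of the standard generators. -/
def stdForm : Gen g → Gen g → ℚ
  | Sum.inl i, Sum.inr j => if i = j then 1 else 0
  | Sum.inr i, Sum.inl j => if i = j then -1 else 0
  | _, _ => 0

/-- The transvection `v ↦ v + s ω(v, c) c`. -/
def transv (ω : V →ₗ[ℚ] V →ₗ[ℚ] ℚ) (c : V) (s : ℚ) : Module.End ℚ V :=
  1 + s • (ω.flip c).smulRight c

theorem transv_apply (ω : V →ₗ[ℚ] V →ₗ[ℚ] ℚ) (c : V) (s : ℚ) (v : V) :
    transv ω c s v = v + (s * ω v c) • c := by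
  simp [transv, mul_smul]

/-- The monoid generated by the transvections. -/
def transvMonoid (ω : V →ₗ[ℚ] V →ₗ[ℚ] ℚ) : Submonoid (Module.End ℚ V) :=
  Submonoid.closure {t | ∃ c s, t = transv ω c s}

theorem transv_mem (ω : V →ₗ[ℚ] V →ₗ[ℚ] ℚ) (c : V) (s : ℚ) : transv ω c s ∈ transvMonoid ω :=
  Submonoid.subset_closure ⟨c, s, rfl⟩

theorem form_apply_of_mem_transvMonoid {ω : V →ₗ[ℚ] V →ₗ[ℚ] ℚ} (hω : ∀ u, ω u u = 0)
    {τ : Module.End ℚ V} (hτ : τ ∈ transvMonoid ω) (u v : V) : ω (τ u) (τ v) = ω u v := by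
  have hskew : ∀ u v, ω u v = - ω v u := fun u v => by
    have := hω (u + v)
    simp only [map_add, LinearMap.add_apply, hω] at this
    linarith
  induction hτ using Submonoid.closure_induction generalizing u v with
  | mem t ht =>
    obtain ⟨c, s, rfl⟩ := ht
    simp only [transv_apply, map_add, map_smul, LinearMap.add_apply, LinearMap.smul_apply,
      smul_eq_mul, hω]
    rw [hskew c v]
    ring
  | one => rfl
  | mul s t _ _ hs ht => rw [Module.End.mul_apply, Module.End.mul_apply, hs, ht]

/-- A vector is moved to another one by one or two transvections, without moving the vectors that
have the same product with both. -/
theorem exists_transv_move {ω : V →ₗ[ℚ] V →ₗ[ℚ] ℚ} (hω : ∀ u, ω u u = 0) (F : Set V) {u u' : V}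
    (h : ∀ f ∈ F, ω f u = ω f u') (z : V) (hz : ∀ f ∈ F, ω f z = ω f u) (huz : ω u z ≠ 0)
    (hzu : ω z u' ≠ 0) : ∃ τ ∈ transvMonoid ω, τ u = u' ∧ ∀ f ∈ F, τ f = f := by
  have one : ∀ u u' : V, (∀ f ∈ F, ω f u = ω f u') → ω u u' ≠ 0 →
      ∃ τ ∈ transvMonoid ω, τ u = u' ∧ ∀ f ∈ F, τ f = f := by
    intro u u' h hu
    refine ⟨_, transv_mem ω (u' - u) (ω u u')⁻¹, ?_, fun f hf => ?_⟩
    · rw [transv_apply, map_sub, hω, sub_zero, inv_mul_cancel₀ hu, one_smul, add_sub_cancel]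
    · rw [transv_apply, map_sub, h f hf, sub_self, mul_zero, zero_smul, add_zero]
  obtain ⟨σ, hσ, h1, h2⟩ := one u z (fun f hf => (hz f hf).symm) huz
  obtain ⟨τ, hτ, h3, h4⟩ := one z u' (fun f hf => (hz f hf).trans (h f hf)) hzu
  refine ⟨τ * σ, mul_mem hτ hσ, ?_, fun f hf => ?_⟩
  · rw [Module.End.mul_apply, h1, h3]
  · rw [Module.End.mul_apply, h2 f hf, h4 f hf]

/-- The index of the handle of a generator. -/
def handleIdx : Gen g → ℕ := Sum.elim (fun i => (i : ℕ)) fun i => (i : ℕ)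

theorem stdForm_eq_zero {x y : Gen g} (h : handleIdx x ≠ handleIdx y) : stdForm x y = 0 := by
  rcases x with i | i <;> rcases y with j | j <;> simp only [stdForm, handleIdx, Sum.elim_inl,
    Sum.elim_inr] at h ⊢
  · exact if_neg fun e => h (congrArg _ e)
  · exact if_neg fun e => h (congrArg _ e)

theorem exists_transv_basis {ω : V →ₗ[ℚ] V →ₗ[ℚ] ℚ} (hω : ∀ u, ω u u = 0) {v e : Gen g → V}
    (hv : ∀ x y, ω (v x) (v y) = stdForm x y) (he : ∀ x y, ω (e x) (e y) = stdForm x y) :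
    ∃ τ ∈ transvMonoid ω, ∀ x, τ (v x) = e x := by
  have hskew : ∀ u v, ω u v = - ω v u := fun u v => by
    have := hω (u + v)
    simp only [map_add, LinearMap.add_apply, hω] at this
    linarith
  have key : ∀ n ≤ g, ∃ τ ∈ transvMonoid ω, ∀ x, handleIdx x < n → τ (v x) = e x := by
    intro n
    induction n with
    | zero => exact fun _ => ⟨1, one_mem _, fun x hx => absurd hx (Nat.not_lt_zero _)⟩
    | succ n ih =>
      intro hn
      obtain ⟨τ, hτ, hτe⟩ := ih (by omega)
      let i : Fin g := ⟨n, hn⟩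
      have hv₁ : ∀ x y, ω (τ (v x)) (τ (v y)) = stdForm x y := fun x y => by
        rw [form_apply_of_mem_transvMonoid hω hτ, hv]
      have hi : ∀ x : Gen g, handleIdx x < n → ∀ y, handleIdx y = n → stdForm x y = 0 :=
        fun x hx y hy => stdForm_eq_zero (by omega)
      have hne : ∀ x : Gen g, handleIdx x < n → stdForm x (Sum.inl i) = 0 ∧
          stdForm x (Sum.inr i) = 0 := fun x hx => ⟨hi x hx _ rfl, hi x hx _ rfl⟩
      have hab : stdForm (Sum.inl i : Gen g) (Sum.inr i) = 1 := if_pos rfl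
      have haa : stdForm (Sum.inl i : Gen g) (Sum.inl i) = 0 := rfl
      -- First the vector `τ (v (inl i))` is moved to `e (inl i)`.
      obtain ⟨σ, hσ, hσ₁, hσ₂⟩ : ∃ σ ∈ transvMonoid ω, σ (τ (v (Sum.inl i))) = e (Sum.inl i) ∧
          ∀ f ∈ e '' {x | handleIdx x < n}, σ f = f := by
        have h1 : ∀ f ∈ e '' {x | handleIdx x < n}, ω f (τ (v (Sum.inl i))) = 0 ∧
            ω f (τ (v (Sum.inr i))) = 0 ∧ ω f (e (Sum.inl i)) = 0 ∧ ω f (e (Sum.inr i)) = 0 := by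
          rintro _ ⟨x, hx, rfl⟩
          refine ⟨?_, ?_, ?_, ?_⟩
          · rw [← hτe x hx, hv₁, (hne x hx).1]
          · rw [← hτe x hx, hv₁, (hne x hx).2]
          · rw [he, (hne x hx).1]
          · rw [he, (hne x hx).2]
        have h2 : ω (τ (v (Sum.inl i))) (τ (v (Sum.inr i))) ≠ 0 := by
          rw [hv₁, hab]; exact one_ne_zero
        have h3 : ω (e (Sum.inr i)) (e (Sum.inl i)) ≠ 0 := by
          rw [hskew, he, hab]; norm_num
        have h4 : ∃ z, (∀ f ∈ e '' {x | handleIdx x < n}, ω f z = 0) ∧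
            ω (τ (v (Sum.inl i))) z ≠ 0 ∧ ω z (e (Sum.inl i)) ≠ 0 := by
          by_cases c1 : ω (τ (v (Sum.inr i))) (e (Sum.inl i)) = 0
          · by_cases c2 : ω (τ (v (Sum.inl i))) (e (Sum.inr i)) = 0
            · refine ⟨τ (v (Sum.inr i)) + e (Sum.inr i), fun f hf => ?_, ?_, ?_⟩
              · rw [map_add, (h1 f hf).2.1, (h1 f hf).2.2.2, add_zero]
              · rwa [map_add, c2, add_zero]
              · rwa [map_add, LinearMap.add_apply, c1, zero_add]
            · exact ⟨e (Sum.inr i), fun f hf => (h1 f hf).2.2.2, c2, h3⟩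
          · exact ⟨τ (v (Sum.inr i)), fun f hf => (h1 f hf).2.1, h2, c1⟩
        obtain ⟨z, hz1, hz2, hz3⟩ := h4
        exact exists_transv_move hω _ (fun f hf => (h1 f hf).1.trans (h1 f hf).2.2.1.symm) z
          (fun f hf => (hz1 f hf).trans (h1 f hf).1.symm) hz2 hz3
      have hστ := mul_mem hσ hτ
      have hv₂ : ∀ x y, ω (σ (τ (v x))) (σ (τ (v y))) = stdForm x y := fun x y => by
        rw [form_apply_of_mem_transvMonoid hω hσ, hv₁]
      have hσe : ∀ x, handleIdx x < n ∨ x = Sum.inl i → σ (τ (v x)) = e x := by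
        rintro x (hx | rfl)
        · rw [hτe x hx]; exact hσ₂ _ ⟨x, hx, rfl⟩
        · exact hσ₁
      -- Then the image of `v (inr i)` is moved to `e (inr i)`.
      have hF : ∀ x : Gen g, handleIdx x < n ∨ x = Sum.inl i → stdForm x (Sum.inl i) = 0 := by
        rintro x (hx | rfl)
        · exact (hne x hx).1
        · rfl
      obtain ⟨ρ, hρ, hρ₁, hρ₂⟩ : ∃ ρ ∈ transvMonoid ω,
          ρ (σ (τ (v (Sum.inr i)))) = e (Sum.inr i) ∧
          ∀ f ∈ e '' {x | handleIdx x < n ∨ x = Sum.inl i}, ρ f = f := by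
        have h1 : ∀ f ∈ e '' {x | handleIdx x < n ∨ x = Sum.inl i},
            ω f (σ (τ (v (Sum.inr i)))) = ω f (e (Sum.inr i)) := by
          rintro _ ⟨x, hx, rfl⟩
          rw [he, ← hv₂, hσe x hx]
        by_cases c : ω (σ (τ (v (Sum.inr i)))) (e (Sum.inr i)) = 0
        · refine exists_transv_move hω _ h1 (e (Sum.inr i) + e (Sum.inl i)) ?_ ?_ ?_
          · intro f hf
            rw [h1 f hf]
            obtain ⟨x, hx, rfl⟩ := hf
            rw [map_add, he x (Sum.inl i), hF x hx, add_zero]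
          · rw [map_add, c, zero_add, hskew, ← hσe (Sum.inl i) (Or.inr rfl), hv₂, hab]
            norm_num
          · rw [map_add, LinearMap.add_apply, hω, zero_add, he, hab]
            exact one_ne_zero
        · refine ⟨_, transv_mem ω (e (Sum.inr i) - σ (τ (v (Sum.inr i))))
            (ω (σ (τ (v (Sum.inr i)))) (e (Sum.inr i)))⁻¹, ?_, fun f hf => ?_⟩
          · rw [transv_apply, map_sub, hω, sub_zero, inv_mul_cancel₀ c, one_smul, add_sub_cancel]
          · rw [transv_apply, map_sub, h1 f hf, sub_self, mul_zero, zero_smul, add_zero]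
      refine ⟨ρ * (σ * τ), mul_mem hρ hστ, fun x hx => ?_⟩
      rw [Module.End.mul_apply, Module.End.mul_apply]
      by_cases c : handleIdx x < n ∨ x = Sum.inl i
      · rw [hσe x c]; exact hρ₂ _ ⟨x, c, rfl⟩
      · have : x = Sum.inr i := by
          push Not at c
          rcases x with j | j
          · exfalso
            refine c.2 (congrArg Sum.inl (Fin.ext ?_))
            have := c.1
            simp only [handleIdx, Sum.elim_inl] at this hx
            simp only [i]
            omega
          · refine congrArg Sum.inr (Fin.ext ?_)
            have := c.1
            simp only [handleIdx, Sum.elim_inr] at this hx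
            simp only [i]
            omega
        rw [this]; exact hρ₁
  obtain ⟨τ, hτ, h⟩ := key g le_rfl
  refine ⟨τ, hτ, fun x => h x ?_⟩
  rcases x with i | i <;> exact i.2

/-- If the columns of a matrix form a symplectic basis, so do its rows. -/
theorem symplectic_rows {M : Gen g → Gen g → ℚ}
    (h : ∀ y z, ∑ i, (M (Sum.inl i) y * M (Sum.inr i) z - M (Sum.inr i) y * M (Sum.inl i) z) =
      stdForm y z) (x x' : Gen g) :
    ∑ i, (M x (Sum.inl i) * M x' (Sum.inr i) - M x (Sum.inr i) * M x' (Sum.inl i)) =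
      stdForm x x' := by
  have hJ : ∀ x y : Gen g, Matrix.J (Fin g) ℚ x y = - stdForm x y := by
    rintro (i | i) (j | j) <;> simp [Matrix.J, stdForm, Matrix.one_apply]
    split_ifs <;> rfl
  have hform : ∀ (u v : Gen g → ℚ), ∑ y, (∑ x, u x * Matrix.J (Fin g) ℚ x y) * v y =
      - ∑ i, (u (Sum.inl i) * v (Sum.inr i) - u (Sum.inr i) * v (Sum.inl i)) := by
    intro u v
    simp only [hJ, Fintype.sum_sum_type, stdForm]
    simp [Finset.sum_sub_distrib, Finset.sum_neg_distrib]
    ring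
  have h1 : (Matrix.of M) ∈ Matrix.symplecticGroup (Fin g) ℚ := by
    rw [SymplecticGroup.mem_iff']
    ext y z
    rw [Matrix.mul_apply]
    simp only [Matrix.mul_apply, Matrix.transpose_apply, Matrix.of_apply]
    rw [hform (fun x => M x y) (fun x => M x z), h, hJ]
  have h2 := congrFun (congrFun (SymplecticGroup.mem_iff.mp h1) x) x'
  rw [Matrix.mul_apply] at h2
  simp only [Matrix.mul_apply, Matrix.transpose_apply, Matrix.of_apply] at h2
  rw [hform (M x) (M x'), hJ] at h2
  linarith

end Transvection

/-! ### The action of the generalized mapping class group on homology -/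

section Homology

variable {g : ℕ}

theorem hcoef_eq_zero (x : Gen g) {a : GrpAlg g} (ha : a ∈ augPow g 2) : hcoef x a = 0 :=
  mem_augPow_one.mp (fox_mem x ha)

theorem hcoef_congr (x : Gen g) {a b : GrpAlg g} (h : a - b ∈ augPow g 2) :
    hcoef x a = hcoef x b := by
  rw [← sub_eq_zero, ← map_sub]; exact hcoef_eq_zero x h

theorem hcoef_one (x : Gen g) : hcoef x 1 = 0 := by
  rw [hcoef_apply, fox_one, map_zero]

theorem hcoef_gX (x y : Gen g) : hcoef x (gX y) = if y = x then 1 else 0 := by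
  rw [hcoef_apply, fox_gX]; split_ifs
  · exact map_one _
  · exact map_zero _

theorem hcoef_pt_mul (x : Gen g) (v w : Pi1 g) :
    hcoef x (pt (v * w)) = hcoef x (pt v) + hcoef x (pt w) := by
  rw [map_mul, hcoef_apply, fox_mul, aug_pt, one_smul, map_add, map_mul, aug_pt, one_mul]
  rfl

/-- The homology class of an element of the completion. -/
def hvec (h : Hat g) (x : Gen g) : ℚ := hcoef x (exists_sub_hat_mem h 2).choose

theorem hvec_eq {h : Hat g} {a : GrpAlg g} (ha : h - hat g a ∈ filt g 2) (x : Gen g) :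
    hvec h x = hcoef x a := by
  refine hcoef_congr x (hat_mem_filt.mp ?_)
  have := sub_mem ha (exists_sub_hat_mem h 2).choose_spec
  rwa [sub_sub_sub_cancel_left, ← map_sub] at this

theorem hvec_hat (a : GrpAlg g) (x : Gen g) : hvec (hat g a) x = hcoef x a :=
  hvec_eq (by rw [sub_self]; exact zero_mem _) x

/-- The intersection form on homology classes. -/
def hform (g : ℕ) : (Gen g → ℚ) →ₗ[ℚ] (Gen g → ℚ) →ₗ[ℚ] ℚ :=
  LinearMap.mk₂ ℚ (fun u v => ∑ i, (u (Sum.inl i) * v (Sum.inr i) - u (Sum.inr i) * v (Sum.inl i)))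
    (fun u u' v => by
      rw [← Finset.sum_add_distrib]
      exact Finset.sum_congr rfl fun i _ => by simp only [Pi.add_apply]; ring)
    (fun c u v => by
      rw [smul_eq_mul, Finset.mul_sum]
      exact Finset.sum_congr rfl fun i _ => by simp only [Pi.smul_apply, smul_eq_mul]; ring)
    (fun u v v' => by
      rw [← Finset.sum_add_distrib]
      exact Finset.sum_congr rfl fun i _ => by simp only [Pi.add_apply]; ring)
    (fun c u v => by
      rw [smul_eq_mul, Finset.mul_sum]
      exact Finset.sum_congr rfl fun i _ => by simp only [Pi.smul_apply, smul_eq_mul]; ring)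

theorem hform_apply (u v : Gen g → ℚ) : hform g u v =
    ∑ i, (u (Sum.inl i) * v (Sum.inr i) - u (Sum.inr i) * v (Sum.inl i)) := rfl

theorem hform_self (u : Gen g → ℚ) : hform g u u = 0 := by
  rw [hform_apply]
  exact Finset.sum_eq_zero fun i _ => by ring

/-- A twist acts on homology as a transvection. -/
theorem hvec_twist (r : ℚ) (γ : Pi1 g) (h : Hat g) :
    hvec ((twist r γ).1 h) = transv (hform g) (fun x => hcoef x (pt γ)) (2 * r) (hvec h) := by
  obtain ⟨a, ha⟩ := exists_sub_hat_mem h 2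
  have hd := sigmaL_isDer (logSqTrunc 5 γ)
  set d := sigmaL (logSqTrunc 5 γ) with hd'
  have e0 : d (a - aug g a • 1) = d a := by
    rw [map_sub, map_smul, hd.map_one, smul_zero, sub_zero]
  have e1 : ∀ x, hcoef x (a - aug g a • 1) = hcoef x a := fun x => by
    rw [map_sub, map_smul, hcoef_one, smul_zero, sub_zero]
  have h1 := sigmaL_logSqTrunc_congr (M := 5) (by omega) γ (sub_aug_mem a)
  rw [← hd', e0] at h1
  have h2 : d (d a) ∈ augPow g 2 := by
    have := sigmaL_sigmaL_logSqTrunc_mem (M := 5) (by omega) γ (sub_aug_mem a)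
    rwa [← hd', e0] at this
  have h3 : (twist r γ).1 h - hat g (a + r • d a) ∈ filt g 2 := by
    have e : h.1 2 = lvl (aug g) 2 a := sub_eq_zero.mp ha
    rw [mem_filt]
    change (twistAut r γ h).1 2 - lvl (aug g) 2 (a + r • d a) = 0
    have h4 := IsNilpotent.exp_smul_eq_sum (a := r • twistLevel γ 2) (m := lvl (aug g) 2 a)
      (k := 2) (by
        rw [pow_two, mul_smul, Module.End.smul_def, Module.End.smul_def, LinearMap.smul_apply,
          LinearMap.smul_apply, twistLevel_lvl γ (M := 5) (by omega), map_smul,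
          twistLevel_lvl γ (M := 5) (by omega), lvl_eq_zero.mpr h2, smul_zero, smul_zero])
      ((isNilpotent_twistLevel γ 2).smul r)
    rw [Module.End.smul_def] at h4
    rw [twistAut_level, e, h4, Finset.sum_range_succ, Finset.sum_range_one, pow_zero, pow_one,
      one_smul, Module.End.smul_def, LinearMap.smul_apply, twistLevel_lvl γ (M := 5) (by omega),
      map_add, map_smul, sub_eq_zero, ← hd']
    simp
  funext x
  rw [hvec_eq h3, transv_apply, map_add, map_smul, hcoef_congr x h1, map_smul, map_sub, hcoef_one,
    sub_zero, Pi.add_apply, hvec_eq ha]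
  have e2 : omega (a - aug g a • 1) (pt γ) = hform g (hvec h) fun x => hcoef x (pt γ) := by
    rw [hform_apply, omega]
    refine Finset.sum_congr rfl fun i _ => ?_
    rw [e1, e1, hvec_eq ha, hvec_eq ha]
  rw [e2, Pi.smul_apply, smul_eq_mul, smul_eq_mul, smul_eq_mul]
  ring

theorem exists_hcoef_eq (c : Gen g → ℤ) : ∃ γ : Pi1 g, ∀ x, hcoef x (pt γ) = c x := by
  have hz : ∀ (x : Gen g) (v : Pi1 g) (n : ℤ), hcoef x (pt (v ^ n)) = n * hcoef x (pt v) := by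
    intro x v n
    let φ : Pi1 g →* Multiplicative ℚ :=
      { toFun := fun v => Multiplicative.ofAdd (hcoef x (pt v))
        map_one' := by rw [map_one, hcoef_one]; rfl
        map_mul' := fun v w => by rw [hcoef_pt_mul]; rfl }
    have := congrArg Multiplicative.toAdd (map_zpow φ v n)
    rw [toAdd_zpow] at this
    change hcoef x (pt (v ^ n)) = n • hcoef x (pt v) at this
    rw [this, zsmul_eq_mul]
  have key : ∀ s : Finset (Gen g), ∃ γ : Pi1 g, ∀ x, hcoef x (pt γ) = if x ∈ s then (c x : ℚ)
      else 0 := by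
    intro s
    induction s using Finset.induction_on with
    | empty => exact ⟨1, fun x => by rw [map_one, hcoef_one]; simp⟩
    | insert y s hy ih =>
      obtain ⟨γ, hγ⟩ := ih
      refine ⟨γ * FreeGroup.of y ^ (c y), fun x => ?_⟩
      have e : hcoef x (pt (FreeGroup.of y)) = if y = x then 1 else 0 := by
        rw [← hcoef_gX, gX, map_sub, hcoef_one, sub_zero]
      rw [hcoef_pt_mul, hγ, hz, e]
      by_cases h : y = x
      · subst h; simp [hy]
      · have h' : x ≠ y := fun e => h e.symm
        simp [h, h', Finset.mem_insert]
  obtain ⟨γ, hγ⟩ := key Finset.univ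
  exact ⟨γ, fun x => by rw [hγ, if_pos (Finset.mem_univ x)]⟩

/-- The group of automorphisms generated by the rational powers of twists. -/
def twistGroup (g : ℕ) : Subgroup (hatAut g) :=
  Subgroup.closure {T | ∃ r γ, T = twist r γ}

theorem twist_mem (r : ℚ) (γ : Pi1 g) : twist r γ ∈ twistGroup g :=
  Subgroup.subset_closure ⟨r, γ, rfl⟩

theorem exists_common_den (c : Gen g → ℚ) :
    ∃ (D : ℚ) (z : Gen g → ℤ), D ≠ 0 ∧ ∀ x, (z x : ℚ) = D * c x := by
  have h : ∀ x, ∃ z : ℤ, (z : ℚ) = ((∏ y, (c y).den : ℕ) : ℚ) * c x := by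
    intro x
    obtain ⟨k, hk⟩ := Finset.dvd_prod_of_mem (fun y => (c y).den) (Finset.mem_univ x)
    refine ⟨k * (c x).num, ?_⟩
    rw [hk]
    push_cast
    rw [mul_right_comm, Rat.den_mul_eq_num, mul_comm]
  choose z hz using h
  refine ⟨_, z, ?_, hz⟩
  exact_mod_cast Finset.prod_ne_zero_iff.mpr fun y _ => (c y).den_ne_zero

/-- Every product of transvections is induced by a product of twists. -/
theorem exists_twist_of_mem_transvMonoid {τ : Module.End ℚ (Gen g → ℚ)}
    (hτ : τ ∈ transvMonoid (hform g)) :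
    ∃ T ∈ twistGroup g, ∀ h, hvec (T.1 h) = τ (hvec h) := by
  induction hτ using Submonoid.closure_induction with
  | mem t ht =>
    obtain ⟨c, s, rfl⟩ := ht
    obtain ⟨D, z, hD, hz⟩ := exists_common_den c
    obtain ⟨γ, hγ⟩ := exists_hcoef_eq z
    refine ⟨_, twist_mem (s / (2 * D ^ 2)) γ, fun h => ?_⟩
    have e : (fun x => hcoef x (pt γ)) = D • c := funext fun x => by
      rw [hγ, hz]; rfl
    rw [hvec_twist, e, transv_apply, transv_apply, map_smul, smul_smul, smul_eq_mul]
    congr 2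
    field_simp
  | one => exact ⟨1, one_mem _, fun _ => rfl⟩
  | mul s t _ _ hs ht =>
    obtain ⟨S, hS, hS'⟩ := hs
    obtain ⟨T, hT, hT'⟩ := ht
    refine ⟨S * T, mul_mem hS hT, fun h => ?_⟩
    rw [Module.End.mul_apply, ← hT', ← hS']
    rfl

end Homology

/-! ### The image of the boundary element -/

section Boundary

variable {g : ℕ}

/-- The inclusion of the Malcev completion, as a homomorphism of monoids. -/
def malcevHom (g : ℕ) : malcev g →* Hat g := (Units.coeHom _).comp (malcev g).subtype

theorem map_boundary (φ : Pi1 g →* malcev g) :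
    malcevVal (φ (boundary g)) = (List.ofFn fun i : Fin g =>
      malcevVal (φ (FreeGroup.of (Sum.inl i)) * φ (FreeGroup.of (Sum.inr i)) *
        (φ (FreeGroup.of (Sum.inl i)))⁻¹ * (φ (FreeGroup.of (Sum.inr i)))⁻¹)).prod := by
  change ((malcevHom g).comp φ) (boundary g) = _
  rw [boundary, map_list_prod, List.map_ofFn]
  congr 2
  funext i
  simp only [Function.comp_apply, MonoidHom.comp_apply, map_mul φ, map_inv φ]
  rfl

theorem prod_ofFn_congr {N n : ℕ} (hN : 2 ≤ N) (c d E : Fin n → Hat g)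
    (hd : ∀ i, d i - 1 ∈ filt g 1) (hE : ∀ i, E i ∈ filt g (N - 1))
    (h : ∀ i, c i - d i - E i ∈ filt g N) :
    (List.ofFn d).prod - 1 ∈ filt g 1 ∧
      (List.ofFn c).prod - (List.ofFn d).prod - ∑ i, E i ∈ filt g N := by
  induction n with
  | zero => simp
  | succ n ih =>
    obtain ⟨h1, h2⟩ := ih (fun i => c i.succ) (fun i => d i.succ) (fun i => E i.succ)
      (fun i => hd _) (fun i => hE _) (fun i => h _)
    rw [List.ofFn_succ, List.ofFn_succ, List.prod_cons, List.prod_cons, Fin.sum_univ_succ]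
    set c' := (List.ofFn fun i => c i.succ).prod
    set d' := (List.ofFn fun i => d i.succ).prod
    set E' := ∑ i : Fin n, E i.succ with hE'
    have hE'm : E' ∈ filt g (N - 1) := sum_mem fun i _ => hE _
    constructor
    · have := mul_congr_filt (x' := (1 : Hat g)) (y' := (1 : Hat g)) (hd 0) h1
      rwa [mul_one] at this
    · have hc0 : c 0 - 1 ∈ filt g 1 := by
        have h3 := add_mem (add_mem (filt_anti (by omega : 1 ≤ N) (h 0))
          (filt_anti (by omega : 1 ≤ N - 1) (hE 0))) (hd 0)
        convert h3 using 1
        abel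
      have k1 := filt_mul_right d' (h 0)
      have k2 := filt_mul_left (c 0) h2
      have k3 := mul_mem_filt (k := N) (hE 0) h1 (by omega)
      have k4 := mul_mem_filt (k := N) hc0 hE'm (by omega)
      convert add_mem (add_mem k1 k2) (add_mem k3 k4) using 1
      simp only [sub_mul, mul_sub, one_mul, mul_one]
      abel

/-- The leading term of a commutator. -/
theorem commutator_congr {p q : malcev g} {P Q : Hat g} (hP : P ∈ filt g 1) (hQ : Q ∈ filt g 1)
    (hp : malcevVal p - 1 - P ∈ filt g 2) (hq : malcevVal q - 1 - Q ∈ filt g 2) :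
    malcevVal (p * q * p⁻¹ * q⁻¹) - 1 - (P * Q - Q * P) ∈ filt g 3 := by
  have hp1 := malcevVal_sub_one_mem p
  have hq1 := malcevVal_sub_one_mem q
  have hi := malcevVal_sub_one_mem (p⁻¹ * q⁻¹)
  have e1 : malcevVal (p * q * p⁻¹ * q⁻¹) - 1 =
      (malcevVal p * malcevVal q - malcevVal q * malcevVal p) * malcevVal (p⁻¹ * q⁻¹) := by
    rw [sub_mul, ← malcevVal_mul, ← malcevVal_mul, ← malcevVal_mul, ← malcevVal_mul,
      show q * p * (p⁻¹ * q⁻¹) = 1 by group, malcevVal_one, mul_assoc _ p⁻¹]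
  have k1 : (malcevVal p - 1 - P) * (malcevVal q - 1) ∈ filt g 3 := mul_mem_filt hp hq1 le_rfl
  have k2 : P * (malcevVal q - 1 - Q) ∈ filt g 3 := mul_mem_filt hP hq le_rfl
  have k3 : (malcevVal q - 1 - Q) * (malcevVal p - 1) ∈ filt g 3 := mul_mem_filt hq hp1 le_rfl
  have k4 : Q * (malcevVal p - 1 - P) ∈ filt g 3 := mul_mem_filt hQ hp le_rfl
  have k5 := sub_mem (add_mem k1 k2) (add_mem k3 k4)
  have e2 : (malcevVal p - 1 - P) * (malcevVal q - 1) + P * (malcevVal q - 1 - Q) -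
      ((malcevVal q - 1 - Q) * (malcevVal p - 1) + Q * (malcevVal p - 1 - P)) =
      malcevVal p * malcevVal q - malcevVal q * malcevVal p - (P * Q - Q * P) := by
    simp only [sub_mul, mul_sub, one_mul, mul_one]
    abel
  rw [e2] at k5
  have k6 : malcevVal p * malcevVal q - malcevVal q * malcevVal p ∈ filt g 2 := by
    have h1 := sub_mem (mul_mem_filt (k := 2) hP hQ le_rfl) (mul_mem_filt (k := 2) hQ hP le_rfl)
    have := add_mem (filt_anti (by omega) k5) h1
    rwa [sub_add_cancel] at this
  have k7 := mul_mem_filt (k := 3) k6 hi le_rfl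
  rw [mul_sub, mul_one] at k7
  rw [e1]
  convert add_mem k7 k5 using 1
  abel

end Boundary

section Homology

variable {g : ℕ}

theorem coef_pair_mul (p q : Gen g → ℚ) (y z : Gen g) :
    coef [z, y] ((∑ x, p x • gX x) * ∑ x, q x • gX x) = p y * q z := by
  rw [Finset.mul_sum, map_sum, Finset.sum_eq_single z]
  · rw [mul_smul_comm, map_smul, coef_cons_mul_gX, if_pos rfl, map_sum, Finset.sum_eq_single y]
    · rw [map_smul, ← one_mul (gX y), coef_cons_mul_gX, if_pos rfl]
      change q z • p y • (aug g) 1 = _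
      rw [map_one, smul_eq_mul, smul_eq_mul]; ring
    · intro x _ hx
      rw [map_smul, ← one_mul (gX x), coef_cons_mul_gX, if_neg hx, smul_zero]
    · intro h; exact absurd (Finset.mem_univ y) h
  · intro x _ hx
    rw [mul_smul_comm, map_smul, coef_cons_mul_gX, if_neg hx, smul_zero]
  · intro h; exact absurd (Finset.mem_univ z) h

theorem sub_hat_hvec_mem (y : malcev g) :
    malcevVal y - 1 - hat g (∑ x, hvec (malcevVal y) x • gX x) ∈ filt g 2 := by
  obtain ⟨a, ha⟩ := exists_sub_hat_mem (malcevVal y) 2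
  have h1 : a - 1 ∈ augPow g 1 := by
    have := sub_mem (malcevVal_sub_one_mem y) (filt_anti (by omega : 1 ≤ 2) ha)
    rw [← hat_mem_filt, map_sub, map_one]
    rwa [sub_sub_sub_cancel_left] at this
  have h2 := sub_sum_hcoef_mem h1
  have e : ∑ x, hcoef x (a - 1) • gX x = ∑ x, hvec (malcevVal y) x • gX x := by
    refine Finset.sum_congr rfl fun x _ => ?_
    rw [hvec_eq ha, map_sub, hcoef_one, sub_zero]
  rw [e, ← hat_mem_filt, map_sub, map_sub, map_one] at h2
  have := add_mem ha h2
  convert this using 1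
  abel

/-- An element of the generalized mapping class group acts on homology by a symplectic map. -/
theorem hform_hvec (w : GenMCG g) (x y : Gen g) :
    hform g (hvec (malcevVal (w.1 (toMalcev g (FreeGroup.of x)))))
      (hvec (malcevVal (w.1 (toMalcev g (FreeGroup.of y))))) = stdForm x y := by
  let L (w : GenMCG g) (x : Gen g) : GrpAlg g :=
    ∑ y, hvec (malcevVal (w.1 (toMalcev g (FreeGroup.of x)))) y • gX y
  have hL : ∀ w x, L w x ∈ augPow g 1 := fun w x =>
    sum_mem fun y _ => augPow_smul _ (gX_mem y)
  let S (w : GenMCG g) : GrpAlg g := ∑ i, (L w (Sum.inl i) * L w (Sum.inr i) -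
    L w (Sum.inr i) * L w (Sum.inl i))
  have h1 : ∀ w : GenMCG g, malcevVal (w.1 (toMalcev g (boundary g))) - 1 - hat g (S w) ∈
      filt g 3 := by
    intro w
    have h2 := map_boundary (w.1.toMonoidHom.comp (toMalcev g))
    have h3 := (prod_ofFn_congr (g := g) (N := 3) (by omega) _ (fun _ : Fin g => 1)
      (fun i => hat g (L w (Sum.inl i)) * hat g (L w (Sum.inr i)) -
        hat g (L w (Sum.inr i)) * hat g (L w (Sum.inl i)))
      (fun i => by rw [sub_self]; exact zero_mem _)
      (fun i => sub_mem
        (mul_mem_filt (hat_mem_filt.mpr (hL w _)) (hat_mem_filt.mpr (hL w _)) le_rfl)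
        (mul_mem_filt (hat_mem_filt.mpr (hL w _)) (hat_mem_filt.mpr (hL w _)) le_rfl))
      (fun i => commutator_congr (hat_mem_filt.mpr (hL w (Sum.inl i)))
        (hat_mem_filt.mpr (hL w (Sum.inr i))) (sub_hat_hvec_mem _) (sub_hat_hvec_mem _))).2
    have h4 : (List.ofFn fun _ : Fin g => (1 : Hat g)).prod = 1 := by simp
    rw [h4] at h3
    have h5 : hat g (S w) = ∑ i : Fin g, (hat g (L w (Sum.inl i)) * hat g (L w (Sum.inr i)) -
        hat g (L w (Sum.inr i)) * hat g (L w (Sum.inl i))) := by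
      simp only [S, map_sum, map_sub, map_mul]
    rw [h5]
    change malcevVal ((w.1.toMonoidHom.comp (toMalcev g)) (boundary g)) - 1 - _ ∈ _
    rw [h2]
    exact h3
  have hb := h1 w
  have hb1 : malcevVal (toMalcev g (boundary g)) - 1 - hat g (S 1) ∈ filt g 3 := h1 1
  rw [w.2.2] at hb
  have h2 : S w - S 1 ∈ augPow g 3 := by
    have := sub_mem hb1 hb
    rw [← hat_mem_filt, map_sub]
    convert this using 1
    rw [sub_sub_sub_cancel_left]
  have hcoefS : ∀ (w : GenMCG g) y z, coef [z, y] (S w) =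
      ∑ i, (hvec (malcevVal (w.1 (toMalcev g (FreeGroup.of (Sum.inl i))))) y *
        hvec (malcevVal (w.1 (toMalcev g (FreeGroup.of (Sum.inr i))))) z -
        hvec (malcevVal (w.1 (toMalcev g (FreeGroup.of (Sum.inr i))))) y *
        hvec (malcevVal (w.1 (toMalcev g (FreeGroup.of (Sum.inl i))))) z) := by
    intro w y z
    simp only [S, map_sum, map_sub]
    refine Finset.sum_congr rfl fun i _ => ?_
    rw [coef_pair_mul, coef_pair_mul]
  have hid : ∀ x y : Gen g, hvec (malcevVal ((1 : GenMCG g).1 (toMalcev g (FreeGroup.of x)))) y =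
      if x = y then 1 else 0 := fun x y => by
    change hvec (hat g (pt (FreeGroup.of x))) y = _
    rw [hvec_hat, ← hcoef_gX, gX, map_sub, hcoef_one, sub_zero]
  rw [hform_apply]
  refine symplectic_rows (M := fun x y => hvec (malcevVal (w.1 (toMalcev g (FreeGroup.of x)))) y)
    (fun y z => ?_) x y
  rw [← hcoefS, coef_congr [z, y] h2, hcoefS]
  simp only [hid]
  rcases y with i | i <;> rcases z with j | j <;> simp [stdForm]
  all_goals
    by_cases h : i = j
    · simp [h]
    · simp [h, Ne.symm h]

/-- Every element of the generalized mapping class group acts on homology as a product of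
twists. -/
theorem exists_twist_two (w : GenMCG g) : ∃ T ∈ twistGroup g, ∀ x,
    malcevVal ((hatAutToMCG g T * w).1 (toMalcev g (FreeGroup.of x))) -
      hat g (pt (FreeGroup.of x)) ∈ filt g 2 := by
  obtain ⟨τ, hτ, h⟩ := exists_transv_basis (ω := hform g) hform_self (hform_hvec w)
    (hform_hvec 1)
  obtain ⟨T, hT, hT'⟩ := exists_twist_of_mem_transvMonoid hτ
  refine ⟨T, hT, fun x => ?_⟩
  have h1 := sub_hat_hvec_mem ((hatAutToMCG g T * w).1 (toMalcev g (FreeGroup.of x)))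
  have h2 := sub_hat_hvec_mem (toMalcev g (FreeGroup.of x))
  have e : hvec (malcevVal ((hatAutToMCG g T * w).1 (toMalcev g (FreeGroup.of x)))) =
      hvec (malcevVal (toMalcev g (FreeGroup.of x))) :=
    (hT' (malcevVal (w.1 (toMalcev g (FreeGroup.of x))))).trans (h x)
  rw [e] at h1
  have := sub_mem h1 h2
  rwa [sub_sub_sub_cancel_right, sub_sub_sub_cancel_right] at this

end Homology

/-! ### Leading terms of automorphisms that are trivial up to a given order -/

section LeadingAut

variable {g : ℕ}

theorem malcev_inv_congr {n : ℕ} {p a : malcev g} (h : malcevVal p - malcevVal a ∈ filt g n) :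
    malcevVal p⁻¹ - malcevVal a⁻¹ ∈ filt g n := by
  have := neg_mem (filt_mul_right (malcevVal a⁻¹) (filt_mul_left (malcevVal p⁻¹) h))
  rwa [mul_sub, sub_mul, malcevVal_inv_mul, one_mul, mul_assoc, malcevVal_mul_inv, mul_one,
    neg_sub] at this

set_option maxHeartbeats 1000000 in
/-- The first order variation of a commutator. -/
theorem commutator_sub_congr {n : ℕ} (hn : 2 ≤ n) {p q a b : malcev g}
    (hp : malcevVal p - malcevVal a ∈ filt g n) (hq : malcevVal q - malcevVal b ∈ filt g n) :
    malcevVal (p * q * p⁻¹ * q⁻¹) - malcevVal (a * b * a⁻¹ * b⁻¹) -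
      ((malcevVal p - malcevVal a) * (malcevVal b - 1) -
        (malcevVal b - 1) * (malcevVal p - malcevVal a) +
        ((malcevVal a - 1) * (malcevVal q - malcevVal b) -
          (malcevVal q - malcevVal b) * (malcevVal a - 1))) ∈ filt g (n + 2) := by
  have e1 : ∀ p q : malcev g, malcevVal (p * q * p⁻¹ * q⁻¹) - 1 =
      (malcevVal p * malcevVal q - malcevVal q * malcevVal p) * malcevVal (p⁻¹ * q⁻¹) := by
    intro p q
    rw [sub_mul, ← malcevVal_mul, ← malcevVal_mul, ← malcevVal_mul, ← malcevVal_mul,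
      show q * p * (p⁻¹ * q⁻¹) = 1 by group, malcevVal_one, mul_assoc _ p⁻¹]
  have ha := malcevVal_sub_one_mem a
  have hb := malcevVal_sub_one_mem b
  have hi := malcevVal_sub_one_mem (p⁻¹ * q⁻¹)
  have h1 := e1 p q
  have h2 := e1 a b
  have hinv : malcevVal (p⁻¹ * q⁻¹) - malcevVal (a⁻¹ * b⁻¹) ∈ filt g n :=
    mul_congr_filt (malcev_inv_congr hp) (malcev_inv_congr hq)
  have hab : malcevVal a * malcevVal b - malcevVal b * malcevVal a ∈ filt g 2 := by
    have := sub_mem (mul_mem_filt (k := 2) ha hb le_rfl) (mul_mem_filt (k := 2) hb ha le_rfl)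
    convert this using 1
    simp only [sub_mul, mul_sub, one_mul, mul_one]
    abel
  set X := malcevVal p - malcevVal a with hX
  set Y := malcevVal q - malcevVal b with hY
  set E := X * (malcevVal b - 1) - (malcevVal b - 1) * X +
    ((malcevVal a - 1) * Y - Y * (malcevVal a - 1)) with hE
  have hEm : E ∈ filt g (n + 1) :=
    add_mem (sub_mem (mul_mem_filt hp hb le_rfl) (mul_mem_filt hb hp (by omega)))
      (sub_mem (mul_mem_filt ha hq (by omega)) (mul_mem_filt hq ha le_rfl))
  have hXY : X * Y - Y * X ∈ filt g (n + 2) :=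
    sub_mem (mul_mem_filt hp hq (by omega)) (mul_mem_filt hq hp (by omega))
  have e2 : malcevVal p * malcevVal q - malcevVal q * malcevVal p =
      malcevVal a * malcevVal b - malcevVal b * malcevVal a + E + (X * Y - Y * X) := by
    rw [hE, hX, hY]
    simp only [sub_mul, mul_sub, one_mul, mul_one]
    abel
  have k1 := mul_mem_filt (k := n + 2) hEm hi le_rfl
  have k2 := filt_mul_right (malcevVal (p⁻¹ * q⁻¹)) hXY
  have k3 := mul_mem_filt (k := n + 2) hab hinv (by omega)
  have e3 : malcevVal (p * q * p⁻¹ * q⁻¹) - malcevVal (a * b * a⁻¹ * b⁻¹) =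
      (malcevVal p * malcevVal q - malcevVal q * malcevVal p) * malcevVal (p⁻¹ * q⁻¹) -
      (malcevVal a * malcevVal b - malcevVal b * malcevVal a) * malcevVal (a⁻¹ * b⁻¹) := by
    rw [← h1, ← h2, sub_sub_sub_cancel_right]
  rw [e3, e2]
  convert add_mem (add_mem k1 k2) k3 using 1
  simp only [add_mul, mul_sub, mul_one]
  abel

/-- The leading term of the displacement of a generator is primitive. -/
theorem exists_displacement {n : ℕ} (hn : 1 ≤ n) (w : GenMCG g) (x : Gen g)
    (h : malcevVal (w.1 (toMalcev g (FreeGroup.of x))) - hat g (pt (FreeGroup.of x)) ∈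
      filt g n) : ∃ b ∈ augPow g n,
    malcevVal (w.1 (toMalcev g (FreeGroup.of x))) - hat g (pt (FreeGroup.of x)) - hat g b ∈
      filt g (n + 1) ∧ comul g b - b ⊗ₜ[ℚ] 1 - 1 ⊗ₜ[ℚ] b ∈ tensPow g (n + 1) := by
  set p := w.1 (toMalcev g (FreeGroup.of x))
  set a := toMalcev g (FreeGroup.of x) with ha
  have e : malcevVal (p * a⁻¹) - 1 = (malcevVal p - malcevVal a) * malcevVal a⁻¹ := by
    rw [sub_mul, malcevVal_mul_inv, malcevVal_mul]
  obtain ⟨b, hb, h1, h2⟩ := exists_primitive_leading hn (p * a⁻¹) (by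
    rw [e]; exact filt_mul_right _ h)
  refine ⟨b, hb, ?_, h2⟩
  have h3 := filt_mul_right (malcevVal a) h1
  have h4 := mul_mem_filt (k := n + 1) (hat_mem_filt.mpr hb) (malcevVal_sub_one_mem a) le_rfl
  rw [e, sub_mul, mul_assoc, malcevVal_inv_mul, mul_one] at h3
  have := add_mem h3 h4
  rw [mul_sub, mul_one] at this
  convert this using 1
  rw [sub_add_sub_cancel]
  rfl

set_option maxHeartbeats 1000000 in
/-- The condition on the leading terms of the displacements of the generators that comes from the
boundary element. -/
theorem sum_displacement_mem {n : ℕ} (hn : 2 ≤ n) (w : GenMCG g) {y : Gen g → GrpAlg g}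
    (hy : ∀ x, y x ∈ augPow g n)
    (h : ∀ x, malcevVal (w.1 (toMalcev g (FreeGroup.of x))) - hat g (pt (FreeGroup.of x)) -
      hat g (y x) ∈ filt g (n + 1)) :
    ∑ i : Fin g, (y (Sum.inl i) * gX (Sum.inr i) - gX (Sum.inr i) * y (Sum.inl i) +
      (gX (Sum.inl i) * y (Sum.inr i) - y (Sum.inr i) * gX (Sum.inl i))) ∈ augPow g (n + 2) := by
  have h0 : ∀ x, malcevVal (w.1 (toMalcev g (FreeGroup.of x))) -
      malcevVal (toMalcev g (FreeGroup.of x)) ∈ filt g n := fun x => by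
    have := add_mem (filt_anti (Nat.le_succ n) (h x)) (hat_mem_filt.mpr (hy x))
    rwa [sub_add_cancel] at this
  let E (i : Fin g) : GrpAlg g := y (Sum.inl i) * gX (Sum.inr i) - gX (Sum.inr i) * y (Sum.inl i) +
      (gX (Sum.inl i) * y (Sum.inr i) - y (Sum.inr i) * gX (Sum.inl i))
  have hE : ∀ i, E i ∈ augPow g (n + 1) := fun i =>
    add_mem (sub_mem (mul_mem_augPow_of_le (hy _) (gX_mem _) le_rfl)
      (mul_mem_augPow_of_le (gX_mem _) (hy _) (by omega)))
      (sub_mem (mul_mem_augPow_of_le (gX_mem _) (hy _) (by omega))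
        (mul_mem_augPow_of_le (hy _) (gX_mem _) le_rfl))
  have hstep : ∀ i : Fin g,
      malcevVal (w.1 (toMalcev g (FreeGroup.of (Sum.inl i))) *
        w.1 (toMalcev g (FreeGroup.of (Sum.inr i))) *
        (w.1 (toMalcev g (FreeGroup.of (Sum.inl i))))⁻¹ *
        (w.1 (toMalcev g (FreeGroup.of (Sum.inr i))))⁻¹) -
      malcevVal (toMalcev g (FreeGroup.of (Sum.inl i)) *
        toMalcev g (FreeGroup.of (Sum.inr i)) *
        (toMalcev g (FreeGroup.of (Sum.inl i)))⁻¹ *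
        (toMalcev g (FreeGroup.of (Sum.inr i)))⁻¹) - hat g (E i) ∈ filt g (n + 2) := by
    intro i
    have h1 := commutator_sub_congr hn (h0 (Sum.inl i)) (h0 (Sum.inr i))
    have hX : ∀ x : Gen g, malcevVal (toMalcev g (FreeGroup.of x)) - 1 = hat g (gX x) := fun x => by
      rw [malcevVal_toMalcev, gX, map_sub, map_one]
    rw [hX, hX] at h1
    have hXm : ∀ x : Gen g, hat g (gX x) ∈ filt g 1 := fun x => hat_mem_filt.mpr (gX_mem x)
    have k1 := mul_mem_filt (k := n + 2) (h (Sum.inl i)) (hXm (Sum.inr i)) le_rfl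
    have k2 := mul_mem_filt (k := n + 2) (hXm (Sum.inr i)) (h (Sum.inl i)) (by omega)
    have k3 := mul_mem_filt (k := n + 2) (hXm (Sum.inl i)) (h (Sum.inr i)) (by omega)
    have k4 := mul_mem_filt (k := n + 2) (h (Sum.inr i)) (hXm (Sum.inl i)) le_rfl
    convert add_mem h1 (add_mem (sub_mem k1 k2) (sub_mem k3 k4)) using 1
    simp only [E, map_add, map_sub, map_mul, malcevVal_toMalcev]
    simp only [sub_mul, mul_sub]
    abel
  have h1 := (prod_ofFn_congr (N := n + 2) (by omega) _ _ (fun i => hat g (E i))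
    (fun i => malcevVal_sub_one_mem _) (fun i => hat_mem_filt.mpr (hE i)) hstep).2
  have e1 := map_boundary (w.1.toMonoidHom.comp (toMalcev g))
  have e2 := map_boundary (toMalcev g)
  have e3 : (w.1.toMonoidHom.comp (toMalcev g)) (boundary g) = toMalcev g (boundary g) := w.2.2
  rw [e3] at e1
  rw [← e2] at h1
  have h2 : malcevVal (toMalcev g (boundary g)) - malcevVal (toMalcev g (boundary g)) -
      ∑ i, hat g (E i) ∈ filt g (n + 2) := by
    nth_rw 1 [e1]
    exact h1
  rw [sub_self, zero_sub, neg_mem_iff, ← map_sum, hat_mem_filt] at h2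
  exact h2

set_option maxHeartbeats 1000000 in
/-- The leading terms of the displacements of the generators are those of the action of a
combination of free loops. -/
theorem exists_displacement_eq {n : ℕ} (hn : 2 ≤ n) (w : GenMCG g)
    (h : ∀ x, malcevVal (w.1 (toMalcev g (FreeGroup.of x))) - hat g (pt (FreeGroup.of x)) ∈
      filt g n) : ∃ c : Gen g × Word g n → ℚ, ∀ x,
      malcevVal (w.1 (toMalcev g (FreeGroup.of x))) - hat g (pt (FreeGroup.of x)) -
        hat g (∑ p, c p • sigmaL (gX p.1 * lieMono p.2.1) (pt (FreeGroup.of x))) ∈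
          filt g (n + 1) := by
  choose y hy hy1 hy2 using fun x => exists_displacement (by omega : 1 ≤ n) w x (h x)
  have hsum := sum_displacement_mem hn w hy hy1
  -- The boundary condition says that `Z = ∑ (x - 1) z_x`, with `z` dual to `y` for the intersection
  -- form, is cyclically symmetric. The action of `Z` then has leading terms `(n + 1) y_x`.
  let z : Gen g → GrpAlg g := Sum.elim (fun i => - y (Sum.inr i)) fun i => y (Sum.inl i)
  have hz : ∀ x, z x ∈ augPow g n := by
    rintro (i | i)
    · exact neg_mem (hy _)
    · exact hy _
  have hzL : ∀ x, (n : ℚ) • z x - ∑ v : Word g n, coef v.1 (z x) • lieMono v.1 ∈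
      augPow g (n + 1) := by
    rintro (i | i)
    · have := neg_mem (smul_sub_sum_lieMono_mem (hy (Sum.inr i)) (hy2 (Sum.inr i)))
      convert this using 1
      simp only [z, Sum.elim_inl, map_neg, smul_neg, neg_smul, Finset.sum_neg_distrib]
      abel
    · exact smul_sub_sum_lieMono_mem (hy (Sum.inl i)) (hy2 (Sum.inl i))
  have hzc : ∑ x, (gX x * z x - z x * gX x) ∈ augPow g (n + 2) := by
    have := neg_mem hsum
    convert this using 1
    rw [Fintype.sum_sum_type, ← Finset.sum_add_distrib, ← Finset.sum_neg_distrib]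
    refine Finset.sum_congr rfl fun i _ => ?_
    simp only [z, Sum.elim_inl, Sum.elim_inr, mul_neg, neg_mul]
    abel
  set Z := ∑ x, gX x * z x with hZ
  have hZm : Z ∈ augPow g (n + 1) := sum_mem fun x _ => mul_mem_augPow_of_le (gX_mem x) (hz x)
    (by omega)
  have hcyc := cyc_sum_congr z hz hzc
  have hσ : ∀ x, sigmaL Z (pt (FreeGroup.of x)) - ((n : ℚ) + 1) • y x ∈ augPow g (n + 1) := by
    rintro (i | i)
    · have := add_mem (sigmaL_inl_congr i hZm) (hcyc (Sum.inr i))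
      rwa [sub_add_sub_cancel] at this
    · have := sub_mem (sigmaL_inr_congr i hZm) (hcyc (Sum.inl i))
      convert this using 1
      simp only [z, Sum.elim_inl, smul_neg]
      abel
  have hn0 : (n : ℚ) ≠ 0 := by positivity
  have hn1 : (n : ℚ) + 1 ≠ 0 := by positivity
  -- As the `z_x` are primitive, `Z` is a combination of free loops `(a - 1) L`, with brackets `L`.
  let Z' : GrpAlg g := ∑ p : Gen g × Word g n, ((n : ℚ)⁻¹ * coef p.2.1 (z p.1)) •
    (gX p.1 * lieMono p.2.1)
  have hZZ : Z - Z' ∈ augPow g (n + 2) := by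
    have hZ' : Z' = ∑ x, ∑ v : Word g n, ((n : ℚ)⁻¹ * coef v.1 (z x)) • (gX x * lieMono v.1) :=
      Fintype.sum_prod_type _
    rw [hZ, hZ', ← Finset.sum_sub_distrib]
    refine sum_mem fun x _ => ?_
    have := augPow_smul (n : ℚ)⁻¹ (mul_mem_augPow_of_le (k := n + 2) (gX_mem x) (hzL x) (by omega))
    convert this using 1
    rw [mul_sub, smul_sub, mul_smul_comm, smul_smul, inv_mul_cancel₀ hn0, one_smul,
      Finset.mul_sum, Finset.smul_sum]
    congr 1
    refine Finset.sum_congr rfl fun v _ => ?_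
    rw [mul_smul_comm, smul_smul]
  have hσZ : ∀ x, sigmaL (Z - Z') (pt (FreeGroup.of x)) ∈ augPow g (n + 1) := fun x => by
    have := sigmaL_mem hZZ (gX_mem x) (k := n + 1) (by omega)
    rwa [gX, map_sub, (sigmaL_isDer _).map_one, sub_zero] at this
  refine ⟨fun p => ((n : ℚ) + 1)⁻¹ * ((n : ℚ)⁻¹ * coef p.2.1 (z p.1)), fun x => ?_⟩
  have e : ∑ p : Gen g × Word g n, (((n : ℚ) + 1)⁻¹ * ((n : ℚ)⁻¹ * coef p.2.1 (z p.1))) •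
      sigmaL (gX p.1 * lieMono p.2.1) (pt (FreeGroup.of x)) =
      ((n : ℚ) + 1)⁻¹ • sigmaL Z' (pt (FreeGroup.of x)) := by
    rw [map_sum, LinearMap.sum_apply, Finset.smul_sum]
    refine Finset.sum_congr rfl fun p _ => ?_
    rw [map_smul, LinearMap.smul_apply, smul_smul]
  have h1 := augPow_smul ((n : ℚ) + 1)⁻¹ (sub_mem (hσZ x) (hσ x))
  rw [← hat_mem_filt] at h1
  rw [e]
  convert add_mem (hy1 x) h1 using 1
  rw [map_sub sigmaL, LinearMap.sub_apply, smul_sub, smul_sub, smul_sub, smul_smul,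
    inv_mul_cancel₀ hn1, one_smul, map_sub, map_sub, map_sub]
  abel

end LeadingAut

/-! ### Coefficients of polynomial functions with values in a subgroup -/

section Polynomial

/-- If all values of a polynomial function without constant term lie in a subgroup, so do the
rational multiples of its linear coefficient. -/
theorem smul_linear_coeff_mem {M : Type*} [AddCommGroup M] [Module ℚ M] (S : AddSubgroup M)
    {ι : Type*} (d : ι → ℕ) (D : ℕ) (s : Finset ι) (c : ι → M)
    (hd : ∀ i ∈ s, 1 ≤ d i ∧ d i ≤ D + 1) (h : ∀ r : ℚ, ∑ i ∈ s, r ^ d i • c i ∈ S) (q : ℚ) :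
    q • ∑ i ∈ s with d i = 1, c i ∈ S := by
  induction D generalizing s c q with
  | zero =>
    have h1 := h q
    rw [Finset.filter_true_of_mem fun i hi => by have := hd i hi; omega, Finset.smul_sum]
    convert h1 using 1
    refine Finset.sum_congr rfl fun i hi => ?_
    rw [show d i = 1 by have := hd i hi; omega, pow_one]
  | succ D ih =>
    -- The combination `2 ^ (D + 2) p(r) - p(2 r)` has no term of degree `D + 2`.
    have h1 := ih (s.filter fun i => d i ≤ D + 1) (fun i => ((2 : ℚ) ^ (D + 2) - 2 ^ d i) • c i)
      (fun i hi => ⟨(hd i (Finset.mem_filter.mp hi).1).1, (Finset.mem_filter.mp hi).2⟩)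
      (fun r => by
        have h2 := sub_mem (S.nsmul_mem (h r) (2 ^ (D + 2))) (h (2 * r))
        convert h2 using 1
        rw [← Nat.cast_smul_eq_nsmul ℚ, Finset.smul_sum, ← Finset.sum_sub_distrib,
          Finset.sum_filter]
        refine Finset.sum_congr rfl fun i hi => ?_
        have e : ((2 ^ (D + 2) : ℕ) : ℚ) • r ^ d i • c i - (2 * r) ^ d i • c i =
            (r ^ d i) • ((2 : ℚ) ^ (D + 2) - 2 ^ d i) • c i := by
          rw [smul_smul, smul_smul, ← sub_smul]
          congr 1
          push_cast
          ring
        rw [e]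
        split_ifs with h3
        · rfl
        · rw [show d i = D + 2 by have := hd i hi; omega, sub_self, zero_smul, smul_zero])
      (q / ((2 : ℚ) ^ (D + 2) - 2))
    have h4 : ((2 : ℚ) ^ (D + 2) - 2) ≠ 0 := by
      have : (1 : ℚ) ≤ 2 ^ D := one_le_pow₀ (by norm_num)
      rw [pow_add]
      linarith
    convert h1 using 1
    rw [Finset.filter_filter, Finset.smul_sum, Finset.smul_sum]
    refine Finset.sum_congr (Finset.filter_congr fun i _ => by omega) fun i hi => ?_
    rw [(Finset.mem_filter.mp hi).2.2, pow_one, smul_smul, div_mul_cancel₀ _ h4]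

/-- The expansion of `exp (r a) exp (-r b)`, with linear coefficient `a - b`. -/
theorem exists_exp_mul_exp_expansion {R : Type*} [Ring R] [Algebra ℚ R] {a b : R}
    (ha : IsNilpotent a) (hb : IsNilpotent b) :
    ∃ (s : Finset (ℕ × ℕ)) (c : ℕ × ℕ → R) (D : ℕ),
      (∀ i ∈ s, 1 ≤ i.1 + i.2 ∧ i.1 + i.2 ≤ D + 1) ∧
      (∀ r : ℚ, IsNilpotent.exp (r • a) * IsNilpotent.exp ((-r) • b) =
        1 + ∑ i ∈ s, r ^ (i.1 + i.2) • c i) ∧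
      ∑ i ∈ s with i.1 + i.2 = 1, c i = a - b := by
  obtain ⟨k, hk⟩ := ha
  obtain ⟨l, hl⟩ := hb
  set K := k + l + 2 with hK
  let c : ℕ × ℕ → R := fun i =>
    (((i.1.factorial : ℚ)⁻¹ * (i.2.factorial : ℚ)⁻¹) * (-1) ^ i.2) • (a ^ i.1 * b ^ i.2)
  have h0 : (0, 0) ∈ Finset.range K ×ˢ Finset.range K := by simp [hK]
  refine ⟨(Finset.range K ×ˢ Finset.range K).erase (0, 0), c, 2 * K, fun i hi => ?_, fun r => ?_,
    ?_⟩
  · obtain ⟨h1, h2⟩ := Finset.mem_erase.mp hi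
    obtain ⟨h3, h4⟩ := Finset.mem_product.mp h2
    rw [Finset.mem_range] at h3 h4
    refine ⟨?_, by omega⟩
    by_contra h5
    exact h1 (Prod.ext (by omega) (by omega))
  · have e1 : (r • a) ^ K = 0 := by
      rw [smul_pow, pow_eq_zero_of_le (by omega : k ≤ K) hk, smul_zero]
    have e2 : ((-r) • b) ^ K = 0 := by
      rw [smul_pow, pow_eq_zero_of_le (by omega : l ≤ K) hl, smul_zero]
    have e3 : (1 : R) = r ^ (0 + 0) • c (0, 0) := by simp [c]
    rw [IsNilpotent.exp_eq_sum e1, IsNilpotent.exp_eq_sum e2, Finset.sum_mul_sum,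
      ← Finset.sum_product', e3]
    rw [Finset.add_sum_erase _ (fun i : ℕ × ℕ => r ^ (i.1 + i.2) • c i) h0]
    refine Finset.sum_congr rfl fun i _ => ?_
    simp only [c, smul_pow, smul_mul_smul_comm, smul_smul]
    congr 1
    rw [neg_pow, pow_add]
    ring
  · have e : ((Finset.range K ×ˢ Finset.range K).erase (0, 0)).filter (fun i => i.1 + i.2 = 1) =
        {(1, 0), (0, 1)} := by
      ext ⟨i, j⟩
      simp only [Finset.mem_filter, Finset.mem_erase, Finset.mem_product, Finset.mem_range,
        Finset.mem_insert, Finset.mem_singleton, Prod.mk.injEq, ne_eq]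
      omega
    rw [e, Finset.sum_pair (by simp)]
    simp [c, sub_eq_add_neg]

end Polynomial

/-! ### Realization of leading terms by twists -/

section Realization

variable {g : ℕ}

theorem hatAut_mem_filt (T : hatAut g) {m : ℕ} {h : Hat g} (hh : h ∈ filt g m) :
    T.1 h ∈ filt g m := (T.2.1 m h).mpr hh

set_option maxHeartbeats 1000000 in
/-- An automorphism that is trivial modulo `I ^ 2` on the generators acts trivially on the quotients
of the filtration. -/
theorem hatAut_sub_mem {T : hatAut g}
    (hT : ∀ x, T.1 (hat g (pt (FreeGroup.of x))) - hat g (pt (FreeGroup.of x)) ∈ filt g 2)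
    {j : ℕ} {h : Hat g} (hh : h ∈ filt g j) : T.1 h - h ∈ filt g (j + 1) := by
  have hX : ∀ x, T.1 (hat g (gX x)) - hat g (gX x) ∈ filt g 2 := fun x => by
    have e : T.1 (hat g (gX x)) - hat g (gX x) =
        T.1 (hat g (pt (FreeGroup.of x))) - hat g (pt (FreeGroup.of x)) := by
      rw [gX, map_sub, map_sub, map_one, map_one, sub_sub_sub_cancel_right]
    rw [e]; exact hT x
  let δ : GrpAlg g →ₗ[ℚ] Hat g :=
    T.1.toAlgHom.toLinearMap ∘ₗ (hat g).toLinearMap - (hat g).toLinearMap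
  have hδ : ∀ a, δ a = T.1 (hat g a) - hat g a := fun a => rfl
  have key : ∀ j, ∀ a ∈ augPow g j, δ a ∈ filt g (j + 1) := by
    intro j
    induction j with
    | zero =>
      intro a _
      have h1 : hat g (a - aug g a • 1) ∈ filt g 1 := hat_mem_filt.mpr (sub_aug_mem a)
      have h2 := sub_mem (hatAut_mem_filt T h1) h1
      have h3 : δ 1 = 0 := by rw [hδ, map_one, map_one, sub_self]
      rwa [← hδ, map_sub, map_smul, h3, smul_zero, sub_zero] at h2
    | succ j ih =>
      intro a ha
      refine augPow_succ_le
        (S := ((filt g (j + 2)).restrictScalars ℚ).comap δ) (fun b hb x => ?_) ha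
      change δ (b * gX x) ∈ filt g (j + 2)
      have h1 := mul_mem_filt (k := j + 2) (hatAut_mem_filt T (hat_mem_filt.mpr hb)) (hX x) le_rfl
      have h2 := mul_mem_filt (k := j + 2) (ih b hb) (hat_mem_filt.mpr (gX_mem x)) le_rfl
      have := add_mem h1 h2
      rwa [hδ b, mul_sub, sub_mul, sub_add_sub_cancel, ← map_mul (hat g), ← map_mul] at this
  obtain ⟨a, ha, h1⟩ := exists_mem_sub_hat_mem hh (Nat.le_succ j)
  have h2 := sub_mem (hatAut_mem_filt T h1) h1
  have h3 := add_mem h2 (key j a ha)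
  rw [hδ, map_sub] at h3
  convert h3 using 1
  abel

/-- The leading terms in degree `n` of the products of twists that are trivial up to this order. -/
def twistLead (g n : ℕ) (hn : 2 ≤ n) :
    AddSubgroup (Gen g → GrpAlg g ⧸ augIdeal (aug g) ^ (n + 1)) where
  carrier := {δ | ∃ T ∈ twistGroup g,
    (∀ x, T.1 (hat g (pt (FreeGroup.of x))) - hat g (pt (FreeGroup.of x)) ∈ filt g n) ∧
    ∀ x, (T.1 (hat g (pt (FreeGroup.of x))) - hat g (pt (FreeGroup.of x))).1 (n + 1) = δ x}
  zero_mem' := by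
    have h : ∀ x, (1 : hatAut g).1 (hat g (pt (FreeGroup.of x))) - hat g (pt (FreeGroup.of x)) =
        0 := fun x => sub_self _
    refine ⟨1, one_mem _, fun x => ?_, fun x => ?_⟩
    · rw [h]; exact zero_mem _
    · rw [h]; rfl
  add_mem' := by
    rintro δ ε ⟨S, hS, hS1, hS2⟩ ⟨T, hT, hT1, hT2⟩
    have e : ∀ x, (S * T).1 (hat g (pt (FreeGroup.of x))) - hat g (pt (FreeGroup.of x)) =
        (S.1 (hat g (pt (FreeGroup.of x))) - hat g (pt (FreeGroup.of x))) +
        (T.1 (hat g (pt (FreeGroup.of x))) - hat g (pt (FreeGroup.of x))) +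
        (S.1 (T.1 (hat g (pt (FreeGroup.of x))) - hat g (pt (FreeGroup.of x))) -
        (T.1 (hat g (pt (FreeGroup.of x))) - hat g (pt (FreeGroup.of x)))) := fun x => by
      rw [map_sub]
      change S.1 (T.1 _) - _ = _
      abel
    have h3 : ∀ x, _ ∈ filt g (n + 1) := fun x =>
      hatAut_sub_mem (T := S) (fun x => filt_anti hn (hS1 x)) (hT1 x)
    refine ⟨S * T, mul_mem hS hT, fun x => ?_, fun x => ?_⟩
    · rw [e]
      exact add_mem (add_mem (hS1 x) (hT1 x)) (filt_anti (Nat.le_succ n) (h3 x))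
    · rw [e]
      change (S.1 _ - _ : Hat g).1 (n + 1) + (T.1 _ - _ : Hat g).1 (n + 1) +
        (S.1 (T.1 _ - _) - _ : Hat g).1 (n + 1) = δ x + ε x
      rw [hS2, hT2, mem_filt.mp (h3 x), add_zero]
  neg_mem' := by
    rintro δ ⟨T, hT, hT1, hT2⟩
    have hT' : ∀ x, T⁻¹.1 (hat g (pt (FreeGroup.of x))) - hat g (pt (FreeGroup.of x)) =
        - T⁻¹.1 (T.1 (hat g (pt (FreeGroup.of x))) - hat g (pt (FreeGroup.of x))) := fun x => by
      rw [map_sub, hatAut_inv_apply', neg_sub]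
    have hT1' : ∀ x, T⁻¹.1 (hat g (pt (FreeGroup.of x))) - hat g (pt (FreeGroup.of x)) ∈
        filt g n := fun x => by
      rw [hT']; exact neg_mem (hatAut_mem_filt _ (hT1 x))
    refine ⟨T⁻¹, inv_mem hT, hT1', fun x => ?_⟩
    have h3 := mem_filt.mp
      (hatAut_sub_mem (T := T⁻¹) (fun x => filt_anti hn (hT1' x)) (hT1 x))
    rw [hT']
    change - (T⁻¹.1 (T.1 _ - _) : Hat g).1 (n + 1) = - δ x
    rw [← hT2]
    exact congrArg Neg.neg (sub_eq_zero.mp h3)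

theorem sigmaL_congr_of_cyc {u v : GrpAlg g} (h : ∀ x, cyc x u = cyc x v) :
    sigmaL u = sigmaL v := by
  refine (sigmaL_isDer u).ext (sigmaL_isDer v) fun x => ?_
  rw [sigmaL_of, sigmaL_of]
  simp only [crossSum_apply, h]

theorem sigmaL_mul_comm (a b : GrpAlg g) : sigmaL (a * b) = sigmaL (b * a) :=
  sigmaL_congr_of_cyc fun x => cyc_mul_comm x a b

theorem coeff_log_sq_two : PowerSeries.coeff 2 (PowerSeries.log ℚ ^ 2) = 1 := by
  have h := coeff_log_sq_succ 1
  rw [coeff_log_sq_one] at h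
  simp at h
  linarith

/-- The variation of `(log γ) ^ 2` when `γ = x` is replaced by `γ = x v`, for `v` of high order. -/
theorem logSqTrunc_mul_congr {n M : ℕ} (hn : 2 ≤ n) (hM : 3 ≤ M) (x : Gen g) {v : Pi1 g}
    (hv : pt v - 1 ∈ augPow g n) :
    logSqTrunc M (FreeGroup.of x * v) - logSqTrunc M (FreeGroup.of x) -
      (gX x * (pt v - 1) + (pt v - 1) * gX x) ∈ augPow g (n + 2) := by
  set E := pt v - 1 with hE
  set X := gX x with hX
  have hXm : X ∈ augPow g 1 := gX_mem x
  have hY : pt (FreeGroup.of x * v) - 1 = X + (E + X * E) := by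
    rw [hX, gX, hE, map_mul pt]; noncomm_ring
  have hF : E + X * E ∈ augPow g n := add_mem hv (augPow_mul_left _ hv)
  set F := E + X * E with hF'
  have hYm : X + F ∈ augPow g 1 := add_mem hXm (augPow_anti (by omega) hF)
  have hpow : ∀ j : ℕ, (X + F) ^ (j + 1) - X ^ (j + 1) ∈ augPow g (n + j) := by
    intro j
    induction j with
    | zero => rw [zero_add, pow_one, pow_one, add_sub_cancel_left]; exact hF
    | succ j ih =>
      have h1 := mul_mem_augPow_of_le (k := n + (j + 1)) (pow_mem_augPow hYm (j + 1)) hF (by omega)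
      have h2 := mul_mem_augPow_of_le (k := n + (j + 1)) ih hXm (by omega)
      convert add_mem h1 h2 using 1
      rw [pow_succ, pow_succ X]
      noncomm_ring
  have h2 : (X + F) ^ 2 - X ^ 2 - (X * E + E * X) ∈ augPow g (n + 2) := by
    have k1 := mul_mem_augPow_of_le (k := n + 2) (mul_mem_augPow hXm hXm) hv (by omega)
    have k2 := mul_mem_augPow_of_le (k := n + 2) (mul_mem_augPow hXm hv) hXm (by omega)
    have k3 := mul_mem_augPow_of_le (k := n + 2) hF hF (by omega)
    convert add_mem (add_mem k1 k2) k3 using 1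
    rw [hF']
    noncomm_ring
  have e : ∑ k ∈ Finset.range M, (if k = 2 then X * E + E * X else 0) = X * E + E * X := by
    rw [Finset.sum_ite_eq' (Finset.range M) 2 fun _ => X * E + E * X,
      if_pos (Finset.mem_range.mpr (by omega))]
  rw [← e, logSqTrunc, logSqTrunc, ← Finset.sum_sub_distrib, ← Finset.sum_sub_distrib, hY]
  refine sum_mem fun k _ => ?_
  rw [← smul_sub]
  change _ • ((X + F) ^ k - X ^ k) - _ ∈ _
  rcases k with _ | _ | _ | k
  · rw [coeff_log_sq_zero, zero_smul, if_neg (by omega), sub_zero]; exact zero_mem _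
  · rw [zero_add, coeff_log_sq_one, zero_smul, if_neg (by omega), sub_zero]; exact zero_mem _
  · rw [zero_add, coeff_log_sq_two, one_smul, if_pos (by omega)]; exact h2
  · rw [if_neg (by omega), sub_zero]
    exact augPow_smul _ (augPow_anti (by omega) (hpow (k + 2)))

theorem sigmaL_sub_mem {m : ℕ} {u u' : GrpAlg g} (h : u - u' ∈ augPow g (m + 1)) (a : GrpAlg g) :
    sigmaL u a - sigmaL u' a ∈ augPow g m := by
  have h1 := sigmaL_mem h (sub_aug_mem a) (k := m) (by omega)
  rwa [map_sub (sigmaL (u - u')), map_smul, (sigmaL_isDer _).map_one, smul_zero, sub_zero, map_sub,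
    LinearMap.sub_apply] at h1

/-- The leading terms given by the free loops `x L`, where `L` is a left-normed bracket, are
realized by products of twists along curves `x v` and `x`. -/
theorem smul_sigmaL_mem_twistLead {n : ℕ} (hn : 2 ≤ n) (x : Gen g) (w : Word g n) (q : ℚ) :
    (fun y => q • lvl (aug g) (n + 1) (sigmaL (gX x * lieMono w.1) (pt (FreeGroup.of y)))) ∈
      twistLead g n hn := by
  -- The bracket is the leading term of a commutator `v`.
  obtain ⟨v, hv, hvn⟩ : ∃ v : Pi1 g, pt v - 1 - lieMono w.1 ∈ augPow g (n + 1) ∧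
      lieMono w.1 ∈ augPow g n := by
    have h1 : w.1.length = n := w.2
    have h2 := grpComm_congr w.1 (by rintro h; rw [h] at h1; simp at h1; omega)
    have h3 := lieMono_mem w.1
    rw [h1] at h2 h3
    exact ⟨_, h2, h3⟩
  have hE : pt v - 1 ∈ augPow g n := by
    have := add_mem (augPow_anti (Nat.le_succ n) hv) hvn
    rwa [sub_add_cancel] at this
  have hu := logSqTrunc_mul_congr hn (by omega : 3 ≤ n + 4) x hE
  set γ := FreeGroup.of x * v with hγ
  have huu : logSqTrunc (n + 4) γ - logSqTrunc (n + 4) (FreeGroup.of x) ∈ augPow g (n + 1) := by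
    have h1 : gX x * (pt v - 1) + (pt v - 1) * gX x ∈ augPow g (n + 1) :=
      add_mem (mul_mem_augPow_of_le (gX_mem x) hE (by omega))
        (mul_mem_augPow_of_le hE (gX_mem x) (by omega))
    have := add_mem (augPow_anti (by omega) hu) h1
    rwa [sub_add_cancel] at this
  -- In order `n` the two twists agree.
  have hlev : twistLevel γ n = twistLevel (FreeGroup.of x) n := by
    refine LinearMap.ext fun p => ?_
    obtain ⟨a, rfl⟩ := lvl_surjective p
    rw [twistLevel_lvl γ (M := n + 4) (by omega), twistLevel_lvl _ (M := n + 4) (by omega), lvl_eq]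
    exact sigmaL_sub_mem huu a
  -- In order `n + 1` their derivations differ by the action of `2 x L`.
  have hdiff : ∀ y, (twistLevel γ (n + 1) - twistLevel (FreeGroup.of x) (n + 1))
      (lvl (aug g) (n + 1) (pt (FreeGroup.of y))) =
      (2 : ℚ) • lvl (aug g) (n + 1) (sigmaL (gX x * lieMono w.1) (pt (FreeGroup.of y))) := by
    intro y
    rw [LinearMap.sub_apply, twistLevel_lvl γ (M := n + 4) (by omega),
      twistLevel_lvl _ (M := n + 4) (by omega), ← map_sub, ← map_smul, lvl_eq]
    have h1 := sigmaL_sub_mem (m := n + 1) hu (pt (FreeGroup.of y))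
    have h2 : gX x * (pt v - 1) - gX x * lieMono w.1 ∈ augPow g (n + 2) := by
      rw [← mul_sub]; exact mul_mem_augPow_of_le (gX_mem x) hv (by omega)
    have h3 := augPow_smul 2 (sigmaL_sub_mem (m := n + 1) h2 (pt (FreeGroup.of y)))
    convert add_mem h1 h3 using 1
    rw [map_sub, map_add, LinearMap.add_apply, sigmaL_mul_comm (pt v - 1), LinearMap.sub_apply]
    module
  -- The values at the rational `r` are polynomial, and their linear coefficient is isolated.
  obtain ⟨s, c, D, hs, hc, hc1⟩ := exists_exp_mul_exp_expansion
    (isNilpotent_twistLevel γ (n + 1)) (isNilpotent_twistLevel (FreeGroup.of x) (n + 1))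
  have hval : ∀ r : ℚ, ∑ i ∈ s, r ^ (i.1 + i.2) •
      (fun y => c i (lvl (aug g) (n + 1) (pt (FreeGroup.of y)))) ∈ twistLead g n hn := by
    intro r
    refine ⟨twist r γ * twist (-r) (FreeGroup.of x), mul_mem (twist_mem _ _) (twist_mem _ _),
      fun y => ?_, fun y => ?_⟩
    · rw [mem_filt]
      change IsNilpotent.exp (r • twistLevel γ n)
        (IsNilpotent.exp ((-r) • twistLevel (FreeGroup.of x) n)
          (lvl (aug g) n (pt (FreeGroup.of y)))) - lvl (aug g) n (pt (FreeGroup.of y)) = 0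
      rw [hlev, sub_eq_zero]
      exact LinearMap.congr_fun (exp_smul_mul_exp_neg_smul
        (isNilpotent_twistLevel (FreeGroup.of x) n) r) _
    · change (IsNilpotent.exp (r • twistLevel γ (n + 1)) *
        IsNilpotent.exp ((-r) • twistLevel (FreeGroup.of x) (n + 1)))
          (lvl (aug g) (n + 1) (pt (FreeGroup.of y))) -
          lvl (aug g) (n + 1) (pt (FreeGroup.of y)) = _
      rw [hc, LinearMap.add_apply, Module.End.one_apply, add_sub_cancel_left, LinearMap.sum_apply,
        Finset.sum_apply]
      rfl
  have h4 := smul_linear_coeff_mem (twistLead g n hn) (fun i : ℕ × ℕ => i.1 + i.2) D s _ hs hval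
    (q / 2)
  convert h4 using 1
  funext y
  rw [Pi.smul_apply, Finset.sum_apply, ← LinearMap.sum_apply, hc1, hdiff, smul_smul,
    div_mul_cancel₀ _ (two_ne_zero)]

end Realization

/-! ### Density of the group generated by the twists -/

section Density

variable {g : ℕ}

/-- An automorphism trivial up to order `n` is made trivial up to order `n + 1` by a product of
twists. -/
theorem exists_twist_succ {n : ℕ} (hn : 2 ≤ n) (w : GenMCG g)
    (h : ∀ x, malcevVal (w.1 (toMalcev g (FreeGroup.of x))) - hat g (pt (FreeGroup.of x)) ∈
      filt g n) : ∃ T ∈ twistGroup g, ∀ x,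
    malcevVal ((hatAutToMCG g T * w).1 (toMalcev g (FreeGroup.of x))) -
      hat g (pt (FreeGroup.of x)) ∈ filt g (n + 1) := by
  obtain ⟨c, hc⟩ := exists_displacement_eq hn w h
  have h1 : -(∑ p, fun y => c p • lvl (aug g) (n + 1)
      (sigmaL (gX p.1 * lieMono p.2.1) (pt (FreeGroup.of y)))) ∈ twistLead g n hn :=
    neg_mem (sum_mem fun p _ => smul_sigmaL_mem_twistLead hn p.1 p.2 (c p))
  obtain ⟨T, hT, hT1, hT2⟩ := h1
  refine ⟨T, hT, fun x => ?_⟩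
  have h2 := hatAut_sub_mem (T := T) (fun x => filt_anti hn (hT1 x)) (h x)
  have h3 : T.1 (hat g (pt (FreeGroup.of x))) - hat g (pt (FreeGroup.of x)) +
      hat g (∑ p, c p • sigmaL (gX p.1 * lieMono p.2.1) (pt (FreeGroup.of x))) ∈
        filt g (n + 1) := by
    rw [mem_filt]
    change (T.1 (hat g (pt (FreeGroup.of x))) - hat g (pt (FreeGroup.of x))).1 (n + 1) +
      lvl (aug g) (n + 1) (∑ p, c p • sigmaL (gX p.1 * lieMono p.2.1) (pt (FreeGroup.of x))) = 0
    rw [hT2, Pi.neg_apply, Finset.sum_apply, map_sum, neg_add_eq_zero]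
    exact Finset.sum_congr rfl fun p _ => (map_smul _ _ _).symm
  change T.1 (malcevVal (w.1 (toMalcev g (FreeGroup.of x)))) - hat g (pt (FreeGroup.of x)) ∈ _
  convert add_mem (add_mem h2 (hc x)) h3 using 1
  rw [map_sub]
  abel

theorem exists_twist_mem_johnson (w : GenMCG g) (k : ℕ) :
    ∃ T ∈ twistGroup g, hatAutToMCG g T * w ∈ johnson g k := by
  have key : ∀ n, 2 ≤ n → ∃ T ∈ twistGroup g, ∀ x,
      malcevVal ((hatAutToMCG g T * w).1 (toMalcev g (FreeGroup.of x))) -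
        hat g (pt (FreeGroup.of x)) ∈ filt g n := by
    intro n hn
    induction n, hn using Nat.le_induction with
    | base => exact exists_twist_two w
    | succ n hn ih =>
      obtain ⟨S, hS, h⟩ := ih
      obtain ⟨T, hT, h'⟩ := exists_twist_succ hn _ h
      refine ⟨T * S, mul_mem hT hS, fun x => ?_⟩
      rw [map_mul, mul_assoc]
      exact h' x
  obtain ⟨T, hT, h⟩ := key (k + 2) (by omega)
  exact ⟨T, hT, sub_mem_filt_of_gen _ fun x => filt_anti (by omega) (h x)⟩

theorem dense_closure_isRationalTwist (g : ℕ) :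
    Dense (Subgroup.closure {t : GenMCG g | ∃ (r : ℚ) (γ : Pi1 g), IsRationalTwist r γ t} :
      Set (GenMCG g)) := by
  have hle : twistGroup g ≤ (Subgroup.closure
      {t : GenMCG g | ∃ (r : ℚ) (γ : Pi1 g), IsRationalTwist r γ t}).comap (hatAutToMCG g) := by
    rw [twistGroup, Subgroup.closure_le]
    rintro _ ⟨r, γ, rfl⟩
    exact Subgroup.subset_closure ⟨r, γ, isRationalTwist_twist r γ⟩
  intro u
  rw [mem_closure_iff]
  intro U hU huU
  obtain ⟨k, hk⟩ := hU u huU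
  obtain ⟨T, hT, h⟩ := exists_twist_mem_johnson u k
  refine ⟨(hatAutToMCG g T)⁻¹, hk _ ?_, inv_mem (hle hT)⟩
  rw [← mul_inv_rev]
  exact inv_mem h

end Density

end GenTwist

end

open GenTwist
theorem mainTheorem1 (g : ℕ) :
    (∀ (r : ℚ) (γ : Pi1 g), ∃! t : GenMCG g, IsRationalTwist r γ t) ∧
    Dense (Subgroup.closure {t : GenMCG g | ∃ (r : ℚ) (γ : Pi1 g), IsRationalTwist r γ t} :
      Set (GenMCG g)) :=
  ⟨existsUnique_isRationalTwist, dense_closure_isRationalTwist g⟩
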